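/- Let $k$ be a field, let $\Gamma$ be a Hopf algebra over $k$ with bijective antipode $S$, comultiplication $\gamma\mapsto\sum\gamma_1\otimes\gamma_2$ and counit $\epsilon$, and let $A$ be a (left) $\Gamma$-module algebra. The smash product $A\#\Gamma$ is the algebra with underlying space $A\otimes\Gamma$ and product $(a\otimes\gamma)(b\otimes\delta)=\sum a(\gamma_1 b)\otimes\gamma_2\delta$. Let $\tau:K\to A$ be a resolution $\cdots\to K^{-1}\to K^0\to A\to 0$ of $A$ by $\Gamma$-equivariant $A$-bimodules (that is, $\Gamma$ acts on each $K^{-q}$, the $A$-actions $A\otimes K^{-q}\to K^{-q}$ and $K^{-q}\otimes A\to K^{-q}$ are $\Gamma$-linear, and the differential and $\tau$ are $\Gamma$-linear bimodule maps), such that each $K^{-q}$ is free as an $A$-bimodule on a $\Gamma$-stable subspace, i.e. $A\otimes\bar K^{-q}\otimes A\cong K^{-q}$ by the action map, and let $\omega:K\to K\otimes_AK$, $\omega(x)=\omega_1\otimes\omega_2$ (sum understood), be a map of complexes of $\Gamma$-equivariant $A$-bimodules with $(\tau\otimes\tau)\omega=\tau$. Let $\xi:L\to k$ be a resolution of the trivial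 right $\Gamma$-module $k$ by projective right $\Gamma$-modules, and let $\sigma:L\to L\otimes L$, $\sigma(l)=\sigma_1\otimes\sigma_2$, be a map of complexes of right $\Gamma$-modules with $(\xi\otimes\xi)\sigma=\xi$. For left $A\#\Gamma$-modules $M$ and $N$, let $\mathrm{Hom}_A(K\otimes_AM,N)$ be the complex with $\mathrm{Hom}_A(K^{-q}\otimes_AM,N)$ in degree $q$ and differential $u\mapsto-(-1)^{|u|}u\circ(d\otimes\mathrm{id})$, with the right $\Gamma$-action $(u\cdot\gamma)(z)=\sum S(\gamma_1)u(\gamma_2z)$, where $\Gamma$ acts diagonally on $K\otimes_AM$. Let $\mathrm{Hom}_\Gamma(L,\mathrm{Hom}_A(K\otimes_AM,N))$ be the complex whose elements of degree $n$ are the families of right $\Gamma$-linear maps $L^{-p}\to\mathrm{Hom}_A(K^{-q}\otimes_AM,N)$, $p+q=n$, with differential $f\mapsto d\circ f-(-1)^{|f|}f\circ d$. Then there are $k$-linear isomorphisms $$\mathrm{Ext}^n_{A\#\Gamma}(M,N)\cong\mathrm{H}^n\big(\mathrm{Hom}_\Gamma(L,\mathrm{Hom}_A(K\otimes_AM,N))\big),\qquad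 n\ge 0.$$ For $N=M$, the complex $\mathrm{Hom}_A(K\otimes_AM,M)$ has the product $(uv)(x\otimes m)=(-1)^{|v||\omega_1|}u(\omega_1\otimes v(\omega_2\otimes m))$, where $\omega_1\otimes\omega_2=\omega(x)$, and $\mathrm{Hom}_\Gamma(L,\mathrm{Hom}_A(K\otimes_AM,M))$ has the product $(fg)(l)=(-1)^{|g||\sigma_1|}f(\sigma_1)g(\sigma_2)$, where $\sigma_1\otimes\sigma_2=\sigma(l)$. This induces a product on cohomology, and there are $k$-linear isomorphisms $$\mathrm{Ext}^n_{A\#\Gamma}(M,M)\cong\mathrm{H}^n\big(\mathrm{Hom}_\Gamma(L,\mathrm{Hom}_A(K\otimes_AM,M))\big),\qquad n\ge0,$$ which carry the Yoneda product $x\cdot y$ (composition, $y$ first) to this product and $\mathrm{id}_M$ to the class of the map $l\mapsto\big(x\otimes m\mapsto\xi(l)\tau(x)m\big)$; that is, they form an isomorphism of graded algebras. -/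

import Mathlib

open CategoryTheory
open scoped TensorProduct Coalgebra ModuleCat

universe u

section Sweedler

variable {k Γ X : Type*} [Field k] [Ring Γ] [HopfAlgebra k Γ] [AddCommGroup X] [Module k X]

lemma sweedler_sum (B : Γ →ₗ[k] Γ →ₗ[k] X) (γ : Γ) :
    ∑ i ∈ (ℛ k γ).index, B ((ℛ k γ).left i) ((ℛ k γ).right i) =
      TensorProduct.lift B (Coalgebra.comul γ) := by
  rw [← (ℛ k γ).eq, map_sum]
  simp

lemma sweedler_coassoc (T : Γ →ₗ[k] Γ →ₗ[k] Γ →ₗ[k] X) (γ : Γ) :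
    ∑ i ∈ (ℛ k γ).index, ∑ j ∈ (ℛ k ((ℛ k γ).left i)).index,
        T ((ℛ k ((ℛ k γ).left i)).left j) ((ℛ k ((ℛ k γ).left i)).right j) ((ℛ k γ).right i) =
      ∑ i ∈ (ℛ k γ).index, ∑ j ∈ (ℛ k ((ℛ k γ).right i)).index,
        T ((ℛ k γ).left i) ((ℛ k ((ℛ k γ).right i)).left j)
          ((ℛ k ((ℛ k γ).right i)).right j) := by
  have h := Coalgebra.sum_tmul_tmul_eq (ℛ k γ) (fun i => ℛ k ((ℛ k γ).left i))
    (fun i => ℛ k ((ℛ k γ).right i))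
  have h2 := congrArg (TensorProduct.lift
    (((TensorProduct.uncurry (RingHom.id k) Γ Γ X)).comp T)) h
  simpa [map_sum] using h2

lemma sweedler_counit_left (f : Γ →ₗ[k] X) (γ : Γ) :
    ∑ i ∈ (ℛ k γ).index, Coalgebra.counit (R := k) ((ℛ k γ).left i) • f ((ℛ k γ).right i) =
      f γ := by
  conv_rhs => rw [← Coalgebra.sum_counit_smul (ℛ k γ)]
  simp [map_sum]

lemma sweedler_counit_right (f : Γ →ₗ[k] X) (γ : Γ) :
    ∑ i ∈ (ℛ k γ).index, Coalgebra.counit (R := k) ((ℛ k γ).right i) • f ((ℛ k γ).left i) =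
      f γ := by
  have h := Coalgebra.sum_tmul_counit_eq (R := k) (ℛ k γ)
  have h2 := congrArg (TensorProduct.lift ((LinearMap.lsmul k X).flip.comp f)) h
  rw [map_sum] at h2
  simpa only [TensorProduct.lift.tmul, LinearMap.comp_apply, LinearMap.flip_apply,
    LinearMap.lsmul_apply, one_smul] using h2

end Sweedler

/-- `A` is a module algebra over the Hopf algebra `Γ`. -/
class IsModuleAlgebra (k Γ A : Type*) [Field k] [Ring Γ] [HopfAlgebra k Γ] [Ring A] [Algebra k A]
    [Module Γ A] : Prop extends IsScalarTower k Γ A where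
  act_mul (γ : Γ) (a b : A) : γ • (a * b) =
    ∑ i ∈ (ℛ k γ).index, ((ℛ k γ).left i • a) * ((ℛ k γ).right i • b)
  act_one (γ : Γ) : γ • (1 : A) = algebraMap k A (Coalgebra.counit γ)

/-- The smash product `A # Γ`, with underlying vector space `A ⊗ Γ`. -/
def SmashProduct (k A Γ : Type*) [Field k] [Ring Γ] [HopfAlgebra k Γ] [Ring A] [Algebra k A] :
    Type _ := A ⊗[k] Γ

namespace SmashProduct

section
variable (k A Γ : Type*) [Field k] [Ring Γ] [HopfAlgebra k Γ] [Ring A] [Algebra k A]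

noncomputable instance : AddCommGroup (SmashProduct k A Γ) :=
  inferInstanceAs (AddCommGroup (A ⊗[k] Γ))

noncomputable instance : Module k (SmashProduct k A Γ) :=
  inferInstanceAs (Module k (A ⊗[k] Γ))

/-- The basic element `aγ = a ⊗ γ` of the smash product, as a bilinear map. -/
noncomputable def mk : A →ₗ[k] Γ →ₗ[k] SmashProduct k A Γ := TensorProduct.mk k A Γ

variable {k A Γ} in
lemma hom_ext {Z : Type*} [AddCommGroup Z] [Module k Z] {f g : SmashProduct k A Γ →ₗ[k] Z}
    (h : ∀ a γ, f (mk k A Γ a γ) = g (mk k A Γ a γ)) : f = g :=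
  TensorProduct.ext' h

variable {k A Γ} in
@[elab_as_elim]
lemma induction {P : SmashProduct k A Γ → Prop} (x : SmashProduct k A Γ) (zero : P 0)
    (mk : ∀ a γ, P (mk k A Γ a γ)) (add : ∀ x y, P x → P y → P (x + y)) : P x :=
  TensorProduct.induction_on x zero mk add

variable [Module Γ A] [IsModuleAlgebra k Γ A]

/-- For `γ`, `b` and `δ`, the bilinear map `(γ₁, γ₂) ↦ a (γ₁ • b) ⊗ γ₂ δ`. -/
noncomputable def mulAux (a : A) (b : A) (δ : Γ) : Γ →ₗ[k] Γ →ₗ[k] SmashProduct k A Γ :=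
  (mk k A Γ).compl₁₂
    ((LinearMap.mulLeft k a).comp ((Algebra.lsmul k k A).toLinearMap.flip b))
    (LinearMap.mulRight k δ)

lemma mulAux_apply (a b : A) (δ γ₁ γ₂ : Γ) :
    mulAux k A Γ a b δ γ₁ γ₂ = mk k A Γ (a * γ₁ • b) (γ₂ * δ) := rfl

/-- Left multiplication by `aγ` on the smash product, `bδ ↦ ∑ a (γ₁ • b) ⊗ γ₂ δ`. -/
noncomputable def mulPure (a : A) (γ : Γ) : SmashProduct k A Γ →ₗ[k] SmashProduct k A Γ :=
  TensorProduct.lift (LinearMap.mk₂ k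
    (fun b δ => TensorProduct.lift (mulAux k A Γ a b δ) (Coalgebra.comul γ))
    (by intro b b' δ; simp only [← sweedler_sum, mulAux_apply, smul_add, mul_add, map_add,
          LinearMap.add_apply, Finset.sum_add_distrib])
    (by intro c b δ; simp only [← sweedler_sum, mulAux_apply, smul_comm _ c, mul_smul_comm,
          map_smul, LinearMap.smul_apply, Finset.smul_sum])
    (by intro b δ δ'; simp only [← sweedler_sum, mulAux_apply, mul_add, map_add,
          Finset.sum_add_distrib])
    (by intro c b δ; simp only [← sweedler_sum, mulAux_apply, mul_smul_comm, map_smul,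
          Finset.smul_sum]))

lemma mulPure_mk (a : A) (γ : Γ) (b : A) (δ : Γ) : mulPure k A Γ a γ (mk k A Γ b δ) =
    TensorProduct.lift (mulAux k A Γ a b δ) (Coalgebra.comul γ) := rfl

/-- The multiplication of the smash product, `(aγ)(bδ) = ∑ a (γ₁ • b) ⊗ γ₂ δ`. -/
noncomputable def mulHom :
    SmashProduct k A Γ →ₗ[k] SmashProduct k A Γ →ₗ[k] SmashProduct k A Γ :=
  TensorProduct.lift (LinearMap.mk₂ k (mulPure k A Γ)
    (by
      intro a a' γ; apply hom_ext; intro b δ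
      simp only [LinearMap.add_apply, mulPure_mk, ← sweedler_sum, mulAux_apply, add_mul, map_add,
        Finset.sum_add_distrib])
    (by
      intro c a γ; apply hom_ext; intro b δ
      simp only [mulPure_mk, ← sweedler_sum, mulAux_apply, smul_mul_assoc, map_smul,
        LinearMap.smul_apply, Finset.smul_sum])
    (by
      intro a γ γ'; apply hom_ext; intro b δ
      simp only [LinearMap.add_apply, mulPure_mk, map_add])
    (by
      intro c a γ; apply hom_ext; intro b δ
      simp only [LinearMap.smul_apply, mulPure_mk, map_smul]))

lemma mulHom_mk (a b : A) (γ δ : Γ) :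
    mulHom k A Γ (mk k A Γ a γ) (mk k A Γ b δ) =
      TensorProduct.lift (mulAux k A Γ a b δ) (Coalgebra.comul γ) := rfl

lemma mulHom_mk' (a b : A) (γ δ : Γ) :
    mulHom k A Γ (mk k A Γ a γ) (mk k A Γ b δ) =
      ∑ i ∈ (ℛ k γ).index,
        mk k A Γ (a * (ℛ k γ).left i • b) ((ℛ k γ).right i * δ) := by
  rw [mulHom_mk, ← sweedler_sum]; rfl

lemma one_mulHom (x : SmashProduct k A Γ) : mulHom k A Γ (mk k A Γ 1 1) x = x := by
  suffices mulHom k A Γ (mk k A Γ 1 1) = LinearMap.id from LinearMap.congr_fun this x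
  apply hom_ext; intro b δ
  rw [mulHom_mk, Bialgebra.comul_one, Algebra.TensorProduct.one_def, TensorProduct.lift.tmul,
    mulAux_apply]
  simp

lemma mulHom_one (x : SmashProduct k A Γ) : mulHom k A Γ x (mk k A Γ 1 1) = x := by
  suffices (mulHom k A Γ).flip (mk k A Γ 1 1) = LinearMap.id from LinearMap.congr_fun this x
  apply hom_ext; intro a γ
  rw [LinearMap.flip_apply, mulHom_mk']
  have h := sweedler_counit_left (mk k A Γ a) γ
  simp only [IsModuleAlgebra.act_one (k := k), mul_one]
  rw [LinearMap.id_apply, ← h]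
  refine Finset.sum_congr rfl fun i _ => ?_
  rw [← Algebra.commutes, ← Algebra.smul_def, map_smul, LinearMap.smul_apply]

lemma lift_mulAux_mul (a c : A) (γ δ η : Γ) :
    TensorProduct.lift (mulAux k A Γ a c η) (Coalgebra.comul (γ * δ)) =
      ∑ i ∈ (ℛ k γ).index, ∑ j ∈ (ℛ k δ).index,
        mk k A Γ (a * ((ℛ k γ).left i * (ℛ k δ).left j) • c)
          ((ℛ k γ).right i * (ℛ k δ).right j * η) := by
  rw [Bialgebra.comul_mul, ← (ℛ k γ).eq, ← (ℛ k δ).eq, Finset.sum_mul_sum, map_sum]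
  refine Finset.sum_congr rfl fun i _ => ?_
  rw [map_sum]
  refine Finset.sum_congr rfl fun j _ => ?_
  rw [Algebra.TensorProduct.tmul_mul_tmul, TensorProduct.lift.tmul, mulAux_apply]

lemma mulHom_assoc_mk (a b c : A) (γ δ η : Γ) :
    mulHom k A Γ (mulHom k A Γ (mk k A Γ a γ) (mk k A Γ b δ)) (mk k A Γ c η) =
      mulHom k A Γ (mk k A Γ a γ) (mulHom k A Γ (mk k A Γ b δ) (mk k A Γ c η)) := by
  have key (x : A) (ζ : Γ) := sweedler_coassoc (k := k)
    ((((LinearMap.mul k A).compl₁₂ ((Algebra.lsmul k k A).toLinearMap.flip b)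
      ((Algebra.lsmul k k A).toLinearMap.flip x)).compr₂ (LinearMap.mulLeft k a)).compr₂
        ((mk k A Γ).compl₂ (LinearMap.mulRight k ζ))) γ
  simp only [LinearMap.compr₂_apply, LinearMap.compl₁₂_apply, LinearMap.compl₂_apply,
    LinearMap.flip_apply, LinearMap.mul_apply', LinearMap.mulLeft_apply,
    LinearMap.mulRight_apply, AlgHom.toLinearMap_apply, Algebra.lsmul_coe] at key
  rw [mulHom_mk' k A Γ a b, mulHom_mk' k A Γ b c]
  simp only [map_sum, LinearMap.sum_apply]
  simp only [mulHom_mk k A Γ _ c, lift_mulAux_mul, mulHom_mk' k A Γ a _ γ]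
  simp only [IsModuleAlgebra.act_mul (k := k) (Γ := Γ) _ b, Finset.mul_sum, map_sum,
    LinearMap.sum_apply]
  simp only [key]
  symm
  rw [Finset.sum_comm]
  simp only [mul_smul, mul_assoc]
  refine Finset.sum_congr rfl fun i _ => ?_
  rw [Finset.sum_comm]

lemma mulHom_assoc (x y z : SmashProduct k A Γ) :
    mulHom k A Γ (mulHom k A Γ x y) z = mulHom k A Γ x (mulHom k A Γ y z) := by
  induction x using SmashProduct.induction with
  | add x x' hx hx' => simp only [map_add, LinearMap.add_apply, hx, hx']
  | zero => simp only [map_zero, LinearMap.zero_apply]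
  | mk a γ =>
    induction y using SmashProduct.induction with
    | add y y' hy hy' => simp only [map_add, LinearMap.add_apply, hy, hy']
    | zero => simp only [map_zero, LinearMap.zero_apply]
    | mk b δ =>
      induction z using SmashProduct.induction with
      | add z z' hz hz' => simp only [map_add, hz, hz']
      | zero => simp only [map_zero]
      | mk c η => exact mulHom_assoc_mk k A Γ a b c γ δ η

noncomputable instance : Ring (SmashProduct k A Γ) where
  mul x y := mulHom k A Γ x y
  one := mk k A Γ 1 1
  left_distrib x y z := map_add (mulHom k A Γ x) y z
  right_distrib x y z := LinearMap.map_add₂ (mulHom k A Γ) x y z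
  zero_mul x := LinearMap.map_zero₂ (mulHom k A Γ) x
  mul_zero x := map_zero (mulHom k A Γ x)
  mul_assoc := mulHom_assoc k A Γ
  one_mul := one_mulHom k A Γ
  mul_one := mulHom_one k A Γ
  zsmul := (· • ·)
  zsmul_zero' := zero_zsmul
  zsmul_succ' n x := by simp [add_smul]
  zsmul_neg' n x := by
    change Int.negSucc n • x = -(((n + 1 : ℕ) : ℤ) • x)
    rw [Int.negSucc_eq, neg_smul]; rfl
  neg_add_cancel := neg_add_cancel
  nsmul := (· • ·)
  nsmul_zero := zero_nsmul
  nsmul_succ n x := succ_nsmul x n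
  sub_eq_add_neg := sub_eq_add_neg

lemma mul_def (x y : SmashProduct k A Γ) : x * y = mulHom k A Γ x y := rfl

lemma one_def : (1 : SmashProduct k A Γ) = mk k A Γ 1 1 := rfl

noncomputable instance : Algebra k (SmashProduct k A Γ) :=
  Algebra.ofModule
    (fun c x y => LinearMap.map_smul₂ (mulHom k A Γ) c x y)
    (fun c x y => map_smul (mulHom k A Γ x) c y)

/-- The embedding `a ↦ a ⊗ 1` of `A` into the smash product. -/
noncomputable def inl : A →+* SmashProduct k A Γ where
  toFun a := mk k A Γ a 1
  map_one' := rfl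
  map_mul' a b := by
    rw [mul_def, mulHom_mk, Bialgebra.comul_one, Algebra.TensorProduct.one_def,
      TensorProduct.lift.tmul, mulAux_apply]
    simp
  map_zero' := by simp
  map_add' a b := by simp

/-- The embedding `γ ↦ 1 ⊗ γ` of `Γ` into the smash product. -/
noncomputable def inr : Γ →+* SmashProduct k A Γ where
  toFun γ := mk k A Γ 1 γ
  map_one' := rfl
  map_mul' γ δ := by
    rw [mul_def, mulHom_mk']
    simp only [IsModuleAlgebra.act_one (k := k), one_mul]
    refine (sweedler_counit_left ((mk k A Γ 1).comp (LinearMap.mulRight k δ)) γ).symm.trans ?_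
    refine Finset.sum_congr rfl fun i _ => ?_
    rw [Algebra.algebraMap_eq_smul_one, map_smul, LinearMap.smul_apply]
    rfl
  map_zero' := by simp
  map_add' a b := by simp

lemma inl_mul_inr (a : A) (γ : Γ) : inl k A Γ a * inr k A Γ γ = mk k A Γ a γ := by
  change mulHom k A Γ (mk k A Γ a 1) (mk k A Γ 1 γ) = _
  rw [mulHom_mk, Bialgebra.comul_one, Algebra.TensorProduct.one_def,
      TensorProduct.lift.tmul, mulAux_apply]
  simp

lemma inr_mul_inl (a : A) (γ : Γ) : inr k A Γ γ * inl k A Γ a =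
    ∑ i ∈ (ℛ k γ).index,
      inl k A Γ ((ℛ k γ).left i • a) * inr k A Γ ((ℛ k γ).right i) := by
  simp only [inl_mul_inr]
  change mulHom k A Γ (mk k A Γ 1 γ) (mk k A Γ a 1) = _
  rw [mulHom_mk']
  simp

lemma inl_smul (c : k) (a : A) : inl k A Γ (c • a) = c • inl k A Γ a := by
  change mk k A Γ (c • a) 1 = c • mk k A Γ a 1
  simp

lemma inr_smul (c : k) (γ : Γ) : inr k A Γ (c • γ) = c • inr k A Γ γ := by
  change mk k A Γ 1 (c • γ) = c • mk k A Γ 1 γ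
  simp

end
end SmashProduct

/-- For a module `Y` over `A` and over `Γ`: the action map `A ⊗ Y → Y` is `Γ`-linear. -/
class IsEquivariantModule (k Γ A Y : Type*) [Field k] [Ring Γ] [HopfAlgebra k Γ] [Ring A]
    [Algebra k A] [Module Γ A] [AddCommGroup Y] [Module A Y] [Module Γ Y] : Prop where
  act_smul (γ : Γ) (a : A) (y : Y) : γ • (a • y) =
    ∑ i ∈ (ℛ k γ).index, ((ℛ k γ).left i • a) • ((ℛ k γ).right i • y)

/-- For an `A`-bimodule `X` (left and right `A`-actions, which commute) with an action of `Γ`: the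
action maps `A ⊗ X → X` and `X ⊗ A → X` are `Γ`-linear, that is, `X` is a `Γ`-equivariant
`A`-bimodule. -/
class IsEquivariantBimodule (k Γ A X : Type*) [Field k] [Ring Γ] [HopfAlgebra k Γ] [Ring A]
    [Algebra k A] [Module Γ A] [AddCommGroup X] [Module A X] [Module Aᵐᵒᵖ X]
    [SMulCommClass A Aᵐᵒᵖ X] [Module Γ X] : Prop extends IsEquivariantModule k Γ A X where
  act_op_smul (γ : Γ) (a : A) (x : X) : γ • (MulOpposite.op a • x) =
    ∑ i ∈ (ℛ k γ).index,
      MulOpposite.op ((ℛ k γ).right i • a) • ((ℛ k γ).left i • x)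

section Restriction

variable {k A Γ : Type u} [Field k] [Ring Γ] [HopfAlgebra k Γ] [Ring A] [Algebra k A]
  [Module Γ A] [IsModuleAlgebra k Γ A]

/-- The restriction of an `A # Γ`-module to `A`. -/
noncomputable instance (M : ModuleCat.{u} (SmashProduct k A Γ)) : Module A M :=
  Module.compHom M (SmashProduct.inl k A Γ)

/-- The restriction of an `A # Γ`-module to `Γ`. -/
noncomputable instance (M : ModuleCat.{u} (SmashProduct k A Γ)) : Module Γ M :=
  Module.compHom M (SmashProduct.inr k A Γ)

instance (M : ModuleCat.{u} (SmashProduct k A Γ)) : IsScalarTower k A M where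
  smul_assoc c a m := by
    change SmashProduct.inl k A Γ (c • a) • m = c • (SmashProduct.inl k A Γ a • m)
    rw [SmashProduct.inl_smul, smul_assoc]

instance (M : ModuleCat.{u} (SmashProduct k A Γ)) : IsScalarTower k Γ M where
  smul_assoc c γ m := by
    change SmashProduct.inr k A Γ (c • γ) • m = c • (SmashProduct.inr k A Γ γ • m)
    rw [SmashProduct.inr_smul, smul_assoc]

instance (M : ModuleCat.{u} (SmashProduct k A Γ)) : IsEquivariantModule k Γ A M where
  act_smul γ a m := by
    change SmashProduct.inr k A Γ γ • (SmashProduct.inl k A Γ a • m) = ∑ i ∈ _,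
      SmashProduct.inl k A Γ _ • (SmashProduct.inr k A Γ _ • m)
    simp only [← mul_smul]
    rw [SmashProduct.inr_mul_inl, Finset.sum_smul]

end Restriction

section BalTensor

/-- The relations `xa ⊗ y = x ⊗ ay`. -/
def BalTensor.relations (k A X Y : Type*) [Field k] [Ring A] [AddCommGroup X] [Module k X]
    [Module Aᵐᵒᵖ X] [AddCommGroup Y] [Module k Y] [Module A Y] : Submodule k (X ⊗[k] Y) :=
  Submodule.span k {t | ∃ (x : X) (a : A) (y : Y),
    (MulOpposite.op a • x) ⊗ₜ[k] y - x ⊗ₜ[k] (a • y) = t}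

/-- The tensor product `X ⊗_A Y` of a right and a left module over the `k`-algebra `A`. -/
def BalTensor (k A X Y : Type*) [Field k] [Ring A] [AddCommGroup X] [Module k X]
    [Module Aᵐᵒᵖ X] [AddCommGroup Y] [Module k Y] [Module A Y] : Type _ :=
  (X ⊗[k] Y) ⧸ BalTensor.relations k A X Y

namespace BalTensor

section Basic

variable (k A X Y : Type*) [Field k] [Ring A] [AddCommGroup X] [Module k X]
  [Module Aᵐᵒᵖ X] [AddCommGroup Y] [Module k Y] [Module A Y]

noncomputable instance : AddCommGroup (BalTensor k A X Y) :=
  inferInstanceAs (AddCommGroup ((X ⊗[k] Y) ⧸ BalTensor.relations k A X Y))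

noncomputable instance : Module k (BalTensor k A X Y) :=
  inferInstanceAs (Module k ((X ⊗[k] Y) ⧸ BalTensor.relations k A X Y))

/-- The element `x ⊗_A y`. -/
noncomputable def mk : X →ₗ[k] Y →ₗ[k] BalTensor k A X Y :=
  (TensorProduct.mk k X Y).compr₂ (BalTensor.relations k A X Y).mkQ

variable {k A X Y}

lemma mk_op_smul (x : X) (a : A) (y : Y) :
    mk k A X Y (MulOpposite.op a • x) y = mk k A X Y x (a • y) := by
  refine sub_eq_zero.mp ?_
  change (relations k A X Y).mkQ (_ ⊗ₜ _) - (relations k A X Y).mkQ (_ ⊗ₜ _) = 0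
  rw [← map_sub, Submodule.mkQ_apply, Submodule.Quotient.mk_eq_zero]
  exact Submodule.subset_span ⟨x, a, y, rfl⟩

@[elab_as_elim]
lemma induction {P : BalTensor k A X Y → Prop} (z : BalTensor k A X Y) (zero : P 0)
    (mk : ∀ x y, P (mk k A X Y x y)) (add : ∀ z w, P z → P w → P (z + w)) : P z := by
  obtain ⟨t, rfl⟩ := Submodule.mkQ_surjective _ z
  induction t using TensorProduct.induction_on with
  | zero => rw [map_zero]; exact zero
  | tmul x y => exact mk x y
  | add t s ht hs => rw [map_add]; exact add _ _ ht hs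

variable {Z : Type*} [AddCommGroup Z] [Module k Z]

lemma hom_ext {f g : BalTensor k A X Y →ₗ[k] Z}
    (h : ∀ x y, f (mk k A X Y x y) = g (mk k A X Y x y)) : f = g := by
  ext z
  induction z using BalTensor.induction with
  | zero => rw [map_zero, map_zero]
  | mk x y => exact h x y
  | add z w hz hw => rw [map_add, map_add, hz, hw]

/-- A balanced bilinear map factors through `X ⊗_A Y`. -/
noncomputable def lift (B : X →ₗ[k] Y →ₗ[k] Z)
    (h : ∀ x (a : A) y, B (MulOpposite.op a • x) y = B x (a • y)) : BalTensor k A X Y →ₗ[k] Z :=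
  (relations k A X Y).liftQ (TensorProduct.lift B) (by
    rw [relations, Submodule.span_le]
    rintro _ ⟨x, a, y, rfl⟩
    simp [h])

@[simp]
lemma lift_mk (B : X →ₗ[k] Y →ₗ[k] Z)
    (h : ∀ x (a : A) y, B (MulOpposite.op a • x) y = B x (a • y)) (x : X) (y : Y) :
    lift B h (mk k A X Y x y) = B x y := rfl

variable {X' Y' : Type*} [AddCommGroup X'] [Module k X']
  [Module Aᵐᵒᵖ X'] [AddCommGroup Y'] [Module k Y'] [Module A Y']

/-- The map `f ⊗_A g`. -/
noncomputable def map (f : X →ₗ[k] X') (g : Y →ₗ[k] Y')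
    (hf : ∀ (a : A) x, f (MulOpposite.op a • x) = MulOpposite.op a • f x)
    (hg : ∀ (a : A) y, g (a • y) = a • g y) : BalTensor k A X Y →ₗ[k] BalTensor k A X' Y' :=
  lift ((mk k A X' Y').compl₁₂ f g) (by
    intro x a y
    simp only [LinearMap.compl₁₂_apply]
    rw [hf, hg, mk_op_smul])

@[simp]
lemma map_mk (f : X →ₗ[k] X') (g : Y →ₗ[k] Y')
    (hf : ∀ (a : A) x, f (MulOpposite.op a • x) = MulOpposite.op a • f x)
    (hg : ∀ (a : A) y, g (a • y) = a • g y) (x : X) (y : Y) :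
    map f g hf hg (mk k A X Y x y) = mk k A X' Y' (f x) (g y) := rfl

end Basic

section LeftModule

variable {k A X Y : Type*} [Field k] [Ring A] [Algebra k A] [AddCommGroup X] [Module k X]
  [Module A X] [IsScalarTower k A X] [Module Aᵐᵒᵖ X] [SMulCommClass A Aᵐᵒᵖ X]
  [AddCommGroup Y] [Module k Y] [Module A Y]

/-- Left multiplication `x ⊗ y ↦ ax ⊗ y`. -/
noncomputable def leftMul (a : A) : BalTensor k A X Y →ₗ[k] BalTensor k A X Y :=
  map (Algebra.lsmul k k X a) LinearMap.id (fun b x => smul_comm a (MulOpposite.op b) x)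
    (fun _ _ => rfl)

lemma leftMul_mk (a : A) (x : X) (y : Y) :
    leftMul a (mk k A X Y x y) = mk k A X Y (a • x) y := rfl

noncomputable instance : Module A (BalTensor k A X Y) where
  smul a := leftMul a
  one_smul z := by
    change leftMul 1 z = z
    induction z using BalTensor.induction with
    | zero => rw [map_zero]
    | mk x y => rw [leftMul_mk, one_smul]
    | add z w hz hw => rw [map_add, hz, hw]
  mul_smul a b z := by
    change leftMul (a * b) z = leftMul a (leftMul b z)
    induction z using BalTensor.induction with
    | zero => simp only [map_zero]
    | mk x y => simp only [leftMul_mk, mul_smul]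
    | add z w hz hw => simp only [map_add, hz, hw]
  smul_zero a := map_zero (leftMul a)
  smul_add a := map_add (leftMul a)
  add_smul a b z := by
    change leftMul (a + b) z = leftMul a z + leftMul b z
    induction z using BalTensor.induction with
    | zero => simp only [map_zero, add_zero]
    | mk x y => simp only [leftMul_mk, add_smul, map_add, LinearMap.add_apply]
    | add z w hz hw => rw [map_add, map_add, map_add, hz, hw]; abel
  zero_smul z := by
    change leftMul 0 z = 0
    induction z using BalTensor.induction with
    | zero => rw [map_zero]
    | mk x y => simp only [leftMul_mk, zero_smul, map_zero, LinearMap.zero_apply]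
    | add z w hz hw => rw [map_add, hz, hw, add_zero]

lemma smul_mk (a : A) (x : X) (y : Y) : a • mk k A X Y x y = mk k A X Y (a • x) y := rfl

instance : IsScalarTower k A (BalTensor k A X Y) where
  smul_assoc c a z := by
    induction z using BalTensor.induction with
    | zero => simp only [smul_zero]
    | mk x y => simp only [smul_mk, smul_assoc, map_smul, LinearMap.smul_apply]
    | add z w hz hw => simp only [smul_add, hz, hw]

end LeftModule

section RightModule

variable {k A X Y : Type*} [Field k] [Ring A] [Algebra k A] [AddCommGroup X] [Module k X]
  [Module Aᵐᵒᵖ X] [AddCommGroup Y] [Module k Y] [Module A Y] [Module Aᵐᵒᵖ Y]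
  [IsScalarTower k Aᵐᵒᵖ Y] [SMulCommClass A Aᵐᵒᵖ Y]

/-- Right multiplication `x ⊗ y ↦ x ⊗ ya`. -/
noncomputable def rightMul (a : A) : BalTensor k A X Y →ₗ[k] BalTensor k A X Y :=
  map LinearMap.id (Algebra.lsmul k k Y (MulOpposite.op a)) (fun _ _ => rfl)
    (fun b y => (smul_comm b (MulOpposite.op a) y).symm)

lemma rightMul_mk (a : A) (x : X) (y : Y) :
    rightMul a (mk k A X Y x y) = mk k A X Y x (MulOpposite.op a • y) := rfl

end RightModule

section Diagonal

variable {k Γ A X Y : Type*} [Field k] [Ring Γ] [HopfAlgebra k Γ] [Ring A] [Algebra k A]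
  [Module Γ A] [IsScalarTower k Γ A]
  [AddCommGroup X] [Module k X] [Module A X] [Module Aᵐᵒᵖ X] [IsScalarTower k Aᵐᵒᵖ X]
  [SMulCommClass A Aᵐᵒᵖ X] [Module Γ X] [IsScalarTower k Γ X] [IsEquivariantBimodule k Γ A X]
  [AddCommGroup Y] [Module k Y] [Module A Y] [IsScalarTower k A Y] [Module Γ Y]
  [IsScalarTower k Γ Y] [IsEquivariantModule k Γ A Y]

/-- The diagonal action of `γ ∈ Γ` on `X ⊗_A Y`, `x ⊗ y ↦ ∑ γ₁ x ⊗ γ₂ y`. -/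
noncomputable def diag (γ : Γ) : BalTensor k A X Y →ₗ[k] BalTensor k A X Y :=
  lift (∑ i ∈ (ℛ k γ).index, (mk k A X Y).compl₁₂ (Algebra.lsmul k k X ((ℛ k γ).left i))
      (Algebra.lsmul k k Y ((ℛ k γ).right i))) (by
    intro x a y
    have key := sweedler_coassoc (k := k) (
      LinearMap.mk₂ k (fun g₁ g₂ => ((mk k A X Y) (MulOpposite.op (g₂ • a) • g₁ • x)).comp
        ((Algebra.lsmul k k Y).toLinearMap.flip y))
        (by intro g g' h; simp only [add_smul, smul_add, map_add, LinearMap.add_comp])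
        (by intro c g h
            rw [smul_assoc, smul_comm (MulOpposite.op (h • a)) c, map_smul, LinearMap.smul_comp])
        (by intro g h h'
            simp only [add_smul, MulOpposite.op_add, map_add, LinearMap.add_comp])
        (by intro c g h
            rw [smul_assoc, MulOpposite.op_smul, smul_assoc, map_smul, LinearMap.smul_comp])) γ
    simp only [LinearMap.sum_apply, LinearMap.compl₁₂_apply, Algebra.lsmul_coe,
      IsEquivariantBimodule.act_op_smul (k := k) (Γ := Γ) _ a x,
      IsEquivariantModule.act_smul (k := k) (Γ := Γ) _ a y, map_sum]
    simp only [LinearMap.mk₂_apply, LinearMap.comp_apply, LinearMap.flip_apply,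
      AlgHom.toLinearMap_apply, Algebra.lsmul_coe] at key
    rw [key]
    simp only [mk_op_smul])

lemma diag_mk (γ : Γ) (x : X) (y : Y) : diag γ (mk k A X Y x y) =
    ∑ i ∈ (ℛ k γ).index, mk k A X Y ((ℛ k γ).left i • x) ((ℛ k γ).right i • y) := by
  simp [diag]

end Diagonal

end BalTensor

end BalTensor

/-- The action map `A ⊗ V ⊗ A → X`, `a ⊗ v ⊗ b ↦ a v b`, for a subspace `V` of a bimodule `X`. -/
noncomputable def bimoduleAction (k A : Type*) {X : Type*} [Field k] [Ring A] [Algebra k A]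
    [AddCommGroup X] [Module k X] [Module A X] [Module Aᵐᵒᵖ X] [IsScalarTower k A X]
    [IsScalarTower k Aᵐᵒᵖ X] (V : Submodule k X) : A ⊗[k] (V ⊗[k] A) →ₗ[k] X :=
  TensorProduct.lift ((LinearMap.llcomp k (V ⊗[k] A) X X ∘ₗ
    (Algebra.lsmul k k X).toLinearMap).flip
      (TensorProduct.lift (((Algebra.lsmul k k X).toLinearMap ∘ₗ
        (MulOpposite.opLinearEquiv k (M := A)).toLinearMap).flip ∘ₗ V.subtype)))

lemma bimoduleAction_tmul {k A X : Type*} [Field k] [Ring A] [Algebra k A]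
    [AddCommGroup X] [Module k X] [Module A X] [Module Aᵐᵒᵖ X] [IsScalarTower k A X]
    [IsScalarTower k Aᵐᵒᵖ X] (V : Submodule k X) (a b : A) (v : V) :
    bimoduleAction k A V (a ⊗ₜ (v ⊗ₜ b)) = a • MulOpposite.op b • (v : X) := rfl

/-- A `Γ`-equivariant `A`-bimodule resolution `⋯ → X 1 → X 0 → A → 0` of `A` which in each degree
is free as an `A`-bimodule on a `Γ`-stable subspace. -/
structure EquivariantResolution (k A Γ : Type u) [Field k] [Ring Γ] [HopfAlgebra k Γ] [Ring A]
    [Algebra k A] [Module Γ A] [IsModuleAlgebra k Γ A] where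
  X : ℕ → Type u
  [addCommGroup : ∀ n, AddCommGroup (X n)]
  [moduleField : ∀ n, Module k (X n)]
  [moduleLeft : ∀ n, Module A (X n)]
  [moduleRight : ∀ n, Module Aᵐᵒᵖ (X n)]
  [moduleHopf : ∀ n, Module Γ (X n)]
  [towerLeft : ∀ n, IsScalarTower k A (X n)]
  [towerRight : ∀ n, IsScalarTower k Aᵐᵒᵖ (X n)]
  [towerHopf : ∀ n, IsScalarTower k Γ (X n)]
  [bimodule : ∀ n, SMulCommClass A Aᵐᵒᵖ (X n)]
  [equivariant : ∀ n, IsEquivariantBimodule k Γ A (X n)]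
  /-- the differential -/
  d : ∀ n, X (n + 1) →ₗ[k] X n
  d_smul : ∀ n (a : A) x, d n (a • x) = a • d n x
  d_op_smul : ∀ n (a : A) x, d n (MulOpposite.op a • x) = MulOpposite.op a • d n x
  d_act : ∀ n (γ : Γ) x, d n (γ • x) = γ • d n x
  /-- the augmentation `τ` -/
  aug : X 0 →ₗ[k] A
  aug_smul : ∀ (a : A) x, aug (a • x) = a * aug x
  aug_op_smul : ∀ (a : A) x, aug (MulOpposite.op a • x) = aug x * a
  aug_act : ∀ (γ : Γ) x, aug (γ • x) = γ • aug x
  aug_surjective : Function.Surjective aug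
  exact_aug : Function.Exact (d 0) aug
  exact_d : ∀ n, Function.Exact (d (n + 1)) (d n)
  /-- the base space of the free bimodule `X n` -/
  base : ∀ n, Submodule k (X n)
  base_act : ∀ n (γ : Γ), ∀ x ∈ base n, γ • x ∈ base n
  base_free : ∀ n, Function.Bijective (bimoduleAction k A (base n))

attribute [instance] EquivariantResolution.addCommGroup EquivariantResolution.moduleField
  EquivariantResolution.moduleLeft EquivariantResolution.moduleRight
  EquivariantResolution.moduleHopf EquivariantResolution.towerLeft
  EquivariantResolution.towerRight EquivariantResolution.towerHopf
  EquivariantResolution.bimodule EquivariantResolution.equivariant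

namespace EquivariantResolution

variable {k A Γ : Type u} [Field k] [Ring Γ] [HopfAlgebra k Γ] [Ring A]
  [Algebra k A] [Module Γ A] [IsModuleAlgebra k Γ A] (K : EquivariantResolution k A Γ)

/-- The map `d ⊗ id` on `K ⊗_A Y`. -/
noncomputable def dLeft (n : ℕ) (Y : Type*) [AddCommGroup Y] [Module k Y] [Module A Y] :
    BalTensor k A (K.X (n + 1)) Y →ₗ[k] BalTensor k A (K.X n) Y :=
  BalTensor.map (K.d n) LinearMap.id (K.d_op_smul n) (fun _ _ => rfl)

lemma dLeft_smul (n : ℕ) (Y : Type*) [AddCommGroup Y] [Module k Y] [Module A Y] (a : A)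
    (z : BalTensor k A (K.X (n + 1)) Y) : K.dLeft n Y (a • z) = a • K.dLeft n Y z := by
  induction z using BalTensor.induction with
  | zero => simp only [smul_zero, map_zero]
  | mk x y => simp only [dLeft, BalTensor.smul_mk, BalTensor.map_mk, K.d_smul]
  | add z w hz hw => simp only [smul_add, map_add, hz, hw]

/-- The map `id ⊗ d` on `X ⊗_A K`. -/
noncomputable def dRight (n : ℕ) (X : Type*) [AddCommGroup X] [Module k X] [Module Aᵐᵒᵖ X] :
    BalTensor k A X (K.X (n + 1)) →ₗ[k] BalTensor k A X (K.X n) :=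
  BalTensor.map LinearMap.id (K.d n) (fun _ _ => rfl) (K.d_smul n)

/-- The map `τ ⊗ τ : K₀ ⊗_A K₀ → A ⊗_A A = A`. -/
noncomputable def augTensor : BalTensor k A (K.X 0) (K.X 0) →ₗ[k] A :=
  BalTensor.lift ((LinearMap.mul k A).compl₁₂ K.aug K.aug) (by
    intro x a y
    simp only [LinearMap.compl₁₂_apply, LinearMap.mul_apply', K.aug_op_smul, K.aug_smul,
      mul_assoc])

/-- A diagonal map `ω : K → K ⊗_A K`: a morphism of complexes of `Γ`-equivariant `A`-bimodules
which is compatible with the augmentations to `A`. Here `comp n i j` is the component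
`K_n → K_i ⊗_A K_j`, which vanishes unless `i + j = n`. -/
structure Diagonal where
  comp : ∀ n i j, K.X n →ₗ[k] BalTensor k A (K.X i) (K.X j)
  comp_eq_zero : ∀ n i j, i + j ≠ n → comp n i j = 0
  comp_smul : ∀ n i j (a : A) x, comp n i j (a • x) = a • comp n i j x
  comp_op_smul : ∀ n i j (a : A) x,
    comp n i j (MulOpposite.op a • x) = BalTensor.rightMul a (comp n i j x)
  comp_act : ∀ n i j (γ : Γ) x, comp n i j (γ • x) = BalTensor.diag γ (comp n i j x)
  comp_d : ∀ n i j x, comp n i j (K.d n x) =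
    K.dLeft i (K.X j) (comp (n + 1) (i + 1) j x) +
      (-1 : k) ^ i • K.dRight j (K.X i) (comp (n + 1) i (j + 1) x)
  comp_aug : ∀ x, K.augTensor (comp 0 0 0 x) = K.aug x

end EquivariantResolution

/-- A projective resolution `⋯ → X 1 → X 0 → k → 0` of the trivial right `Γ`-module `k`. -/
structure TrivialResolution (k Γ : Type u) [Field k] [Ring Γ] [HopfAlgebra k Γ] where
  X : ℕ → Type u
  [addCommGroup : ∀ n, AddCommGroup (X n)]
  [moduleField : ∀ n, Module k (X n)]
  [moduleRight : ∀ n, Module Γᵐᵒᵖ (X n)]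
  [towerRight : ∀ n, IsScalarTower k Γᵐᵒᵖ (X n)]
  [projective : ∀ n, Module.Projective Γᵐᵒᵖ (X n)]
  /-- the differential -/
  d : ∀ n, X (n + 1) →ₗ[k] X n
  d_op_smul : ∀ n (γ : Γ) l, d n (MulOpposite.op γ • l) = MulOpposite.op γ • d n l
  /-- the augmentation `ξ` -/
  aug : X 0 →ₗ[k] k
  aug_op_smul : ∀ (γ : Γ) l, aug (MulOpposite.op γ • l) = aug l * Coalgebra.counit γ
  aug_surjective : Function.Surjective aug
  exact_aug : Function.Exact (d 0) aug
  exact_d : ∀ n, Function.Exact (d (n + 1)) (d n)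

attribute [instance] TrivialResolution.addCommGroup TrivialResolution.moduleField
  TrivialResolution.moduleRight TrivialResolution.towerRight TrivialResolution.projective

namespace TrivialResolution

variable {k Γ : Type u} [Field k] [Ring Γ] [HopfAlgebra k Γ] (L : TrivialResolution k Γ)

/-- The diagonal right action `(l ⊗ l') γ = ∑ l γ₁ ⊗ l' γ₂` on `L_i ⊗ L_j`. -/
noncomputable def diag (i j : ℕ) (γ : Γ) : L.X i ⊗[k] L.X j →ₗ[k] L.X i ⊗[k] L.X j :=
  ∑ s ∈ (ℛ k γ).index, TensorProduct.map
    (Algebra.lsmul k k (L.X i) (MulOpposite.op ((ℛ k γ).left s)))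
    (Algebra.lsmul k k (L.X j) (MulOpposite.op ((ℛ k γ).right s)))

/-- A diagonal map `σ : L → L ⊗ L`: a morphism of complexes of right `Γ`-modules which is
compatible with the augmentations to `k`. Here `comp n i j` is the component `L_n → L_i ⊗ L_j`,
which vanishes unless `i + j = n`. -/
structure Diagonal where
  comp : ∀ n i j, L.X n →ₗ[k] L.X i ⊗[k] L.X j
  comp_eq_zero : ∀ n i j, i + j ≠ n → comp n i j = 0
  comp_op_smul : ∀ n i j (γ : Γ) l, comp n i j (MulOpposite.op γ • l) = L.diag i j γ (comp n i j l)
  comp_d : ∀ n i j l, comp n i j (L.d n l) =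
    (L.d i).rTensor (L.X j) (comp (n + 1) (i + 1) j l) +
      (-1 : k) ^ i • (L.d j).lTensor (L.X i) (comp (n + 1) i (j + 1) l)
  comp_aug : ∀ l, TensorProduct.lid k k (TensorProduct.map L.aug L.aug (comp 0 0 0 l)) = L.aug l

end TrivialResolution

section Cochains

variable {k A Γ : Type u} [Field k] [Ring Γ] [HopfAlgebra k Γ] [Ring A]
  [Algebra k A] [Module Γ A] [IsModuleAlgebra k Γ A]
  (K : EquivariantResolution k A Γ) (L : TrivialResolution k Γ)
  (M N : ModuleCat.{u} (SmashProduct k A Γ))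

/-- The space `Hom_A(K_q ⊗_A M, N)`. -/
abbrev HomA (q : ℕ) : Type u := BalTensor k A (K.X q) M →ₗ[A] N

variable {K M N} in
/-- The right action of `γ` on maps `u : K_q ⊗_A M → N`, `(u · γ)(z) = ∑ S(γ₁) u(γ₂ z)`, where
`Γ` acts diagonally on `K_q ⊗_A M`. -/
noncomputable def homAct {q : ℕ} (u : HomA K M N q) (γ : Γ) (z : BalTensor k A (K.X q) M) : N :=
  ∑ i ∈ (ℛ k γ).index,
    HopfAlgebra.antipode k ((ℛ k γ).left i) • u (BalTensor.diag ((ℛ k γ).right i) z)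

/-- The differential `u ↦ -(-1)^q u (d ⊗ id)` of the complex `Hom_A(K ⊗_A M, N)`, in degree `q`. -/
noncomputable def homD (q : ℕ) : HomA K M N q →ₗ[k] HomA K M N (q + 1) where
  toFun u := -(-1 : k) ^ q •
    u.comp ({ K.dLeft q M with map_smul' := K.dLeft_smul q M } :
      BalTensor k A (K.X (q + 1)) M →ₗ[A] BalTensor k A (K.X q) M)
  map_add' u v := by rw [LinearMap.add_comp, smul_add]
  map_smul' c u := by
    rw [LinearMap.smul_comp, smul_comm]; rfl

lemma homD_apply (q : ℕ) (u : HomA K M N q) (z : BalTensor k A (K.X (q + 1)) M) :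
    homD K M N q u z = -(-1 : k) ^ q • u (K.dLeft q M z) := rfl

/-- Families of linear maps `L_p → Hom_A(K_q ⊗_A M, N)`, for all `p` and `q`. -/
def PreCochain : Type u := ∀ p q : ℕ, L.X p →ₗ[k] HomA K M N q

noncomputable instance : AddCommGroup (PreCochain K L M N) :=
  inferInstanceAs (AddCommGroup (∀ p q : ℕ, L.X p →ₗ[k] HomA K M N q))

noncomputable instance : Module k (PreCochain K L M N) :=
  inferInstanceAs (Module k (∀ p q : ℕ, L.X p →ₗ[k] HomA K M N q))

namespace PreCochain

variable {K L M N}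

@[simp] lemma add_apply (f g : PreCochain K L M N) (p q : ℕ) : (f + g) p q = f p q + g p q := rfl

@[simp] lemma sub_apply (f g : PreCochain K L M N) (p q : ℕ) : (f - g) p q = f p q - g p q := rfl

@[simp] lemma zero_apply (p q : ℕ) : (0 : PreCochain K L M N) p q = 0 := rfl

@[simp] lemma smul_apply (c : k) (f : PreCochain K L M N) (p q : ℕ) :
    (c • f) p q = c • f p q := rfl

lemma ext {f g : PreCochain K L M N} (h : ∀ p q l z, f p q l z = g p q l z) : f = g := by
  funext p q
  ext l z
  exact h p q l z

end PreCochain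

variable {K L M N} in
/-- The part `f ↦ d ∘ f` of the differential, where `d` is that of `Hom_A(K ⊗_A M, N)`. -/
noncomputable def diffK (f : PreCochain K L M N) : PreCochain K L M N
  | _, 0 => 0
  | p, q + 1 => homD K M N q ∘ₗ f p q

variable {K L M N} in
/-- The part `f ↦ f ∘ d` of the differential, where `d` is that of `L`. -/
noncomputable def diffL (f : PreCochain K L M N) : PreCochain K L M N
  | 0, _ => 0
  | p + 1, q => f p q ∘ₗ L.d p

/-- The differential `f ↦ d ∘ f - (-1)^n f ∘ d` of the hom complex on maps of degree `n`. -/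
noncomputable def diff (n : ℕ) : PreCochain K L M N →ₗ[k] PreCochain K L M N where
  toFun f := diffK f - (-1 : k) ^ n • diffL f
  map_add' f g := by
    refine PreCochain.ext fun p q l z => ?_
    rcases p with _ | p <;> rcases q with _ | q <;>
      simp [diffK, diffL] <;> abel
  map_smul' c f := by
    refine PreCochain.ext fun p q l z => ?_
    rcases p with _ | p <;> rcases q with _ | q <;>
      simp [diffK, diffL, smul_sub, smul_comm c]

lemma diff_apply (n : ℕ) (f : PreCochain K L M N) :
    diff K L M N n f = diffK f - (-1 : k) ^ n • diffL f := rfl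

/-- The space `Hom_Γ(L, Hom_A(K ⊗_A M, N))^n` of maps of degree `n`: the families of right
`Γ`-linear maps `L_p → Hom_A(K_q ⊗_A M, N)` with `p + q = n`. -/
def cochains (n : ℕ) : Submodule k (PreCochain K L M N) where
  carrier := {f | (∀ p q, p + q ≠ n → f p q = 0) ∧
    ∀ p q (γ : Γ) (l : L.X p) z, f p q (MulOpposite.op γ • l) z = homAct (f p q l) γ z}
  zero_mem' := ⟨fun _ _ _ => rfl, fun p q γ l z => by simp [homAct]⟩
  add_mem' := by
    rintro f g ⟨hf, hf'⟩ ⟨hg, hg'⟩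
    refine ⟨fun p q h => by simp [hf p q h, hg p q h], fun p q γ l z => ?_⟩
    simp only [PreCochain.add_apply, LinearMap.add_apply, hf', hg', homAct, smul_add,
      Finset.sum_add_distrib]
  smul_mem' := by
    rintro c f ⟨hf, hf'⟩
    refine ⟨fun p q h => by simp [hf p q h], fun p q γ l z => ?_⟩
    simp only [PreCochain.smul_apply, LinearMap.smul_apply, hf', homAct, Finset.smul_sum,
      smul_comm c (HopfAlgebra.antipode k (A := Γ) _)]

/-- The cocycles of degree `n`. -/
noncomputable def cocycles (n : ℕ) : Submodule k (PreCochain K L M N) :=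
  cochains K L M N n ⊓ LinearMap.ker (diff K L M N n)

/-- The coboundaries of degree `n`. -/
noncomputable def coboundaries : ℕ → Submodule k (PreCochain K L M N)
  | 0 => ⊥
  | n + 1 => (cochains K L M N n).map (diff K L M N n)

/-- The cohomology `H^n(Hom_Γ(L, Hom_A(K ⊗_A M, N)))`. -/
abbrev Cohomology (n : ℕ) : Type u :=
  cocycles K L M N n ⧸ (coboundaries K L M N n).submoduleOf (cocycles K L M N n)

end Cochains

section Products

variable {k A Γ : Type u} [Field k] [Ring Γ] [HopfAlgebra k Γ] [Ring A]
  [Algebra k A] [Module Γ A] [IsModuleAlgebra k Γ A]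
  {K : EquivariantResolution k A Γ} {L : TrivialResolution k Γ}
  (ω : K.Diagonal) (σ : L.Diagonal)
  {M : ModuleCat.{u} (SmashProduct k A Γ)}

/-- For `u : K_i ⊗_A M → M` and `v : K_j ⊗_A M → M`, the map
`K_i ⊗_A K_j → Hom_k(M, M)`, `x ⊗ y ↦ (m ↦ u(x ⊗ v(y ⊗ m)))`. -/
noncomputable def evalPair {i j : ℕ} (u : HomA K M M i) (v : HomA K M M j) :
    BalTensor k A (K.X i) (K.X j) →ₗ[k] (M →ₗ[k] M) :=
  BalTensor.lift ((LinearMap.llcomp k M M M).compl₁₂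
    ((BalTensor.mk k A (K.X i) M).compr₂ (u.restrictScalars k))
    ((BalTensor.mk k A (K.X j) M).compr₂ (v.restrictScalars k))) (by
      intro x a y
      ext m
      change u (BalTensor.mk k A _ _ (MulOpposite.op a • x) (v (BalTensor.mk k A _ _ y m))) =
        u (BalTensor.mk k A _ _ x (v (BalTensor.mk k A _ _ (a • y) m)))
      rw [BalTensor.mk_op_smul, ← map_smul, BalTensor.smul_mk])

lemma evalPair_mk {i j : ℕ} (u : HomA K M M i) (v : HomA K M M j) (x : K.X i) (y : K.X j) (m : M) :
    evalPair u v (BalTensor.mk k A _ _ x y) m =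
      u (BalTensor.mk k A _ _ x (v (BalTensor.mk k A _ _ y m))) := rfl

lemma evalPair_rightMul {i j : ℕ} (u : HomA K M M i) (v : HomA K M M j) (a : A)
    (w : BalTensor k A (K.X i) (K.X j)) (m : M) :
    evalPair u v (BalTensor.rightMul a w) m = evalPair u v w (a • m) := by
  induction w using BalTensor.induction with
  | zero => simp only [map_zero, LinearMap.zero_apply]
  | mk x y => rw [BalTensor.rightMul_mk, evalPair_mk, evalPair_mk, BalTensor.mk_op_smul]
  | add z w hz hw => simp only [map_add, LinearMap.add_apply, hz, hw]

lemma evalPair_smul {i j : ℕ} (u : HomA K M M i) (v : HomA K M M j) (a : A)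
    (w : BalTensor k A (K.X i) (K.X j)) (m : M) :
    evalPair u v (a • w) m = a • evalPair u v w m := by
  induction w using BalTensor.induction with
  | zero => simp only [smul_zero, map_zero, LinearMap.zero_apply]
  | mk x y => rw [BalTensor.smul_mk, evalPair_mk, evalPair_mk, ← BalTensor.smul_mk, map_smul]
  | add z w hz hw => simp only [smul_add, map_add, LinearMap.add_apply, hz, hw]

/-- For `u : K_i ⊗_A M → M` and `v : K_j ⊗_A M → M`, the map `K_q ⊗_A M → M`,
`x ⊗ m ↦ u(ω₁(x) ⊗ v(ω₂(x) ⊗ m))`, where `ω₁(x) ⊗ ω₂(x) ∈ K_i ⊗_A K_j`. -/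
noncomputable def mulHomA (q i j : ℕ) (u : HomA K M M i) (v : HomA K M M j) : HomA K M M q where
  __ := BalTensor.lift (evalPair u v ∘ₗ ω.comp q i j) (by
    intro x a m
    simp only [LinearMap.comp_apply, ω.comp_op_smul, evalPair_rightMul])
  map_smul' a z := by
    induction z using BalTensor.induction with
    | zero => simp
    | mk x m =>
      simp only [BalTensor.smul_mk, AddHom.toFun_eq_coe, LinearMap.coe_toAddHom,
        BalTensor.lift_mk, LinearMap.comp_apply, ω.comp_smul, evalPair_smul, RingHom.id_apply]
    | add z w hz hw =>
      simp only [AddHom.toFun_eq_coe, LinearMap.coe_toAddHom, RingHom.id_apply] at hz hw ⊢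
      simp only [smul_add, map_add, hz, hw]

lemma mulHomA_mk (q i j : ℕ) (u : HomA K M M i) (v : HomA K M M j) (x : K.X q) (m : M) :
    mulHomA ω q i j u v (BalTensor.mk k A _ _ x m) = evalPair u v (ω.comp q i j x) m := rfl

lemma evalPair_add_left {i j : ℕ} (u u' : HomA K M M i) (v : HomA K M M j) (w) :
    evalPair (u + u') v w = evalPair u v w + evalPair u' v w := by
  induction w using BalTensor.induction with
  | zero => simp only [map_zero, add_zero]
  | mk x y => rfl
  | add z w hz hw => rw [map_add, map_add, map_add, hz, hw]; abel

lemma evalPair_add_right {i j : ℕ} (u : HomA K M M i) (v v' : HomA K M M j) (w) :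
    evalPair u (v + v') w = evalPair u v w + evalPair u v' w := by
  induction w using BalTensor.induction with
  | zero => simp only [map_zero, add_zero]
  | mk x y => ext m; simp only [LinearMap.add_apply, evalPair_mk, map_add]
  | add z w hz hw => rw [map_add, map_add, map_add, hz, hw]; abel

lemma evalPair_smul_left {i j : ℕ} (c : k) (u : HomA K M M i) (v : HomA K M M j) (w) :
    evalPair (c • u) v w = c • evalPair u v w := by
  induction w using BalTensor.induction with
  | zero => simp only [map_zero, smul_zero]
  | mk x y => rfl
  | add z w hz hw => rw [map_add, map_add, hz, hw, smul_add]

lemma evalPair_smul_right {i j : ℕ} (c : k) (u : HomA K M M i) (v : HomA K M M j) (w) :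
    evalPair u (c • v) w = c • evalPair u v w := by
  induction w using BalTensor.induction with
  | zero => simp only [map_zero, smul_zero]
  | mk x y =>
    ext m
    simp only [LinearMap.smul_apply, evalPair_mk, map_smul]
    exact (u.restrictScalars k).map_smul c _
  | add z w hz hw => rw [map_add, map_add, hz, hw, smul_add]

/-- The map `mulHomA` as a bilinear map. -/
noncomputable def mulHomABilin (q i j : ℕ) :
    HomA K M M i →ₗ[k] HomA K M M j →ₗ[k] HomA K M M q :=
  LinearMap.mk₂ k (mulHomA ω q i j)
    (by
      intro u u' v; ext z
      induction z using BalTensor.induction with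
      | zero => simp only [map_zero]
      | mk x m => simp only [LinearMap.add_apply, mulHomA_mk, evalPair_add_left]
      | add z w hz hw => rw [map_add, map_add, hz, hw])
    (by
      intro c u v; ext z
      induction z using BalTensor.induction with
      | zero => simp only [map_zero]
      | mk x m => simp only [LinearMap.smul_apply, mulHomA_mk, evalPair_smul_left]
      | add z w hz hw => rw [map_add, map_add, hz, hw])
    (by
      intro u v v'; ext z
      induction z using BalTensor.induction with
      | zero => simp only [map_zero]
      | mk x m => simp only [LinearMap.add_apply, mulHomA_mk, evalPair_add_right]
      | add z w hz hw => rw [map_add, map_add, hz, hw])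
    (by
      intro c u v; ext z
      induction z using BalTensor.induction with
      | zero => simp only [map_zero]
      | mk x m => simp only [LinearMap.smul_apply, mulHomA_mk, evalPair_smul_right]
      | add z w hz hw => rw [map_add, map_add, hz, hw])

/-- For `s = ∑ l ⊗ l' ∈ L_{p₁} ⊗ L_{p₂}`, the map `∑ f(l) g(l') : K_q ⊗_A M → M`, where `f(l)` and
`g(l')` have degrees `q₁` and `q₂` and are multiplied (up to sign) by means of `ω`. -/
noncomputable def pairing (f g : PreCochain K L M M) (q p₁ q₁ p₂ q₂ : ℕ) :
    L.X p₁ ⊗[k] L.X p₂ →ₗ[k] HomA K M M q :=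
  TensorProduct.lift ((mulHomABilin ω q q₁ q₂).compl₁₂ (f p₁ q₁) (g p₂ q₂))

lemma pairing_tmul (f g : PreCochain K L M M) (q p₁ q₁ p₂ q₂ : ℕ) (l : L.X p₁) (l' : L.X p₂)
    (x : K.X q) (m : M) :
    pairing ω f g q p₁ q₁ p₂ q₂ (l ⊗ₜ l') (BalTensor.mk k A _ _ x m) =
      evalPair (f p₁ q₁ l) (g p₂ q₂ l') (ω.comp q q₁ q₂ x) m := rfl

/-- The product of a map `f` with a map `g` of degree `b`. On `l ∈ L_p` and `x ⊗ m ∈ K_q ⊗_A M` it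
is `∑ (-1)^(b |σ₁| + |g(σ₂)| |ω₁|) f(σ₁)(ω₁ ⊗ g(σ₂)(ω₂ ⊗ m))`, where `σ₁ ⊗ σ₂ = σ(l)`,
`ω₁ ⊗ ω₂ = ω(x)` and `|g(σ₂)| = |ω₂|` up to sign. -/
noncomputable def cup (b : ℕ) (f g : PreCochain K L M M) : PreCochain K L M M := fun p q =>
  ∑ s ∈ Finset.HasAntidiagonal.antidiagonal p, ∑ t ∈ Finset.HasAntidiagonal.antidiagonal q,
    (-1 : k) ^ (b * s.1 + t.2 * t.1) • pairing ω f g q s.1 t.1 s.2 t.2 ∘ₗ σ.comp p s.1 s.2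

lemma cup_apply (b : ℕ) (f g : PreCochain K L M M) (p q : ℕ) (l : L.X p)
    (z : BalTensor k A (K.X q) M) :
    cup ω σ b f g p q l z = ∑ s ∈ Finset.HasAntidiagonal.antidiagonal p,
      ∑ t ∈ Finset.HasAntidiagonal.antidiagonal q, (-1 : k) ^ (b * s.1 + t.2 * t.1) •
        pairing ω f g q s.1 t.1 s.2 t.2 (σ.comp p s.1 s.2 l) z := by
  simp [cup, LinearMap.sum_apply]

lemma evalPair_homD_left {i j : ℕ} (u : HomA K M M i) (v : HomA K M M j) (w) :
    evalPair (homD K M M i u) v w = -(-1 : k) ^ i • evalPair u v (K.dLeft i (K.X j) w) := by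
  induction w using BalTensor.induction with
  | zero => simp only [map_zero, smul_zero]
  | mk x y => rfl
  | add z w hz hw => rw [map_add, map_add, map_add, hz, hw, smul_add]

lemma evalPair_homD_right {i j : ℕ} (u : HomA K M M i) (v : HomA K M M j) (w) :
    evalPair u (homD K M M j v) w = -(-1 : k) ^ j • evalPair u v (K.dRight j (K.X i) w) := by
  induction w using BalTensor.induction with
  | zero => simp only [map_zero, smul_zero]
  | mk x y =>
    ext m
    change u (BalTensor.mk k A _ _ x (-(-1 : k) ^ j • v (BalTensor.mk k A _ _ (K.d j y) m))) =
      -(-1 : k) ^ j • u (BalTensor.mk k A _ _ x (v (BalTensor.mk k A _ _ (K.d j y) m)))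
    rw [map_smul]
    exact (u.restrictScalars k).map_smul _ _
  | add z w hz hw => rw [map_add, map_add, map_add, hz, hw, smul_add]


/-- The map `evalPair` as a bilinear map. -/
noncomputable def evalPairBilin (i j : ℕ) : HomA K M M i →ₗ[k] HomA K M M j →ₗ[k]
    BalTensor k A (K.X i) (K.X j) →ₗ[k] (M →ₗ[k] M) :=
  LinearMap.mk₂ k evalPair
    (fun u u' v => LinearMap.ext fun w => evalPair_add_left u u' v w)
    (fun c u v => LinearMap.ext fun w => evalPair_smul_left c u v w)
    (fun u v v' => LinearMap.ext fun w => evalPair_add_right u v v' w)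
    (fun c u v => LinearMap.ext fun w => evalPair_smul_right c u v w)

/-- The map `(l ⊗ l', w) ↦ evalPair (f l) (g l') w`. -/
noncomputable def pairE (f g : PreCochain K L M M) (p₁ q₁ p₂ q₂ : ℕ) :
    L.X p₁ ⊗[k] L.X p₂ →ₗ[k] BalTensor k A (K.X q₁) (K.X q₂) →ₗ[k] (M →ₗ[k] M) :=
  TensorProduct.lift ((evalPairBilin q₁ q₂).compl₁₂ (f p₁ q₁) (g p₂ q₂))

lemma pairE_tmul (f g : PreCochain K L M M) (p₁ q₁ p₂ q₂ : ℕ) (l : L.X p₁) (l' : L.X p₂) (w) :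
    pairE f g p₁ q₁ p₂ q₂ (l ⊗ₜ l') w = evalPair (f p₁ q₁ l) (g p₂ q₂ l') w := rfl

lemma pairing_mk (f g : PreCochain K L M M) (q p₁ q₁ p₂ q₂ : ℕ) (r : L.X p₁ ⊗[k] L.X p₂)
    (x : K.X q) (m : M) : pairing ω f g q p₁ q₁ p₂ q₂ r (BalTensor.mk k A _ _ x m) =
      pairE f g p₁ q₁ p₂ q₂ r (ω.comp q q₁ q₂ x) m := by
  induction r using TensorProduct.induction_on with
  | zero => simp only [map_zero, LinearMap.zero_apply]
  | tmul l l' => rfl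
  | add r s hr hs => simp only [map_add, LinearMap.add_apply, hr, hs]

lemma cup_mk (b : ℕ) (f g : PreCochain K L M M) (p q : ℕ) (l : L.X p) (x : K.X q) (m : M) :
    cup ω σ b f g p q l (BalTensor.mk k A _ _ x m) =
      ∑ s ∈ Finset.HasAntidiagonal.antidiagonal p, ∑ t ∈ Finset.HasAntidiagonal.antidiagonal q,
        (-1 : k) ^ (b * s.1 + t.2 * t.1) •
          pairE f g s.1 t.1 s.2 t.2 (σ.comp p s.1 s.2 l) (ω.comp q t.1 t.2 x) m := by
  simp only [cup_apply, pairing_mk]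

lemma pairE_left_zero (f g : PreCochain K L M M) (p₁ q₁ p₂ q₂ : ℕ) (h : f p₁ q₁ = 0) :
    pairE f g p₁ q₁ p₂ q₂ = 0 := by
  ext; simp [pairE, h]

lemma pairE_right_zero (f g : PreCochain K L M M) (p₁ q₁ p₂ q₂ : ℕ) (h : g p₂ q₂ = 0) :
    pairE f g p₁ q₁ p₂ q₂ = 0 := by
  ext; simp [pairE, h]

lemma pairE_diffK_left (f g : PreCochain K L M M) (p₁ q₁ p₂ q₂ : ℕ) (r w) :
    pairE (diffK f) g p₁ (q₁ + 1) p₂ q₂ r w =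
      -(-1 : k) ^ q₁ • pairE f g p₁ q₁ p₂ q₂ r (K.dLeft q₁ _ w) := by
  induction r using TensorProduct.induction_on with
  | zero => simp only [map_zero, LinearMap.zero_apply, smul_zero]
  | tmul l l' => exact evalPair_homD_left _ _ _
  | add r s hr hs => simp only [map_add, LinearMap.add_apply, hr, hs, smul_add]

lemma pairE_diffK_right (f g : PreCochain K L M M) (p₁ q₁ p₂ q₂ : ℕ) (r w) :
    pairE f (diffK g) p₁ q₁ p₂ (q₂ + 1) r w =
      -(-1 : k) ^ q₂ • pairE f g p₁ q₁ p₂ q₂ r (K.dRight q₂ _ w) := by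
  induction r using TensorProduct.induction_on with
  | zero => simp only [map_zero, LinearMap.zero_apply, smul_zero]
  | tmul l l' => exact evalPair_homD_right _ _ _
  | add r s hr hs => simp only [map_add, LinearMap.add_apply, hr, hs, smul_add]

lemma pairE_diffL_left (f g : PreCochain K L M M) (p₁ q₁ p₂ q₂ : ℕ) (r w) :
    pairE (diffL f) g (p₁ + 1) q₁ p₂ q₂ r w =
      pairE f g p₁ q₁ p₂ q₂ ((L.d p₁).rTensor _ r) w := by
  induction r using TensorProduct.induction_on with
  | zero => simp only [map_zero, LinearMap.zero_apply]
  | tmul l l' => rfl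
  | add r s hr hs => simp only [map_add, LinearMap.add_apply, hr, hs]

lemma pairE_diffL_right (f g : PreCochain K L M M) (p₁ q₁ p₂ q₂ : ℕ) (r w) :
    pairE f (diffL g) p₁ q₁ (p₂ + 1) q₂ r w =
      pairE f g p₁ q₁ p₂ q₂ ((L.d p₂).lTensor _ r) w := by
  induction r using TensorProduct.induction_on with
  | zero => simp only [map_zero, LinearMap.zero_apply]
  | tmul l l' => rfl
  | add r s hr hs => simp only [map_add, LinearMap.add_apply, hr, hs]

lemma ext_mk {f g : PreCochain K L M M}
    (h : ∀ p q l x m, f p q l (BalTensor.mk k A _ _ x m) = g p q l (BalTensor.mk k A _ _ x m)) :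
    f = g := by
  refine PreCochain.ext fun p q l z => ?_
  induction z using BalTensor.induction with
  | zero => simp only [map_zero]
  | add z w hz hw => rw [map_add, map_add, hz, hw]
  | mk x m => exact h p q l x m

/-- The part of the Leibniz rule which concerns the differential of `K`. -/
lemma diffK_cup (a b : ℕ) (f g : PreCochain K L M M) (hf : ∀ p q, p + q ≠ a → f p q = 0) :
    diffK (cup ω σ b f g) =
      cup ω σ b (diffK f) g + (-1 : k) ^ a • cup ω σ (b + 1) f (diffK g) := by
  refine ext_mk fun p q l x m => ?_
  simp only [PreCochain.add_apply, PreCochain.smul_apply, LinearMap.add_apply,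
      LinearMap.smul_apply, cup_mk]
  rcases q with _ | q
  · simp [pairE_left_zero (diffK f) g _ 0 _ _ rfl, pairE_right_zero f (diffK g) _ _ _ 0 rfl,
      diffK]
  change -(-1 : k) ^ q • cup ω σ b f g p q l (BalTensor.mk k A _ _ (K.d q x) m) = _
  rw [cup_mk, Finset.smul_sum, Finset.smul_sum, ← Finset.sum_add_distrib]
  refine Finset.sum_congr rfl fun s _ => ?_
  rw [Finset.Nat.sum_antidiagonal_succ (n := q), Finset.Nat.sum_antidiagonal_succ' (n := q)]
  simp only [pairE_left_zero (diffK f) g _ 0 _ _ rfl, pairE_right_zero f (diffK g) _ _ _ 0 rfl,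
    LinearMap.zero_apply, smul_zero, zero_add]
  rw [Finset.smul_sum, Finset.smul_sum, ← Finset.sum_add_distrib]
  refine Finset.sum_congr rfl fun t ht => ?_
  obtain rfl := Finset.HasAntidiagonal.mem_antidiagonal.mp ht
  rw [ω.comp_d, pairE_diffK_left, pairE_diffK_right]
  by_cases h : s.1 + t.1 = a
  · subst h
    simp only [map_add, map_smul, LinearMap.add_apply, LinearMap.smul_apply, smul_add, smul_smul]
    have e : (-1 : k) ^ s.1 * (-1 : k) ^ s.1 = 1 := by rw [← mul_pow]; simp
    congr 2
    · ring
    · linear_combination ((-1 : k) ^ (b * s.1) * (-1) ^ (t.1 * t.2) * (-1) ^ t.1 * (-1) ^ t.1 *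
        (-1) ^ t.2) * e
  · rw [pairE_left_zero f g _ _ _ _ (hf _ _ h)]
    simp

/-- The part of the Leibniz rule which concerns the differential of `L`. -/
lemma diffL_cup (b : ℕ) (f g : PreCochain K L M M) :
    diffL (cup ω σ b f g) =
      (-1 : k) ^ b • cup ω σ b (diffL f) g + cup ω σ (b + 1) f (diffL g) := by
  refine ext_mk fun p q l x m => ?_
  simp only [PreCochain.add_apply, PreCochain.smul_apply, LinearMap.add_apply,
      LinearMap.smul_apply, cup_mk]
  rcases p with _ | p
  · simp [pairE_left_zero (diffL f) g 0 _ _ _ rfl, pairE_right_zero f (diffL g) _ _ 0 _ rfl,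
      diffL]
  change cup ω σ b f g p q (L.d p l) (BalTensor.mk k A _ _ x m) = _
  rw [cup_mk, Finset.Nat.sum_antidiagonal_succ (n := p), Finset.Nat.sum_antidiagonal_succ' (n := p)]
  simp only [pairE_left_zero (diffL f) g 0 _ _ _ rfl, pairE_right_zero f (diffL g) _ _ 0 _ rfl,
    LinearMap.zero_apply, smul_zero, Finset.sum_const_zero, zero_add]
  rw [Finset.smul_sum, ← Finset.sum_add_distrib]
  refine Finset.sum_congr rfl fun s _ => ?_
  rw [Finset.smul_sum, ← Finset.sum_add_distrib]
  refine Finset.sum_congr rfl fun t _ => ?_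
  rw [σ.comp_d, pairE_diffL_left, pairE_diffL_right]
  simp only [map_add, map_smul, LinearMap.add_apply, LinearMap.smul_apply, smul_add, smul_smul]
  have e : (-1 : k) ^ b * (-1 : k) ^ b = 1 := by rw [← mul_pow]; simp
  congr 2
  · linear_combination (-(-1 : k) ^ (b * s.1) * (-1) ^ (t.1 * t.2)) * e
  · ring


lemma cup_add_left (b : ℕ) (f f' g : PreCochain K L M M) :
    cup ω σ b (f + f') g = cup ω σ b f g + cup ω σ b f' g := by
  refine ext_mk fun p q l x m => ?_
  have h (p₁ q₁ p₂ q₂) :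
      pairE (f + f') g p₁ q₁ p₂ q₂ = pairE f g p₁ q₁ p₂ q₂ + pairE f' g p₁ q₁ p₂ q₂ := by
    refine TensorProduct.ext' fun l l' => LinearMap.ext fun w => ?_
    exact evalPair_add_left _ _ _ _
  simp only [PreCochain.add_apply, LinearMap.add_apply, cup_mk, h, smul_add,
    Finset.sum_add_distrib]

lemma cup_smul_left (b : ℕ) (c : k) (f g : PreCochain K L M M) :
    cup ω σ b (c • f) g = c • cup ω σ b f g := by
  refine ext_mk fun p q l x m => ?_
  have h (p₁ q₁ p₂ q₂) : pairE (c • f) g p₁ q₁ p₂ q₂ = c • pairE f g p₁ q₁ p₂ q₂ := by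
    refine TensorProduct.ext' fun l l' => LinearMap.ext fun w => ?_
    exact evalPair_smul_left _ _ _ _
  simp only [PreCochain.smul_apply, LinearMap.smul_apply, cup_mk, h, Finset.smul_sum,
    smul_comm c]

lemma cup_add_right (b : ℕ) (f g g' : PreCochain K L M M) :
    cup ω σ b f (g + g') = cup ω σ b f g + cup ω σ b f g' := by
  refine ext_mk fun p q l x m => ?_
  have h (p₁ q₁ p₂ q₂) :
      pairE f (g + g') p₁ q₁ p₂ q₂ = pairE f g p₁ q₁ p₂ q₂ + pairE f g' p₁ q₁ p₂ q₂ := by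
    refine TensorProduct.ext' fun l l' => LinearMap.ext fun w => ?_
    exact evalPair_add_right _ _ _ _
  simp only [PreCochain.add_apply, LinearMap.add_apply, cup_mk, h, smul_add,
    Finset.sum_add_distrib]

lemma cup_smul_right (b : ℕ) (c : k) (f g : PreCochain K L M M) :
    cup ω σ b f (c • g) = c • cup ω σ b f g := by
  refine ext_mk fun p q l x m => ?_
  have h (p₁ q₁ p₂ q₂) : pairE f (c • g) p₁ q₁ p₂ q₂ = c • pairE f g p₁ q₁ p₂ q₂ := by
    refine TensorProduct.ext' fun l l' => LinearMap.ext fun w => ?_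
    exact evalPair_smul_right _ _ _ _
  simp only [PreCochain.smul_apply, LinearMap.smul_apply, cup_mk, h, Finset.smul_sum,
    smul_comm c]

/-- The product `cup` as a bilinear map. -/
noncomputable def cupBilin (b : ℕ) :
    PreCochain K L M M →ₗ[k] PreCochain K L M M →ₗ[k] PreCochain K L M M :=
  LinearMap.mk₂ k (cup ω σ b) (cup_add_left ω σ b) (cup_smul_left ω σ b)
    (cup_add_right ω σ b) (cup_smul_right ω σ b)

lemma cupBilin_apply (b : ℕ) (f g : PreCochain K L M M) :
    cupBilin ω σ b f g = cup ω σ b f g := rfl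

/-- The Leibniz rule. -/
lemma diff_cup (a b : ℕ) (f g : PreCochain K L M M) (hf : ∀ p q, p + q ≠ a → f p q = 0) :
    diff K L M M (a + b) (cup ω σ b f g) =
      cup ω σ b (diff K L M M a f) g + (-1 : k) ^ a • cup ω σ (b + 1) f (diff K L M M b g) := by
  simp only [diff_apply, diffK_cup ω σ a b f g hf, diffL_cup ω σ b f g]
  simp only [← cupBilin_apply, map_sub, LinearMap.sub_apply, map_smul, LinearMap.smul_apply,
    smul_sub, smul_add, smul_smul]
  have e : (-1 : k) ^ b * (-1 : k) ^ b = 1 := by rw [← mul_pow]; simp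
  have e' : (-1 : k) ^ (a + b) * (-1) ^ b = (-1) ^ a := by
    linear_combination (-1 : k) ^ a * e
  rw [e', pow_add]
  abel

lemma cup_support (a b : ℕ) (f g : PreCochain K L M M) (hf : ∀ p q, p + q ≠ a → f p q = 0)
    (hg : ∀ p q, p + q ≠ b → g p q = 0) (p q : ℕ) (h : p + q ≠ a + b) :
    cup ω σ b f g p q = 0 := by
  refine LinearMap.ext fun l => LinearMap.ext fun z => ?_
  rw [cup_apply]
  refine Finset.sum_eq_zero fun s hs => Finset.sum_eq_zero fun t ht => ?_
  have hs' := Finset.HasAntidiagonal.mem_antidiagonal.mp hs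
  have ht' := Finset.HasAntidiagonal.mem_antidiagonal.mp ht
  have h0 : pairing ω f g q s.1 t.1 s.2 t.2 = 0 := by
    by_cases h1 : s.1 + t.1 = a
    · have h2 : s.2 + t.2 ≠ b := by omega
      ext; simp [pairing, hg _ _ h2]
    · ext; simp [pairing, hf _ _ h1]
  simp [h0]

lemma sweedler_coassoc' {k Γ Y Z : Type*} [Field k] [Ring Γ] [HopfAlgebra k Γ] [AddCommGroup Y]
    [Module k Y] [AddCommGroup Z] [Module k Z] (B : Γ →ₗ[k] Γ →ₗ[k] Y) (c : Γ →ₗ[k] Y →ₗ[k] Z)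
    (γ : Γ) :
    ∑ i ∈ (ℛ k γ).index, ∑ j ∈ (ℛ k ((ℛ k γ).left i)).index,
        c ((ℛ k ((ℛ k γ).left i)).left j)
          (B ((ℛ k ((ℛ k γ).left i)).right j) ((ℛ k γ).right i)) =
      ∑ i ∈ (ℛ k γ).index, ∑ j ∈ (ℛ k ((ℛ k γ).right i)).index,
        c ((ℛ k γ).left i)
          (B ((ℛ k ((ℛ k γ).right i)).left j) ((ℛ k ((ℛ k γ).right i)).right j)) :=
  sweedler_coassoc (k := k)
    ({ toFun := fun g => B.compr₂ (c g)
       map_add' := fun g h => by ext; simp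
       map_smul' := fun r g => by ext; simp } : Γ →ₗ[k] Γ →ₗ[k] Γ →ₗ[k] Z) γ

/-- The diagonal action as a linear map. -/
noncomputable def diagHom {X Y : Type*}
    [AddCommGroup X] [Module k X] [Module A X] [Module Aᵐᵒᵖ X] [IsScalarTower k Aᵐᵒᵖ X]
    [SMulCommClass A Aᵐᵒᵖ X] [Module Γ X] [IsScalarTower k Γ X] [IsEquivariantBimodule k Γ A X]
    [AddCommGroup Y] [Module k Y] [Module A Y] [IsScalarTower k A Y] [Module Γ Y]
    [IsScalarTower k Γ Y] [IsEquivariantModule k Γ A Y] :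
    Γ →ₗ[k] BalTensor k A X Y →ₗ[k] BalTensor k A X Y where
  toFun := BalTensor.diag
  map_add' γ δ := BalTensor.hom_ext fun x y => by
    have h (γ : Γ) := sweedler_sum ((BalTensor.mk k A X Y).compl₁₂
      ((Algebra.lsmul k k X).toLinearMap.flip x) ((Algebra.lsmul k k Y).toLinearMap.flip y)) γ
    simp only [LinearMap.compl₁₂_apply, LinearMap.flip_apply, AlgHom.toLinearMap_apply,
      Algebra.lsmul_coe] at h
    simp only [LinearMap.add_apply, BalTensor.diag_mk, h, map_add]
  map_smul' c γ := BalTensor.hom_ext fun x y => by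
    have h (γ : Γ) := sweedler_sum ((BalTensor.mk k A X Y).compl₁₂
      ((Algebra.lsmul k k X).toLinearMap.flip x) ((Algebra.lsmul k k Y).toLinearMap.flip y)) γ
    simp only [LinearMap.compl₁₂_apply, LinearMap.flip_apply, AlgHom.toLinearMap_apply,
      Algebra.lsmul_coe] at h
    simp only [LinearMap.smul_apply, BalTensor.diag_mk, h, map_smul, RingHom.id_apply]

/-- For fixed `u` and `z`, the bilinear map `(γ₁, γ₂) ↦ S(γ₁) u(γ₂ z)`. -/
noncomputable def homActAux {N : ModuleCat.{u} (SmashProduct k A Γ)} {q : ℕ} (u : HomA K M N q)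
    (z : BalTensor k A (K.X q) M) : Γ →ₗ[k] Γ →ₗ[k] N :=
  ((Algebra.lsmul k k N).toLinearMap ∘ₗ HopfAlgebra.antipode k).compl₂
    (u.restrictScalars k ∘ₗ diagHom.flip z)

lemma homActAux_apply {N : ModuleCat.{u} (SmashProduct k A Γ)} {q : ℕ} (u : HomA K M N q)
    (z : BalTensor k A (K.X q) M) (γ δ : Γ) :
    homActAux u z γ δ = HopfAlgebra.antipode k γ • u (BalTensor.diag δ z) := rfl

lemma homAct_eq {N : ModuleCat.{u} (SmashProduct k A Γ)} {q : ℕ} (u : HomA K M N q) (γ : Γ)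
    (z : BalTensor k A (K.X q) M) :
    homAct u γ z = TensorProduct.lift (homActAux u z) (Coalgebra.comul γ) := by
  rw [← sweedler_sum]; rfl

lemma sum_smul_homAct {N : ModuleCat.{u} (SmashProduct k A Γ)} {q : ℕ} (u : HomA K M N q) (γ : Γ)
    (z : BalTensor k A (K.X q) M) :
    ∑ i ∈ (ℛ k γ).index, (ℛ k γ).left i • homAct u ((ℛ k γ).right i) z =
      u (BalTensor.diag γ z) := by
  have h := sweedler_coassoc' (homActAux u z) (Algebra.lsmul k k N).toLinearMap γ
  simp only [AlgHom.toLinearMap_apply, Algebra.lsmul_coe, homActAux_apply] at h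
  simp only [homAct, Finset.smul_sum]
  rw [← h]
  simp only [← mul_smul, ← Finset.sum_smul, HopfAlgebra.sum_mul_antipode_eq_smul]
  have h2 := sweedler_counit_left (u.restrictScalars k ∘ₗ diagHom.flip z) γ
  refine Eq.trans ?_ h2
  refine Finset.sum_congr rfl fun i _ => ?_
  rw [smul_assoc, one_smul]
  rfl

lemma evalPair_act_aux {i j : ℕ} (u : HomA K M M i) (v : HomA K M M j) (x : K.X i) (y : K.X j)
    (m : M) (γ : Γ) :
    ∑ s ∈ (ℛ k γ).index, u (BalTensor.diag ((ℛ k γ).left s)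
        (BalTensor.mk k A _ _ x (homAct v ((ℛ k γ).right s) (BalTensor.mk k A _ _ y m)))) =
      ∑ s ∈ (ℛ k γ).index, evalPair u v (BalTensor.diag ((ℛ k γ).left s)
        (BalTensor.mk k A _ _ x y)) ((ℛ k γ).right s • m) := by
  let n : Γ →ₗ[k] M :=
    TensorProduct.lift (homActAux v (BalTensor.mk k A _ _ y m)) ∘ₗ Coalgebra.comul
  have hn (γ : Γ) : n γ = homAct v γ (BalTensor.mk k A _ _ y m) := (homAct_eq _ _ _).symm
  let c : Γ →ₗ[k] M →ₗ[k] M := ((BalTensor.mk k A (K.X i) M).compr₂ (u.restrictScalars k)) ∘ₗ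
    (Algebra.lsmul k k (K.X i)).toLinearMap.flip x
  have hc (γ : Γ) (m : M) : c γ m = u (BalTensor.mk k A _ _ (γ • x) m) := rfl
  have h1 := sweedler_coassoc' ((Algebra.lsmul k k M).toLinearMap.compl₂ n) c γ
  simp only [LinearMap.compl₂_apply, AlgHom.toLinearMap_apply, Algebra.lsmul_coe, hn] at h1
  let B : Γ →ₗ[k] Γ →ₗ[k] M := (((BalTensor.mk k A (K.X j) M).compr₂ (v.restrictScalars k)) ∘ₗ
    (Algebra.lsmul k k (K.X j)).toLinearMap.flip y).compl₂
    ((Algebra.lsmul k k M).toLinearMap.flip m)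
  have hB (γ δ : Γ) : B γ δ = v (BalTensor.mk k A _ _ (γ • y) (δ • m)) := rfl
  have h2 := sweedler_coassoc' B c γ
  simp only [BalTensor.diag_mk, map_sum, LinearMap.sum_apply, evalPair_mk, ← hB, ← hc]
  rw [h1, h2]
  refine Finset.sum_congr rfl fun s _ => ?_
  rw [← map_sum, ← map_sum, sum_smul_homAct, BalTensor.diag_mk, map_sum]
  rfl

lemma evalPair_act {i j : ℕ} (f : PreCochain K L M M) (g : PreCochain K L M M) {a b : ℕ}
    (hf : f ∈ cochains K L M M a) (hg : g ∈ cochains K L M M b) (p₁ p₂ : ℕ)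
    (r : L.X p₁ ⊗[k] L.X p₂) (w : BalTensor k A (K.X i) (K.X j)) (m : M) (γ : Γ) :
    pairE f g p₁ i p₂ j (L.diag p₁ p₂ γ r) w m =
      ∑ s ∈ (ℛ k γ).index, HopfAlgebra.antipode k ((ℛ k γ).left s) •
        ∑ t ∈ (ℛ k ((ℛ k γ).right s)).index,
          pairE f g p₁ i p₂ j r (BalTensor.diag ((ℛ k ((ℛ k γ).right s)).left t) w)
            ((ℛ k ((ℛ k γ).right s)).right t • m) := by
  induction r using TensorProduct.induction_on with
  | zero => simp
  | add r r' hr hr' =>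
    simp only [map_add, LinearMap.add_apply, hr, hr', Finset.sum_add_distrib, smul_add]
  | tmul l l' =>
  induction w using BalTensor.induction with
  | zero => simp
  | add w w' hw hw' =>
    simp only [map_add, LinearMap.add_apply, hw, hw', Finset.sum_add_distrib, smul_add]
  | mk x y =>
  simp only [pairE_tmul, ← evalPair_act_aux]
  simp only [TrivialResolution.diag, LinearMap.sum_apply, map_sum, TensorProduct.map_tmul,
    pairE_tmul, evalPair_mk, Algebra.lsmul_coe, hf.2, hg.2]
  let n : Γ →ₗ[k] M :=
    TensorProduct.lift (homActAux (g p₂ j l') (BalTensor.mk k A _ _ y m)) ∘ₗ Coalgebra.comul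
  have hn (γ : Γ) : n γ = homAct (g p₂ j l') γ (BalTensor.mk k A _ _ y m) := (homAct_eq _ _ _).symm
  have h := sweedler_coassoc' ((diagHom.compl₂ ((BalTensor.mk k A (K.X i) M x) ∘ₗ n)).compr₂
    ((f p₁ i l).restrictScalars k))
    ((Algebra.lsmul k k M).toLinearMap ∘ₗ HopfAlgebra.antipode k) γ
  simp only [LinearMap.compr₂_apply, LinearMap.compl₂_apply, LinearMap.comp_apply,
    AlgHom.toLinearMap_apply, Algebra.lsmul_coe, hn] at h
  simp only [Finset.smul_sum]
  exact h

lemma homAct_add_right {N : ModuleCat.{u} (SmashProduct k A Γ)} {q : ℕ} (u : HomA K M N q) (γ : Γ)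
    (z w : BalTensor k A (K.X q) M) : homAct u γ (z + w) = homAct u γ z + homAct u γ w := by
  simp only [homAct, map_add, smul_add, Finset.sum_add_distrib]

lemma cup_mem (a b : ℕ) (f g : PreCochain K L M M)
    (hf : f ∈ cochains K L M M a) (hg : g ∈ cochains K L M M b) :
    cup ω σ b f g ∈ cochains K L M M (a + b) := by
  refine ⟨cup_support ω σ a b f g hf.1 hg.1, fun p q γ l z => ?_⟩
  induction z using BalTensor.induction with
  | zero => simp [homAct]
  | add z w hz hw => rw [map_add, homAct_add_right, hz, hw]
  | mk x m =>
  simp only [homAct, BalTensor.diag_mk, map_sum, cup_mk, ω.comp_act, σ.comp_op_smul,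
    evalPair_act f g hf hg]
  have step (F : Γ × Γ → ℕ × ℕ → ℕ × ℕ → M) (S : Finset (Γ × Γ))
      (P Q : Finset (ℕ × ℕ)) : ∑ j ∈ S, ∑ s ∈ P, ∑ t ∈ Q, F j s t =
        ∑ s ∈ P, ∑ t ∈ Q, ∑ j ∈ S, F j s t := by
    rw [Finset.sum_comm]
    exact Finset.sum_congr rfl fun s _ => Finset.sum_comm
  simp only [step, Finset.smul_sum]
  refine Finset.sum_congr rfl fun s _ => Finset.sum_congr rfl fun t _ =>
    Finset.sum_congr rfl fun i _ => Finset.sum_congr rfl fun j _ => ?_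
  rw [smul_comm]

lemma cup_mem_cocycles (a b : ℕ) {f g : PreCochain K L M M}
    (hf : f ∈ cocycles K L M M a) (hg : g ∈ cocycles K L M M b) :
    cup ω σ b f g ∈ cocycles K L M M (a + b) := by
  refine ⟨cup_mem ω σ a b f g hf.1 hg.1, ?_⟩
  have hf' : diff K L M M a f = 0 := hf.2
  have hg' : diff K L M M b g = 0 := hg.2
  change diff K L M M (a + b) (cup ω σ b f g) = 0
  rw [diff_cup ω σ a b f g hf.1.1, hf', hg', ← cupBilin_apply,
    ← cupBilin_apply, map_zero, map_zero, LinearMap.zero_apply, smul_zero, add_zero]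

lemma cup_mem_coboundaries_left (a b : ℕ) {f g : PreCochain K L M M}
    (hf : f ∈ coboundaries K L M M a) (hg : g ∈ cocycles K L M M b) :
    cup ω σ b f g ∈ coboundaries K L M M (a + b) := by
  rcases a with _ | a
  · obtain rfl : f = 0 := hf
    rw [← cupBilin_apply, map_zero, LinearMap.zero_apply]
    exact zero_mem _
  · obtain ⟨h, hh, rfl⟩ := hf
    have hg' : diff K L M M b g = 0 := hg.2
    rw [Nat.succ_add]
    refine ⟨cup ω σ b h g, cup_mem ω σ a b h g hh hg.1, ?_⟩
    rw [diff_cup ω σ a b h g hh.1, hg', ← cupBilin_apply ω σ (b + 1), map_zero, smul_zero,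
      add_zero]

lemma cup_mem_coboundaries_right (a b : ℕ) {f g : PreCochain K L M M}
    (hf : f ∈ cocycles K L M M a) (hg : g ∈ coboundaries K L M M b) :
    cup ω σ b f g ∈ coboundaries K L M M (a + b) := by
  rcases b with _ | b
  · obtain rfl : g = 0 := hg
    rw [← cupBilin_apply, map_zero]
    exact zero_mem _
  · obtain ⟨h, hh, rfl⟩ := hg
    have hf' : diff K L M M a f = 0 := hf.2
    refine ⟨(-1 : k) ^ a • cup ω σ b f h,
      Submodule.smul_mem _ _ (cup_mem ω σ a b f h hf.1 hh), ?_⟩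
    change diff K L M M (a + b) _ = _
    rw [map_smul, diff_cup ω σ a b f h hf.1.1, hf', ← cupBilin_apply ω σ b, map_zero,
      LinearMap.zero_apply, zero_add, smul_smul, ← mul_pow]
    simp

/-- The product of cocycles. -/
noncomputable def cupCocycles (a b : ℕ) :
    cocycles K L M M a →ₗ[k] cocycles K L M M b →ₗ[k] cocycles K L M M (a + b) :=
  LinearMap.mk₂ k (fun f g => ⟨cup ω σ b f.1 g.1, cup_mem_cocycles ω σ a b f.2 g.2⟩)
    (fun _ _ _ => Subtype.ext (cup_add_left ω σ b _ _ _))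
    (fun _ _ _ => Subtype.ext (cup_smul_left ω σ b _ _ _))
    (fun _ _ _ => Subtype.ext (cup_add_right ω σ b _ _ _))
    (fun _ _ _ => Subtype.ext (cup_smul_right ω σ b _ _ _))

variable (K L M) in
/-- The class of a cocycle. -/
noncomputable def cohomologyClass (n : ℕ) : cocycles K L M M n →ₗ[k] Cohomology K L M M n :=
  Submodule.mkQ _

/-- The product on the cohomology of `Hom_Γ(L, Hom_A(K ⊗_A M, M))`. -/
noncomputable def cohomologyMul (a b : ℕ) :
    Cohomology K L M M a →ₗ[k] Cohomology K L M M b →ₗ[k] Cohomology K L M M (a + b) :=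
  Submodule.liftQ _
    { toFun := fun f => Submodule.liftQ _
        (cohomologyClass K L M (a + b) ∘ₗ cupCocycles ω σ a b f) (fun g hg => by
          rw [LinearMap.mem_ker]
          exact (Submodule.Quotient.mk_eq_zero _).mpr
            (cup_mem_coboundaries_right ω σ a b f.2 hg))
      map_add' := fun f f' => Submodule.linearMap_qext _ (by ext g; simp)
      map_smul' := fun c f => Submodule.linearMap_qext _ (by ext g; simp) }
    (fun f hf => by
      rw [LinearMap.mem_ker]
      refine Submodule.linearMap_qext _ (LinearMap.ext fun g => ?_)
      exact (Submodule.Quotient.mk_eq_zero _).mpr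
        (cup_mem_coboundaries_left ω σ a b hf g.2))

lemma cohomologyMul_class (a b : ℕ) (f : cocycles K L M M a) (g : cocycles K L M M b) :
    cohomologyMul ω σ a b (cohomologyClass K L M a f) (cohomologyClass K L M b g) =
      cohomologyClass K L M (a + b) (cupCocycles ω σ a b f g) := rfl

variable (K M) in
/-- The augmentation `K_0 ⊗_A M → M`, `x ⊗ m ↦ τ(x) m`. -/
noncomputable def augModule : HomA K M M 0 where
  __ := BalTensor.lift ((Algebra.lsmul k k M).toLinearMap ∘ₗ K.aug) (by
    intro x a m
    simp only [LinearMap.comp_apply, AlgHom.toLinearMap_apply, Algebra.lsmul_coe, K.aug_op_smul,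
      mul_smul])
  map_smul' a z := by
    induction z using BalTensor.induction with
    | zero => simp
    | mk x m =>
      change K.aug (a • x) • m = a • (K.aug x • m)
      rw [K.aug_smul, mul_smul]
    | add z w hz hw =>
      simp only [AddHom.toFun_eq_coe, LinearMap.coe_toAddHom, RingHom.id_apply] at hz hw ⊢
      simp only [smul_add, map_add, hz, hw]

lemma augModule_mk (x : K.X 0) (m : M) :
    augModule K M (BalTensor.mk k A _ _ x m) = K.aug x • m := rfl

variable (K L M) in
/-- The map of degree `0` given by `l ↦ (x ⊗ m ↦ ξ(l) τ(x) m)`. -/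
noncomputable def oneCochain : PreCochain K L M M
  | 0, 0 => LinearMap.toSpanSingleton k (HomA K M M 0) (augModule K M) ∘ₗ L.aug
  | 0, _ + 1 => 0
  | _ + 1, _ => 0

lemma oneCochain_apply (l : L.X 0) (z : BalTensor k A (K.X 0) M) :
    oneCochain K L M 0 0 l z = L.aug l • augModule K M z := rfl

lemma augModule_diag (γ : Γ) (z : BalTensor k A (K.X 0) M) :
    augModule K M (BalTensor.diag γ z) = γ • augModule K M z := by
  induction z using BalTensor.induction with
  | zero => simp
  | add z w hz hw => simp only [map_add, smul_add, hz, hw]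
  | mk x m =>
    simp only [BalTensor.diag_mk, map_sum, augModule_mk, K.aug_act]
    rw [IsEquivariantModule.act_smul (k := k)]

lemma oneCochain_mem : oneCochain K L M ∈ cocycles K L M M 0 := by
  refine ⟨⟨?_, ?_⟩, ?_⟩
  · rintro (_ | p) (_ | q) h
    · exact absurd rfl h
    all_goals rfl
  · rintro (_ | p) (_ | q) γ l z
    · have e (u : HomA K M M 0) (c : k) : homAct (c • u) γ z = c • homAct u γ z := by
        simp only [homAct, LinearMap.smul_apply, Finset.smul_sum]
        exact Finset.sum_congr rfl fun i _ => smul_comm _ _ _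
      change _ = homAct (L.aug l • augModule K M) γ z
      rw [oneCochain_apply, L.aug_op_smul, mul_smul, e]
      simp only [homAct, augModule_diag, ← mul_smul, ← Finset.sum_smul,
        HopfAlgebra.sum_antipode_mul_eq_smul, smul_assoc, one_smul]
    all_goals simp [oneCochain, homAct]
  · change diff K L M M 0 (oneCochain K L M) = 0
    rw [diff_apply]
    have hK : diffK (oneCochain K L M) = 0 := by
      refine ext_mk fun p q l x m => ?_
      rcases q with _ | q
      · rfl
      · rcases p with _ | p <;> rcases q with _ | q
        · change -(-1 : k) ^ 0 • (L.aug l • K.aug (K.d 0 x) • m) = 0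
          rw [K.exact_aug.apply_apply_eq_zero, zero_smul, smul_zero, smul_zero]
        all_goals simp [diffK, oneCochain]
    have hL : diffL (oneCochain K L M) = 0 := by
      refine ext_mk fun p q l x m => ?_
      rcases p with _ | p
      · rfl
      · rcases p with _ | p <;> rcases q with _ | q
        · change L.aug (L.d 0 l) • (K.aug x • m) = 0
          rw [L.exact_aug.apply_apply_eq_zero, zero_smul]
        all_goals simp [diffL, oneCochain]
    rw [hK, hL, smul_zero, sub_zero]

variable (K L M) in
/-- The class of the map `l ↦ (x ⊗ m ↦ ξ(l) τ(x) m)`, the unit of the cohomology algebra. -/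
noncomputable def cohomologyOne : Cohomology K L M M 0 :=
  cohomologyClass K L M 0 ⟨oneCochain K L M, oneCochain_mem⟩

end Products

/-! Write X_q = K_q ⊗_A M with the diagonal action of Γ. The vector space X_q ⊗ L_p becomes an A #
Γ-module when A acts on X_q and γ(x ⊗ l) = ∑ γ₁x ⊗ l S⁻¹(γ₂); this is where bijectivity of S enters.
The action is chosen so that Hom_{A#Γ}(X_q ⊗ L_p, N) = Hom_Γ(L_p, Hom_A(X_q, N)), by `Twist.lift`
and `Twist.curry`. As K_q is a free bimodule, X_q is projective over A (`projective_balTensor`), and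
L_p is projective over Γ. So the right side is exact in N and X_q ⊗ L_p is projective
(`Twist.projective`). The total complex `Tot` of these modules resolves M: K → A splits over Aᵐᵒᵖ, L
→ k splits over k, and the two contractions combine (`exists_familyD_eq`). Up to the sign -(-1)^n in
the differential, the complex of the theorem is Hom_{A#Γ}(Tot, N) (`cochainHom_diff`), so its
cohomology is Ext.

The isomorphism must be explicit for the sake of products. A cocycle of degree n is a map from the
n-th syzygy Z_n of `Tot` to N. Its class is the product of this map with the n-fold extension from
Z_0 ≅ M to Z_n, cut into short exact sequences (`SyzygySequence.splice`, `extOfHom`). It vanishes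
exactly if n ≥ 1 and the map extends to Tot_{n-1}, or n = 0 and the map is zero; these are the
coboundaries (`extClass_eq_zero_iff`).

To multiply the class of f by that of a cocycle g of degree b, one lifts g to maps Tot_{b+n} → Tot_n
and composes with f. The lift `totCup` is the product of the tautological cochain, with values in
Tot_n, and g; by naturality, composing it with f gives fg. The Leibniz rule makes it commute with
the differentials up to (-1)^b, and the signs in `splice` absorb this (`splice_comp_splice`).

Two obstacles remain. The product is defined only for cochains with values in M, so cochains from M
to N are treated as off-diagonal entries over M × N (`cupRight`, `cupOne`, `cup_intertwine`).
Moreover ω and σ need not be counital, so `totCup` lifts 1·g and not g itself. But the product with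
1 is a chain endomorphism of `Tot` over the identity of M, because 1·1 = 1 holds strictly
(`cup_oneCochain`). Hence 1·g and g have the same class (`extClass_oneCup`). -/

set_option linter.unusedSectionVars false

/-! ### Dimension shifting and Yoneda products along short exact sequences with projective middle
terms. -/

section Syzygies

open Abelian

universe w v t

/-- A sequence of short exact sequences `0 → Z (n + 1) → P n → Z n → 0` with `P n` projective. -/
structure SyzygySequence (C : Type t) [Category.{v} C] [Abelian C] where
  Z : ℕ → C
  P : ℕ → C
  ι : ∀ n, Z (n + 1) ⟶ P n
  π : ∀ n, P n ⟶ Z n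
  zero : ∀ n, ι n ≫ π n = 0
  shortExact : ∀ n, (ShortComplex.mk (ι n) (π n) (zero n)).ShortExact
  [projective : ∀ n, Projective (P n)]

attribute [instance] SyzygySequence.projective

namespace SyzygySequence

variable {C : Type t} [Category.{v} C] [Abelian C] [HasExt.{w} C] (S : SyzygySequence C)

/-- The class of the extension `0 → Z (n + 1) → P n → Z n → 0`. -/
noncomputable def step (n : ℕ) : Ext (S.Z n) (S.Z (n + 1)) 1 := (S.shortExact n).extClass

/-- In the long exact sequence the obstruction lies in Ext^{j+1}(P n, N) = 0. -/
lemma step_comp_surjective (n : ℕ) {N : C} {j c : ℕ} (h : 1 + j = c) :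
    Function.Surjective fun y : Ext (S.Z (n + 1)) N j => (S.step n).comp y h := by
  intro x
  refine Ext.contravariant_sequence_exact₃ (S.shortExact n) N x ?_ h
  obtain rfl : c = j + 1 := by omega
  exact Ext.eq_zero_of_projective (P := S.P n) _

lemma step_comp_eq_zero (n : ℕ) {N : C} {j c : ℕ} (h : 1 + j = c) (y : Ext (S.Z (n + 1)) N j)
    (hy : (S.step n).comp y h = 0) :
    ∃ x : Ext (S.P n) N j, (Ext.mk₀ (S.ι n)).comp x (zero_add j) = y :=
  Ext.contravariant_sequence_exact₁ (S.shortExact n) N y h hy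

/-- The kernel comes from Ext^{j+1}(P n, N), which vanishes in positive degree. In degree 0 the
connecting map does have a kernel, the maps that extend to P n. -/
lemma step_comp_injective (n : ℕ) {N : C} {j c : ℕ} (h : 1 + (j + 1) = c)
    (y : Ext (S.Z (n + 1)) N (j + 1)) (hy : (S.step n).comp y h = 0) : y = 0 := by
  obtain ⟨x, rfl⟩ := S.step_comp_eq_zero n h y hy
  rw [Ext.eq_zero_of_projective (P := S.P n) x, Ext.comp_zero]

variable (k : Type*) [Field k] [Linear k C]

/-- The iterated product of the classes `step 0, …, step (n - 1)`, with a sign. -/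
noncomputable def splice : ∀ n, Ext (S.Z 0) (S.Z n) n
  | 0 => Ext.mk₀ (𝟙 _)
  -- The accumulated sign is s_n = (-1)^{n(n-1)/2}, for which s_{b+n} = (-1)^{bn} s_b s_n. The
  -- factor (-1)^{bn} is what a chain map of degree b produces when it is moved past n steps.
  | n + 1 => (-1 : k) ^ n • (splice n).comp (S.step n) rfl

lemma splice_succ_comp (n : ℕ) {N : C} {j m c : ℕ} (h : n + 1 + j = c) (hm : 1 + j = m)
    (y : Ext (S.Z (n + 1)) N j) :
    (S.splice k (n + 1)).comp y h = (-1 : k) ^ n •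
      (S.splice k n).comp ((S.step n).comp y hm) (by omega) := by
  rw [splice, Ext.smul_comp, Ext.comp_assoc]
  omega

lemma splice_comp_surjective (n : ℕ) {N : C} {j c : ℕ} (h : n + j = c) (x : Ext (S.Z 0) N c) :
    ∃ y : Ext (S.Z n) N j, (S.splice k n).comp y h = x := by
  induction n generalizing j c with
  | zero =>
    obtain rfl : j = c := by omega
    exact ⟨x, Ext.mk₀_id_comp x⟩
  | succ n ih =>
    obtain ⟨y, hy⟩ := ih (j := 1 + j) (by omega) ((-1 : k) ^ n • x)
    obtain ⟨z, rfl⟩ := S.step_comp_surjective n rfl y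
    refine ⟨z, ?_⟩
    dsimp only at hy
    rw [splice_succ_comp _ _ _ _ rfl, hy, smul_smul, ← mul_pow]
    simp

lemma splice_comp_injective (n : ℕ) {N : C} {j c : ℕ} (h : n + (j + 1) = c)
    (y : Ext (S.Z n) N (j + 1)) (hy : (S.splice k n).comp y h = 0) : y = 0 := by
  induction n generalizing j c with
  | zero =>
    obtain rfl : c = j + 1 := by omega
    exact (Ext.mk₀_id_comp y).symm.trans hy
  | succ n ih =>
    rw [S.splice_succ_comp k n h (add_comm 1 (j + 1)),
      smul_eq_zero_iff_right (pow_ne_zero n (neg_ne_zero.mpr one_ne_zero))] at hy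
    exact S.step_comp_injective n _ y (ih _ _ hy)

/-- The class in `Ext^n(Z 0, N)` of a map `Z n ⟶ N`. -/
noncomputable def extOfHom (n : ℕ) (N : C) : (S.Z n ⟶ N) →ₗ[k] Ext (S.Z 0) N n where
  toFun f := (S.splice k n).comp (Ext.mk₀ f) (add_zero n)
  map_add' f g := by rw [Ext.mk₀_add, Ext.comp_add]
  map_smul' c f := by rw [Ext.mk₀_smul, Ext.comp_smul, RingHom.id_apply]

lemma extOfHom_apply (n : ℕ) {N : C} (f : S.Z n ⟶ N) :
    S.extOfHom k n N f = (S.splice k n).comp (Ext.mk₀ f) (add_zero n) := rfl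

lemma extOfHom_surjective (n : ℕ) (N : C) : Function.Surjective (S.extOfHom k n N) := by
  intro x
  obtain ⟨y, rfl⟩ := S.splice_comp_surjective k n (add_zero n) x
  obtain ⟨f, rfl⟩ := Ext.mk₀_bijective _ _ |>.2 y
  exact ⟨f, rfl⟩

lemma extOfHom_zero_eq_zero {N : C} (f : S.Z 0 ⟶ N) (hf : S.extOfHom k 0 N f = 0) : f = 0 :=
  (Ext.mk₀_eq_zero_iff f).mp ((Ext.mk₀_id_comp _).symm.trans hf)

/-- `splice n` acts injectively on Ext¹, so only the connecting map Hom(Z (n + 1), N) → Ext¹(Z n, N)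
can have a kernel; that kernel consists of the restrictions of maps from P n. -/
lemma extOfHom_succ_eq_zero_iff (n : ℕ) {N : C} (f : S.Z (n + 1) ⟶ N) :
    S.extOfHom k (n + 1) N f = 0 ↔ ∃ g : S.P n ⟶ N, S.ι n ≫ g = f := by
  rw [extOfHom_apply, splice_succ_comp _ _ _ _ rfl,
    smul_eq_zero_iff_right (pow_ne_zero n (neg_ne_zero.mpr one_ne_zero))]
  constructor
  · intro h
    obtain ⟨x, hx⟩ := S.step_comp_eq_zero n rfl _ (S.splice_comp_injective k n (j := 0) rfl _ h)
    obtain ⟨g, rfl⟩ := Ext.mk₀_bijective _ _ |>.2 x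
    rw [Ext.mk₀_comp_mk₀] at hx
    exact ⟨g, Ext.mk₀_bijective _ _ |>.1 hx⟩
  · rintro ⟨g, rfl⟩
    have h := (S.shortExact n).extClass_comp_assoc (Ext.mk₀ g) (h := rfl)
    rw [Ext.mk₀_comp_mk₀] at h
    rw [step, h, Ext.comp_zero]

/-- A chain endomorphism affects the iterated extension only through its map on Z 0. This will be
applied with ψ 0 = id. -/
lemma splice_naturality (φ : ∀ n, S.P n ⟶ S.P n) (ψ : ∀ n, S.Z n ⟶ S.Z n)
    (hπ : ∀ n, φ n ≫ S.π n = S.π n ≫ ψ n) (hι : ∀ n, S.ι n ≫ φ n = ψ (n + 1) ≫ S.ι n) (n : ℕ) :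
    (S.splice k n).comp (Ext.mk₀ (ψ n)) (add_zero n) =
      (Ext.mk₀ (ψ 0)).comp (S.splice k n) (zero_add n) := by
  induction n with
  | zero => simp [splice]
  | succ n ih =>
    have h := ShortComplex.ShortExact.extClass_naturality (S.shortExact n) (S.shortExact n)
      (ShortComplex.homMk (ψ (n + 1)) (φ n) (ψ n) (hι n).symm (hπ n))
    dsimp only [ShortComplex.homMk] at h
    rw [splice_succ_comp _ _ _ _ rfl, step, h, splice, Ext.comp_smul, step]
    congr 1
    rw [← Ext.comp_assoc_of_second_deg_zero, ih, Ext.comp_assoc]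
    omega

/-- A chain map of degree -b computes the Yoneda product with the class that it lifts. In each step
of the induction its sign (-1)^b accounts for the difference between the signs (-1)^n and (-1)^{b+n}
in the two splices. -/
lemma splice_comp_splice (b : ℕ) (φ : ∀ n, S.P (b + n) ⟶ S.P n) (ψ : ∀ n, S.Z (b + n) ⟶ S.Z n)
    (hπ : ∀ n, φ n ≫ S.π n = S.π (b + n) ≫ ψ n)
    (hι : ∀ n, S.ι (b + n) ≫ φ n = (-1 : k) ^ b • ψ (n + 1) ≫ S.ι n) (n : ℕ) :
    ((S.splice k b).comp (Ext.mk₀ (ψ 0)) (add_zero b)).comp (S.splice k n) rfl =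
      (S.splice k (b + n)).comp (Ext.mk₀ (ψ n)) (add_zero (b + n)) := by
  induction n with
  | zero => exact Ext.comp_mk₀_id _
  | succ n ih =>
    have h := ShortComplex.ShortExact.extClass_naturality (S.shortExact (b + n)) (S.shortExact n)
      (ShortComplex.homMk ((-1 : k) ^ b • ψ (n + 1)) (φ n) (ψ n)
        (by simpa using (hι n).symm) (hπ n))
    dsimp only [ShortComplex.homMk] at h
    rw [Ext.mk₀_smul, Ext.comp_smul] at h
    rw [splice, Ext.comp_smul, ← Ext.comp_assoc _ _ _ rfl rfl rfl, ih,
      Ext.comp_assoc_of_second_deg_zero, step, ← h]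
    change _ = (S.splice k (b + n + 1)).comp _ _
    rw [splice_succ_comp _ _ _ _ rfl, step, Ext.comp_smul, smul_smul]
    congr 1
    ring

end SyzygySequence

end Syzygies

/-! ### The inverse of the antipode. -/

section AntipodeInverse

variable (k : Type*) {Γ : Type*} [Field k] [Ring Γ] [HopfAlgebra k Γ]
  [hS : Fact (Function.Bijective (HopfAlgebra.antipode k (A := Γ)))]

/-- The inverse of the antipode. -/
noncomputable def antipodeInv : Γ →ₗ[k] Γ :=
  (LinearEquiv.ofBijective (HopfAlgebra.antipode k (A := Γ)) hS.out).symm.toLinearMap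

lemma antipode_antipodeInv (γ : Γ) : HopfAlgebra.antipode k (antipodeInv k γ) = γ :=
  (LinearEquiv.ofBijective (HopfAlgebra.antipode k (A := Γ)) hS.out).apply_symm_apply γ

lemma antipodeInv_one : antipodeInv k (1 : Γ) = 1 :=
  hS.out.1 (by rw [antipode_antipodeInv, HopfAlgebra.antipode_one])

lemma antipodeInv_mul (γ δ : Γ) :
    antipodeInv k (γ * δ) = antipodeInv k δ * antipodeInv k γ :=
  hS.out.1 (by simp only [antipode_antipodeInv, HopfAlgebra.antipode_mul_antidistrib])

/-- Applying the injective, antimultiplicative map S turns this into the antipode axiom. The legs of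
the comultiplication appear in the order opposite to that for S. -/
lemma sum_antipodeInv_mul (γ : Γ) :
    ∑ i ∈ (ℛ k γ).index, antipodeInv k ((ℛ k γ).right i) * (ℛ k γ).left i =
      Coalgebra.counit (R := k) γ • 1 := by
  refine hS.out.1 ?_
  rw [map_sum, map_smul, HopfAlgebra.antipode_one, ← HopfAlgebra.sum_antipode_mul_eq_smul (ℛ k γ)]
  simp only [antipode_antipodeInv, HopfAlgebra.antipode_mul_antidistrib]

lemma sum_mul_antipodeInv (γ : Γ) :
    ∑ i ∈ (ℛ k γ).index, (ℛ k γ).right i * antipodeInv k ((ℛ k γ).left i) =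
      Coalgebra.counit (R := k) γ • 1 := by
  refine hS.out.1 ?_
  rw [map_sum, map_smul, HopfAlgebra.antipode_one, ← HopfAlgebra.sum_mul_antipode_eq_smul (ℛ k γ)]
  simp only [antipode_antipodeInv, HopfAlgebra.antipode_mul_antidistrib]

/-- The inverse of the antipode, as a map of algebras to the opposite algebra. -/
noncomputable def antipodeInvAlgHom : Γ →ₐ[k] Γᵐᵒᵖ :=
  AlgHom.ofLinearMap ((MulOpposite.opLinearEquiv k).toLinearMap ∘ₗ antipodeInv k)
    (congrArg MulOpposite.op (antipodeInv_one k))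
    (fun γ δ => congrArg MulOpposite.op (antipodeInv_mul k γ δ))

lemma antipodeInvAlgHom_apply (γ : Γ) :
    antipodeInvAlgHom k γ = MulOpposite.op (antipodeInv k γ) := rfl

end AntipodeInverse

/-! ### Modules and linear maps over the smash product. -/

section SmashModules

variable {k A Γ : Type*} [Field k] [Ring Γ] [HopfAlgebra k Γ] [Ring A] [Algebra k A]
  [Module Γ A] [IsModuleAlgebra k Γ A]

/-- The map from the smash product which is given by compatible maps on `A` and on `Γ`. -/
noncomputable def SmashProduct.liftAlgHom {E : Type*} [Ring E] [Algebra k E] (f : A →ₐ[k] E)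
    (g : Γ →ₐ[k] E) (h : ∀ γ a, g γ * f a =
      ∑ i ∈ (ℛ k γ).index, f ((ℛ k γ).left i • a) * g ((ℛ k γ).right i)) :
    SmashProduct k A Γ →ₐ[k] E :=
  AlgHom.ofLinearMap
    (TensorProduct.lift ((LinearMap.mul k E).compl₁₂ f.toLinearMap g.toLinearMap))
    (by
      change f 1 * g 1 = 1
      simp)
    (by
      let φ : SmashProduct k A Γ →ₗ[k] E :=
        TensorProduct.lift ((LinearMap.mul k E).compl₁₂ f.toLinearMap g.toLinearMap)
      have hφ (a : A) (γ : Γ) : φ (SmashProduct.mk k A Γ a γ) = f a * g γ := rfl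
      intro x y
      change φ (SmashProduct.mulHom k A Γ x y) = φ x * φ y
      induction x using SmashProduct.induction with
      | zero => simp
      | add x x' hx hx' => simp only [map_add, LinearMap.add_apply, hx, hx', add_mul]
      | mk a γ =>
      induction y using SmashProduct.induction with
      | zero => simp
      | add y y' hy hy' => simp only [map_add, hy, hy', mul_add]
      | mk b δ =>
      rw [SmashProduct.mulHom_mk', map_sum, hφ, hφ, mul_assoc, ← mul_assoc (g γ), h,
        Finset.sum_mul, Finset.mul_sum]
      exact Finset.sum_congr rfl fun i _ => by rw [hφ, map_mul, map_mul]; simp only [mul_assoc])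

lemma SmashProduct.liftAlgHom_inl {E : Type*} [Ring E] [Algebra k E] (f : A →ₐ[k] E)
    (g : Γ →ₐ[k] E) (h) (a : A) :
    SmashProduct.liftAlgHom f g h (SmashProduct.inl k A Γ a) = f a := by
  change f a * g 1 = _
  simp

lemma SmashProduct.liftAlgHom_inr {E : Type*} [Ring E] [Algebra k E] (f : A →ₐ[k] E)
    (g : Γ →ₐ[k] E) (h) (γ : Γ) :
    SmashProduct.liftAlgHom f g h (SmashProduct.inr k A Γ γ) = g γ := by
  change f 1 * g γ = _
  simp

/-- An additive map which commutes with the actions of `A` and `Γ` is linear over `A # Γ`. -/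
def SmashProduct.linearMapOfCommutes {X Y : Type*} [AddCommGroup X] [AddCommGroup Y]
    [Module (SmashProduct k A Γ) X] [Module (SmashProduct k A Γ) Y] (f : X →+ Y)
    (hA : ∀ (a : A) x, f (SmashProduct.inl k A Γ a • x) = SmashProduct.inl k A Γ a • f x)
    (hΓ : ∀ (γ : Γ) x, f (SmashProduct.inr k A Γ γ • x) = SmashProduct.inr k A Γ γ • f x) :
    X →ₗ[SmashProduct k A Γ] Y where
  __ := f
  map_smul' r x := by
    induction r using SmashProduct.induction with
    | zero => simp
    | add r s hr hs =>
      simp only [add_smul, ZeroHom.toFun_eq_coe, AddMonoidHom.toZeroHom_coe, map_add,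
        RingHom.id_apply] at hr hs ⊢
      rw [hr, hs]
    | mk a γ =>
      -- Each generator is a product of an element of A and an element of Γ, so the two linearities
      -- suffice.
      rw [← SmashProduct.inl_mul_inr, mul_smul, RingHom.id_apply, mul_smul]
      exact (hA _ _).trans (congrArg _ (hΓ _ _))

end SmashModules

/-! ### The diagonal Γ-action on X ⊗_A Y. -/

section DiagonalModule

variable {k A Γ : Type u} {X Y : Type*} [Field k] [Ring Γ] [HopfAlgebra k Γ] [Ring A] [Algebra k A]
  [Module Γ A] [IsModuleAlgebra k Γ A]
  [AddCommGroup X] [Module k X] [Module A X] [Module Aᵐᵒᵖ X] [IsScalarTower k A X]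
  [IsScalarTower k Aᵐᵒᵖ X]
  [SMulCommClass A Aᵐᵒᵖ X] [Module Γ X] [IsScalarTower k Γ X] [IsEquivariantBimodule k Γ A X]
  [AddCommGroup Y] [Module k Y] [Module A Y] [IsScalarTower k A Y] [Module Γ Y]
  [IsScalarTower k Γ Y] [IsEquivariantModule k Γ A Y]

namespace BalTensor

/-- The diagonal action on `x ⊗ y` is given by a bilinear map applied to the comultiplication. -/
noncomputable def diagAux (x : X) (y : Y) : Γ →ₗ[k] Γ →ₗ[k] BalTensor k A X Y :=
  (mk k A X Y).compl₁₂ ((Algebra.lsmul k k X).toLinearMap.flip x)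
    ((Algebra.lsmul k k Y).toLinearMap.flip y)

lemma diagAux_apply (x : X) (y : Y) (γ δ : Γ) :
    diagAux (A := A) (k := k) x y γ δ = mk k A X Y (γ • x) (δ • y) := rfl

lemma diag_eq_lift (γ : Γ) (x : X) (y : Y) : diag γ (mk k A X Y x y) =
    TensorProduct.lift (diagAux x y) (Coalgebra.comul γ) := by
  rw [diag_mk, ← sweedler_sum]
  rfl

lemma diag_one (z : BalTensor k A X Y) : diag (1 : Γ) z = z := by
  induction z using BalTensor.induction with
  | zero => rw [map_zero]
  | add z w hz hw => rw [map_add, hz, hw]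
  | mk x y =>
    rw [diag_eq_lift, Bialgebra.comul_one, Algebra.TensorProduct.one_def,
      TensorProduct.lift.tmul, diagAux_apply, one_smul, one_smul]

/-- Multiplicativity of the comultiplication. -/
lemma diag_mul (γ δ : Γ) (z : BalTensor k A X Y) : diag (γ * δ) z = diag γ (diag δ z) := by
  induction z using BalTensor.induction with
  | zero => simp only [map_zero]
  | add z w hz hw => simp only [map_add, hz, hw]
  | mk x y =>
    rw [diag_eq_lift, Bialgebra.comul_mul, ← (ℛ k γ).eq, ← (ℛ k δ).eq, Finset.sum_mul_sum,
      Finset.sum_comm, map_sum, diag_mk, map_sum]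
    refine Finset.sum_congr rfl fun j _ => ?_
    rw [diag_mk, map_sum]
    refine Finset.sum_congr rfl fun i _ => ?_
    rw [Algebra.TensorProduct.tmul_mul_tmul, TensorProduct.lift.tmul, diagAux_apply, mul_smul,
      mul_smul]

noncomputable instance : Module Γ (BalTensor k A X Y) where
  smul γ := diag γ
  one_smul := diag_one
  mul_smul := diag_mul
  smul_zero γ := map_zero (diag γ)
  smul_add γ := map_add (diag γ)
  add_smul γ δ z := LinearMap.congr_fun (map_add diagHom γ δ) z
  zero_smul z := LinearMap.congr_fun (map_zero diagHom) z

lemma hopf_smul_def (γ : Γ) (z : BalTensor k A X Y) : γ • z = diag γ z := rfl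

instance : IsScalarTower k Γ (BalTensor k A X Y) where
  smul_assoc c γ z := LinearMap.congr_fun (map_smul diagHom c γ) z

/-- By coassociativity both sides are ∑ (γ₁a)(γ₂x) ⊗ γ₃y on generators. -/
instance : IsEquivariantModule k Γ A (BalTensor k A X Y) where
  act_smul γ a z := by
    simp only [hopf_smul_def]
    induction z using BalTensor.induction with
    | zero => simp
    | add z w hz hw => simp only [smul_add, map_add, hz, hw, Finset.sum_add_distrib]
    | mk x y =>
      have key := sweedler_coassoc' (diagAux (k := k) (A := A) (Γ := Γ) x y)
        ((Algebra.lsmul k k (BalTensor k A X Y)).toLinearMap ∘ₗ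
          (Algebra.lsmul k k A).toLinearMap.flip a) γ
      simp only [LinearMap.comp_apply, LinearMap.flip_apply, AlgHom.toLinearMap_apply,
        Algebra.lsmul_coe, diagAux_apply, smul_mk] at key
      simp only [smul_mk, diag_mk, IsEquivariantModule.act_smul (k := k) (Γ := Γ) _ a x, map_sum,
        LinearMap.sum_apply, Finset.smul_sum, key]

end BalTensor

end DiagonalModule

/-! ### The right Γ-module of A-linear maps. -/

section TwistedHom

variable {k A Γ : Type u} {X N : Type*} [Field k] [Ring Γ] [HopfAlgebra k Γ] [Ring A]
  [Algebra k A] [Module Γ A] [IsModuleAlgebra k Γ A]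
  [AddCommGroup X] [Module k X] [Module A X] [IsScalarTower k A X] [Module Γ X]
  [IsScalarTower k Γ X] [IsEquivariantModule k Γ A X]
  [AddCommGroup N] [Module k N] [Module A N] [IsScalarTower k A N] [Module Γ N]
  [IsScalarTower k Γ N] [IsEquivariantModule k Γ A N]

variable (k) in
-- The action of γ on A is conjugation inside the smash product: γ₁ a S(γ₂) = (γ₁a) γ₂ S(γ₃) = γa as
-- operators on N.
lemma sum_smul_smul_antipode_smul (γ : Γ) (a : A) (n : N) :
    ∑ i ∈ (ℛ k γ).index,
      (ℛ k γ).left i • a • HopfAlgebra.antipode k ((ℛ k γ).right i) • n = (γ • a) • n := by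
  have key := sweedler_coassoc' (k := k)
    ((Algebra.lsmul k k N).toLinearMap.compl₂ ((Algebra.lsmul k k N).toLinearMap.flip n ∘ₗ
      HopfAlgebra.antipode k (A := Γ)))
    ((Algebra.lsmul k k N).toLinearMap ∘ₗ (Algebra.lsmul k k A).toLinearMap.flip a) γ
  simp only [LinearMap.comp_apply, LinearMap.flip_apply, AlgHom.toLinearMap_apply,
    Algebra.lsmul_coe, LinearMap.compl₂_apply] at key
  simp only [IsEquivariantModule.act_smul (k := k) (Γ := Γ) _ a, key]
  simp only [← mul_smul (_ : Γ), ← Finset.smul_sum, ← Finset.sum_smul,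
    HopfAlgebra.sum_mul_antipode_eq_smul, smul_assoc, one_smul]
  have h := sweedler_counit_right ((Algebra.lsmul k k N).toLinearMap.flip n ∘ₗ
    (Algebra.lsmul k k A).toLinearMap.flip a) γ
  simp only [LinearMap.comp_apply, LinearMap.flip_apply, AlgHom.toLinearMap_apply,
    Algebra.lsmul_coe] at h
  rw [← h]
  exact Finset.sum_congr rfl fun i _ => smul_comm _ _ _

variable (k) in
-- Replacing γ₂a by the conjugate γ₂ a S(γ₃) makes S(γ₁)γ₂ collapse. This is what makes u · γ linear
-- over A.
lemma sum_antipode_smul_smul_smul (γ : Γ) (a : A) (n : N) :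
    ∑ i ∈ (ℛ k γ).index,
      HopfAlgebra.antipode k ((ℛ k γ).left i) • ((ℛ k γ).right i • a) • n =
        a • HopfAlgebra.antipode k γ • n := by
  have key := sweedler_coassoc (k := k) (X := N)
    (LinearMap.mk₂ k (fun g₁ g₂ => (Algebra.lsmul k k N (HopfAlgebra.antipode k g₁ * g₂) ∘ₗ
        Algebra.lsmul k k N a) ∘ₗ (Algebra.lsmul k k N).toLinearMap.flip n ∘ₗ
          HopfAlgebra.antipode k (A := Γ))
      (by intros; simp only [map_add, add_mul, LinearMap.add_comp])
      (by intros; simp only [map_smul, smul_mul_assoc, LinearMap.smul_comp])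
      (by intros; simp only [map_add, mul_add, LinearMap.add_comp])
      (by intros; simp only [map_smul, mul_smul_comm, LinearMap.smul_comp])) γ
  simp only [LinearMap.mk₂_apply, LinearMap.comp_apply, LinearMap.flip_apply,
    AlgHom.toLinearMap_apply, Algebra.lsmul_coe, mul_smul] at key
  simp only [← sum_smul_smul_antipode_smul k _ a n, Finset.smul_sum]
  rw [← key]
  simp only [← mul_smul (_ : Γ), ← Finset.sum_smul, HopfAlgebra.sum_antipode_mul_eq_smul,
    smul_assoc, one_smul]
  have h := sweedler_counit_left ((Algebra.lsmul k k N a) ∘ₗ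
    (Algebra.lsmul k k N).toLinearMap.flip n ∘ₗ HopfAlgebra.antipode k (A := Γ)) γ
  simpa only [LinearMap.comp_apply, LinearMap.flip_apply, AlgHom.toLinearMap_apply,
    Algebra.lsmul_coe] using h

/-- For `u` and `x`, the bilinear map `(γ₁, γ₂) ↦ S(γ₁) u(γ₂ x)`. -/
noncomputable def twistAux (u : X →ₗ[A] N) (x : X) : Γ →ₗ[k] Γ →ₗ[k] N :=
  ((Algebra.lsmul k k N).toLinearMap ∘ₗ HopfAlgebra.antipode k).compl₂
    (u.restrictScalars k ∘ₗ (Algebra.lsmul k k X).toLinearMap.flip x)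

lemma twistAux_apply (u : X →ₗ[A] N) (x : X) (γ δ : Γ) :
    twistAux (k := k) u x γ δ = HopfAlgebra.antipode k γ • u (δ • x) := rfl

variable (k) in
/-- The right action of `γ ∈ Γ` on `A`-linear maps, `(u · γ)(x) = ∑ S(γ₁) u(γ₂ x)`. -/
noncomputable def twistAct (γ : Γ) (u : X →ₗ[A] N) : X →ₗ[A] N where
  toFun x := TensorProduct.lift (twistAux u x) (Coalgebra.comul (R := k) γ)
  map_add' x y := by
    simp only [← sweedler_sum, twistAux_apply, smul_add, map_add, Finset.sum_add_distrib]
  map_smul' a x := by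
    have key := sweedler_coassoc (k := k) (X := N)
      (LinearMap.mk₂ k (fun g₁ g₂ => (Algebra.lsmul k k N (HopfAlgebra.antipode k g₁) ∘ₗ
          Algebra.lsmul k k N (g₂ • a)) ∘ₗ u.restrictScalars k ∘ₗ
            (Algebra.lsmul k k X).toLinearMap.flip x)
        (by intros; simp only [map_add, LinearMap.add_comp])
        (by intros; simp only [map_smul, LinearMap.smul_comp])
        (by intros; simp only [map_add, add_smul, LinearMap.add_comp, LinearMap.comp_add])
        (by intros; simp only [map_smul, smul_assoc, LinearMap.smul_comp, LinearMap.comp_smul])) γ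
    simp only [LinearMap.mk₂_apply, LinearMap.comp_apply, LinearMap.flip_apply,
      AlgHom.toLinearMap_apply, Algebra.lsmul_coe, LinearMap.coe_restrictScalars] at key
    simp only [← sweedler_sum, twistAux_apply, RingHom.id_apply,
      IsEquivariantModule.act_smul (k := k) (Γ := Γ) _ a x, map_sum, map_smul, Finset.smul_sum]
    -- Regrouping puts S(γ₁) and γ₂a into the same leg, where the preceding lemma moves a to the
    -- front.
    rw [← key]
    simp only [sum_antipode_smul_smul_smul k]

lemma twistAct_apply (γ : Γ) (u : X →ₗ[A] N) (x : X) : twistAct k γ u x =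
    ∑ i ∈ (ℛ k γ).index, HopfAlgebra.antipode k ((ℛ k γ).left i) • u ((ℛ k γ).right i • x) :=
  (sweedler_sum (twistAux u x) γ).symm

/-- The action is on the right because S reverses products. -/
lemma twistAct_mul (γ δ : Γ) (u : X →ₗ[A] N) :
    twistAct k (γ * δ) u = twistAct k δ (twistAct k γ u) := by
  ext x
  change TensorProduct.lift (twistAux u x) (Coalgebra.comul (R := k) (γ * δ)) = _
  rw [Bialgebra.comul_mul, ← (ℛ k γ).eq, ← (ℛ k δ).eq, Finset.sum_mul_sum, Finset.sum_comm,
    map_sum, twistAct_apply]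
  refine Finset.sum_congr rfl fun j _ => ?_
  rw [twistAct_apply, map_sum, Finset.smul_sum]
  refine Finset.sum_congr rfl fun i _ => ?_
  rw [Algebra.TensorProduct.tmul_mul_tmul, TensorProduct.lift.tmul, twistAux_apply,
    HopfAlgebra.antipode_mul_antidistrib, mul_smul, mul_smul]

lemma twistAct_one (u : X →ₗ[A] N) : twistAct k (1 : Γ) u = u := by
  ext x
  change TensorProduct.lift (twistAux u x) (Coalgebra.comul (R := k) (1 : Γ)) = _
  rw [Bialgebra.comul_one, Algebra.TensorProduct.one_def, TensorProduct.lift.tmul,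
    twistAux_apply, HopfAlgebra.antipode_one, one_smul, one_smul]

lemma twistAct_zero (γ : Γ) : twistAct k γ (0 : X →ₗ[A] N) = 0 := by
  ext x
  simp only [twistAct_apply, LinearMap.zero_apply, smul_zero, Finset.sum_const_zero]

lemma twistAct_add (γ : Γ) (u v : X →ₗ[A] N) :
    twistAct k γ (u + v) = twistAct k γ u + twistAct k γ v := by
  ext x
  simp only [twistAct_apply, LinearMap.add_apply, smul_add, Finset.sum_add_distrib]

lemma add_twistAct (γ δ : Γ) (u : X →ₗ[A] N) :
    twistAct k (γ + δ) u = twistAct k γ u + twistAct k δ u := by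
  ext x
  change TensorProduct.lift (twistAux u x) (Coalgebra.comul (R := k) (γ + δ)) = _
  rw [map_add, map_add]
  rfl

lemma zero_twistAct (u : X →ₗ[A] N) : twistAct k (0 : Γ) u = 0 := by
  ext x
  change TensorProduct.lift (twistAux u x) (Coalgebra.comul (R := k) (0 : Γ)) = _
  rw [map_zero, map_zero]
  rfl

lemma twistAct_postcomp {N' : Type*} [AddCommGroup N'] [Module k N'] [Module A N']
    [IsScalarTower k A N'] [Module Γ N'] [IsScalarTower k Γ N'] [IsEquivariantModule k Γ A N']
    (f : N →ₗ[A] N') (hf : ∀ (γ : Γ) n, f (γ • n) = γ • f n) (γ : Γ) (u : X →ₗ[A] N) :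
    twistAct k γ (f ∘ₗ u) = f ∘ₗ twistAct k γ u := by
  ext x
  simp only [twistAct_apply, LinearMap.comp_apply, map_sum, hf]

/-- The space of `A`-linear maps `X → N` with the right action of `Γ`. -/
def TwistedHom (k A Γ X N : Type*) [Field k] [Ring Γ] [HopfAlgebra k Γ] [Ring A] [AddCommGroup X]
    [Module A X] [AddCommGroup N] [Module A N] : Type _ := X →ₗ[A] N

noncomputable instance : AddCommGroup (TwistedHom k A Γ X N) :=
  inferInstanceAs (AddCommGroup (X →ₗ[A] N))

noncomputable instance : Module Γᵐᵒᵖ (TwistedHom k A Γ X N) where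
  smul γ u := twistAct k γ.unop u
  one_smul u := twistAct_one u
  mul_smul _ _ _ := twistAct_mul _ _ _
  smul_zero γ := twistAct_zero γ.unop
  smul_add γ u v := twistAct_add γ.unop u v
  add_smul γ δ u := add_twistAct γ.unop δ.unop u
  zero_smul u := zero_twistAct u

/-- Composition with a map `N → N'` which is linear over `A` and `Γ`. -/
noncomputable def TwistedHom.postcomp {N' : Type*} [AddCommGroup N'] [Module k N'] [Module A N']
    [IsScalarTower k A N'] [Module Γ N'] [IsScalarTower k Γ N'] [IsEquivariantModule k Γ A N']
    (f : N →ₗ[A] N') (hf : ∀ (γ : Γ) n, f (γ • n) = γ • f n) :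
    TwistedHom k A Γ X N →ₗ[Γᵐᵒᵖ] TwistedHom k A Γ X N' where
  toFun u := f.comp u
  map_add' u v := LinearMap.comp_add u v f
  map_smul' γ u := (twistAct_postcomp f hf γ.unop u).symm

end TwistedHom

/-! ### The A # Γ-module X ⊗ L. -/

section Twist

/-- For a `Γ`-equivariant `A`-module `X` and a right `Γ`-module `L`, the space `X ⊗ L` on which `A`
acts by `a (x ⊗ l) = ax ⊗ l` and `Γ` by `γ (x ⊗ l) = ∑ γ₁ x ⊗ l S⁻¹(γ₂)`. -/
def Twist (k A Γ X L : Type*) [Field k] [Ring A] [Ring Γ] [HopfAlgebra k Γ]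
    [AddCommGroup X] [Module k X] [AddCommGroup L] [Module k L] : Type _ := X ⊗[k] L

namespace Twist

variable {k A Γ : Type u} {X L : Type*} [Field k] [Ring Γ] [HopfAlgebra k Γ] [Ring A]
  [Algebra k A] [Module Γ A] [IsModuleAlgebra k Γ A]
  [AddCommGroup X] [Module k X] [Module A X] [IsScalarTower k A X] [Module Γ X]
  [IsScalarTower k Γ X] [IsEquivariantModule k Γ A X]
  [AddCommGroup L] [Module k L] [Module Γᵐᵒᵖ L] [IsScalarTower k Γᵐᵒᵖ L]
  [hS : Fact (Function.Bijective (HopfAlgebra.antipode k (A := Γ)))]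

noncomputable instance : AddCommGroup (Twist k A Γ X L) :=
  inferInstanceAs (AddCommGroup (X ⊗[k] L))

noncomputable instance : Module k (Twist k A Γ X L) :=
  inferInstanceAs (Module k (X ⊗[k] L))

variable (k A Γ X L) in
/-- The element `x ⊗ l`. -/
noncomputable def mk : X →ₗ[k] L →ₗ[k] Twist k A Γ X L := TensorProduct.mk k X L

@[elab_as_elim]
lemma induction {P : Twist k A Γ X L → Prop} (z : Twist k A Γ X L) (zero : P 0)
    (mk : ∀ x l, P (mk k A Γ X L x l)) (add : ∀ z w, P z → P w → P (z + w)) : P z :=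
  TensorProduct.induction_on z zero mk add

variable (k A Γ X L) in
/-- The action of `Γ` on `X ⊗ L`. -/
noncomputable def hopfAction : Γ →ₐ[k] Module.End k (X ⊗[k] L) :=
  -- A composite of algebra maps Γ → Γ ⊗ Γ → End X ⊗ End L → End(X ⊗ L), so the module axioms come
  -- for free. S⁻¹, as a map to Γᵐᵒᵖ, turns the right action on L into a left one.
  (Module.endTensorEndAlgHom (R := k) (S := k) (A := k) (M := X) (N := L)).comp
    ((Algebra.TensorProduct.map (Algebra.lsmul k k X)
      ((Algebra.lsmul k k L).comp (antipodeInvAlgHom k))).comp (Bialgebra.comulAlgHom k Γ))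

lemma hopfAction_tmul (γ : Γ) (x : X) (l : L) : hopfAction k Γ X L γ (x ⊗ₜ l) =
    ∑ i ∈ (ℛ k γ).index, ((ℛ k γ).left i • x) ⊗ₜ
      (MulOpposite.op (antipodeInv k ((ℛ k γ).right i)) • l) := by
  change Module.endTensorEndAlgHom (R := k) (S := k) (A := k) (M := X) (N := L)
    (Algebra.TensorProduct.map _ _ (Coalgebra.comul γ)) _ = _
  rw [← (ℛ k γ).eq, map_sum, map_sum, LinearMap.sum_apply]
  rfl

variable (k A X L) in
/-- The action of `A` on `X ⊗ L`. -/
noncomputable def leftAction : A →ₐ[k] Module.End k (X ⊗[k] L) :=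
  (Module.endTensorEndAlgHom (R := k) (S := k) (A := k) (M := X) (N := L)).comp
    (Algebra.TensorProduct.includeLeft.comp (Algebra.lsmul k k X))

lemma leftAction_tmul (a : A) (x : X) (l : L) :
    leftAction k A X L a (x ⊗ₜ l) = (a • x) ⊗ₜ l := rfl

variable (k A Γ X L) in
/-- The action of `A # Γ` on `X ⊗ L`. -/
noncomputable def smashAction : SmashProduct k A Γ →ₐ[k] Module.End k (X ⊗[k] L) :=
  SmashProduct.liftAlgHom
    (leftAction k A X L) (hopfAction k Γ X L) (by
    intro γ a
    refine TensorProduct.ext' fun x l => ?_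
    have key := sweedler_coassoc' (k := k) (Y := X ⊗[k] L)
      ((TensorProduct.mk k X L).compl₁₂ ((Algebra.lsmul k k X).toLinearMap.flip x)
        ((Algebra.lsmul k k L).toLinearMap.flip l ∘ₗ
          (antipodeInvAlgHom k (Γ := Γ)).toLinearMap))
      ((leftAction k A X L).toLinearMap ∘ₗ (Algebra.lsmul k k A).toLinearMap.flip a) γ
    simp only [LinearMap.comp_apply, LinearMap.flip_apply, LinearMap.compl₁₂_apply,
      AlgHom.toLinearMap_apply, Algebra.lsmul_coe, TensorProduct.mk_apply, leftAction_tmul,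
      antipodeInvAlgHom_apply] at key
    simp only [Module.End.mul_apply, LinearMap.sum_apply, leftAction_tmul, hopfAction_tmul,
      map_sum, IsEquivariantModule.act_smul (k := k) (Γ := Γ) _ a x, TensorProduct.sum_tmul, key])

noncomputable instance : Module (SmashProduct k A Γ) (Twist k A Γ X L) :=
  letI : Module (Module.End k (X ⊗[k] L)) (Twist k A Γ X L) :=
    inferInstanceAs (Module (Module.End k (X ⊗[k] L)) (X ⊗[k] L))
  Module.compHom _ (smashAction k A Γ X L).toRingHom

lemma smul_def (r : SmashProduct k A Γ) (z : Twist k A Γ X L) :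
    r • z = smashAction k A Γ X L r z := rfl

instance : IsScalarTower k (SmashProduct k A Γ) (Twist k A Γ X L) where
  smul_assoc c r z := LinearMap.congr_fun (map_smul (smashAction k A Γ X L) c r) z

lemma inl_smul_mk (a : A) (x : X) (l : L) :
    SmashProduct.inl k A Γ a • mk k A Γ X L x l = mk k A Γ X L (a • x) l := by
  rw [smul_def, smashAction, SmashProduct.liftAlgHom_inl]
  exact leftAction_tmul a x l

lemma inr_smul_mk (γ : Γ) (x : X) (l : L) :
    SmashProduct.inr k A Γ γ • mk k A Γ X L x l = ∑ i ∈ (ℛ k γ).index,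
      mk k A Γ X L ((ℛ k γ).left i • x)
        (MulOpposite.op (antipodeInv k ((ℛ k γ).right i)) • l) := by
  rw [smul_def, smashAction, SmashProduct.liftAlgHom_inr]
  exact hopfAction_tmul γ x l

variable {X' L' : Type*} [AddCommGroup X'] [Module k X'] [Module A X'] [IsScalarTower k A X']
  [Module Γ X'] [IsScalarTower k Γ X'] [IsEquivariantModule k Γ A X']
  [AddCommGroup L'] [Module k L'] [Module Γᵐᵒᵖ L'] [IsScalarTower k Γᵐᵒᵖ L']

/-- The map `f ⊗ g`. -/
noncomputable def map (f : X →ₗ[k] X') (hA : ∀ (a : A) x, f (a • x) = a • f x)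
    (hΓ : ∀ (γ : Γ) x, f (γ • x) = γ • f x) (g : L →ₗ[k] L')
    (hg : ∀ (γ : Γ) l, g (MulOpposite.op γ • l) = MulOpposite.op γ • g l) :
    Twist k A Γ X L →ₗ[SmashProduct k A Γ] Twist k A Γ X' L' :=
  SmashProduct.linearMapOfCommutes
    (show Twist k A Γ X L →ₗ[k] Twist k A Γ X' L' from TensorProduct.map f g).toAddMonoidHom
    (fun a z => by
      let F : Twist k A Γ X L →ₗ[k] Twist k A Γ X' L' := TensorProduct.map f g
      have hF (x l) : F (mk k A Γ X L x l) = mk k A Γ X' L' (f x) (g l) := rfl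
      change F _ = _ • F _
      induction z using Twist.induction with
      | zero => simp only [smul_zero, map_zero]
      | add z w hz hw => simp only [smul_add, map_add, hz, hw]
      | mk x l => rw [inl_smul_mk, hF, hF, inl_smul_mk, hA])
    (fun γ z => by
      let F : Twist k A Γ X L →ₗ[k] Twist k A Γ X' L' := TensorProduct.map f g
      have hF (x l) : F (mk k A Γ X L x l) = mk k A Γ X' L' (f x) (g l) := rfl
      change F _ = _ • F _
      induction z using Twist.induction with
      | zero => simp only [smul_zero, map_zero]
      | add z w hz hw => simp only [smul_add, map_add, hz, hw]
      | mk x l => simp only [inr_smul_mk, map_sum, hF, hΓ, hg])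

/-- The left side is ∑ γ₁x ⊗ l γ₃ S⁻¹(γ₂), and γ₃ S⁻¹(γ₂) collapses. The formula trades an action on
x for one on l, which shows that `curry` is Γ-linear. -/
lemma mk_op_smul_eq (γ : Γ) (x : X) (l : L) :
    ∑ i ∈ (ℛ k γ).index, SmashProduct.inr k A Γ ((ℛ k γ).left i) •
      mk k A Γ X L x (MulOpposite.op ((ℛ k γ).right i) • l) = mk k A Γ X L (γ • x) l := by
  have key := sweedler_coassoc (k := k) (X := Twist k A Γ X L)
    (LinearMap.mk₂ k (fun g₁ g₂ => (mk k A Γ X L (g₁ • x)) ∘ₗ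
        (Algebra.lsmul k k L).toLinearMap.flip l ∘ₗ
        (MulOpposite.opLinearEquiv k).toLinearMap ∘ₗ LinearMap.mulRight k (antipodeInv k g₂))
      (by intros; simp only [map_add, add_smul, LinearMap.add_comp])
      (by intros; simp only [map_smul, smul_assoc, LinearMap.smul_comp])
      (by intros; ext; simp [mul_add])
      (by intros; ext; simp)) γ
  simp only [LinearMap.mk₂_apply, LinearMap.comp_apply, LinearMap.flip_apply,
    AlgHom.toLinearMap_apply, Algebra.lsmul_coe, LinearMap.mulRight_apply,
    LinearEquiv.coe_coe, MulOpposite.coe_opLinearEquiv] at key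
  simp only [inr_smul_mk, ← mul_smul (_ : Γᵐᵒᵖ), ← MulOpposite.op_mul]
  rw [key]
  simp only [← map_sum, ← Finset.sum_smul, ← Finset.op_sum]
  simp only [sum_mul_antipodeInv, MulOpposite.op_smul, MulOpposite.op_one, smul_assoc, one_smul,
    map_smul]
  exact sweedler_counit_right ((mk k A Γ X L).flip l ∘ₗ
    (Algebra.lsmul k k X).toLinearMap.flip x) γ

end Twist

end Twist

/-! ### The adjunction Hom_{A#Γ}(X ⊗ L, N) = Hom_Γ(L, Hom_A(X, N)). -/

section TwistHomCorrespondence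

variable {k A Γ : Type u} {X L : Type u} [Field k] [Ring Γ] [HopfAlgebra k Γ] [Ring A]
  [Algebra k A] [Module Γ A] [IsModuleAlgebra k Γ A]
  [AddCommGroup X] [Module k X] [Module A X] [IsScalarTower k A X] [Module Γ X]
  [IsScalarTower k Γ X] [IsEquivariantModule k Γ A X]
  [AddCommGroup L] [Module k L] [Module Γᵐᵒᵖ L] [IsScalarTower k Γᵐᵒᵖ L]

lemma smul_twistAct {N : Type*} [AddCommGroup N] [Module k N] [Module A N] [IsScalarTower k A N]
    [Module Γ N] [IsScalarTower k Γ N] [IsEquivariantModule k Γ A N] (c : k) (γ : Γ)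
    (u : X →ₗ[A] N) : twistAct k (c • γ) u = c • twistAct k γ u := by
  ext x
  change TensorProduct.lift (twistAux u x) (Coalgebra.comul (R := k) (c • γ)) = _
  rw [map_smul, map_smul]
  rfl

/-- Here γ₁ S(γ₂) cancels, so values of u at γx are recovered from values of twisted maps at x. -/
lemma sum_smul_twistAct {N : Type*} [AddCommGroup N] [Module k N] [Module A N] [IsScalarTower k A N]
    [Module Γ N] [IsScalarTower k Γ N] [IsEquivariantModule k Γ A N] (γ : Γ)
    (u : X →ₗ[A] N) (x : X) :
    ∑ i ∈ (ℛ k γ).index, (ℛ k γ).left i • twistAct k ((ℛ k γ).right i) u x = u (γ • x) := by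
  have h := sweedler_coassoc' (twistAux u x) (Algebra.lsmul k k N).toLinearMap γ
  simp only [AlgHom.toLinearMap_apply, Algebra.lsmul_coe, twistAux_apply] at h
  simp only [twistAct_apply, Finset.smul_sum]
  rw [← h]
  simp only [← mul_smul, ← Finset.sum_smul, HopfAlgebra.sum_mul_antipode_eq_smul, smul_assoc,
    one_smul]
  exact sweedler_counit_left (u.restrictScalars k ∘ₗ
    (Algebra.lsmul k k X).toLinearMap.flip x) γ

variable [hS : Fact (Function.Bijective (HopfAlgebra.antipode k (A := Γ)))]

/-- This identity is exactly the Γ-linearity of the map x ⊗ l ↦ f(l)(x) on X ⊗ L, so it dictates the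
form of the twisted action. -/
lemma sum_twistAct_antipodeInv {N : Type*} [AddCommGroup N] [Module k N] [Module A N]
    [IsScalarTower k A N] [Module Γ N] [IsScalarTower k Γ N] [IsEquivariantModule k Γ A N] (γ : Γ)
    (u : X →ₗ[A] N) (x : X) :
    ∑ i ∈ (ℛ k γ).index, twistAct k (antipodeInv k ((ℛ k γ).right i)) u ((ℛ k γ).left i • x) =
      γ • u x := by
  -- Moving γ₁ out of the argument merges both twists into one, by S⁻¹(γ₃)γ₂, which collapses after
  -- regrouping. In this way the comultiplication of S⁻¹ is never computed.
  simp only [← sum_smul_twistAct (k := k) _ _ x, ← twistAct_mul]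
  let n : Γ →ₗ[k] N := TensorProduct.lift (twistAux u x) ∘ₗ Coalgebra.comul
  have hn (γ : Γ) : twistAct k γ u x = n γ := rfl
  have key := sweedler_coassoc (k := k) (X := N)
    (LinearMap.mk₂ k (fun g₁ g₂ => Algebra.lsmul k k N g₁ ∘ₗ n ∘ₗ
        LinearMap.mulRight k g₂ ∘ₗ antipodeInv k)
      (by intros; simp only [map_add, LinearMap.add_comp])
      (by intros; simp only [map_smul, LinearMap.smul_comp])
      (by intros; ext; simp [mul_add])
      (by intros; ext; simpa using smul_comm _ _ _)) γ
  simp only [LinearMap.mk₂_apply, LinearMap.comp_apply, Algebra.lsmul_coe,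
    LinearMap.mulRight_apply] at key
  simp only [hn]
  rw [key]
  simp only [← Finset.smul_sum, ← map_sum, sum_antipodeInv_mul, map_smul]
  rw [← hn, twistAct_one]
  refine Eq.trans ?_ (sweedler_counit_right
    ((Algebra.lsmul k k N).toLinearMap.flip (u x)) γ)
  exact Finset.sum_congr rfl fun i _ => smul_comm _ _ _

variable {N N' : ModuleCat.{u} (SmashProduct k A Γ)}

namespace Twist

/-- A right `Γ`-linear map from `L` to the `A`-linear maps `X → N` as a map `X ⊗ L → N`. -/
noncomputable def lift (f : L →ₗ[k] (X →ₗ[A] N))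
    (hf : ∀ (γ : Γ) l, f (MulOpposite.op γ • l) = twistAct k γ (f l)) :
    Twist k A Γ X L →ₗ[SmashProduct k A Γ] N :=
  SmashProduct.linearMapOfCommutes
    (show Twist k A Γ X L →ₗ[k] N from TensorProduct.lift
      (LinearMap.restrictScalarsₗ k A X N k ∘ₗ f).flip).toAddMonoidHom
    (fun a z => by
      let F : Twist k A Γ X L →ₗ[k] N := TensorProduct.lift
        (LinearMap.restrictScalarsₗ k A X N k ∘ₗ f).flip
      have hF (x l) : F (mk k A Γ X L x l) = f l x := rfl
      change F _ = _ • F _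
      induction z using Twist.induction with
      | zero => simp only [smul_zero, map_zero]
      | add z w hz hw => simp only [smul_add, map_add, hz, hw]
      | mk x l =>
        rw [inl_smul_mk, hF, hF, map_smul]
        rfl)
    (fun γ z => by
      let F : Twist k A Γ X L →ₗ[k] N := TensorProduct.lift
        (LinearMap.restrictScalarsₗ k A X N k ∘ₗ f).flip
      have hF (x l) : F (mk k A Γ X L x l) = f l x := rfl
      change F _ = _ • F _
      induction z using Twist.induction with
      | zero => simp only [smul_zero, map_zero]
      | add z w hz hw => simp only [smul_add, map_add, hz, hw]
      | mk x l =>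
        simp only [inr_smul_mk, map_sum, hF, hf]
        exact sum_twistAct_antipodeInv γ (f l) x)

lemma linearMap_ext {f g : Twist k A Γ X L →ₗ[SmashProduct k A Γ] N}
    (h : ∀ x l, f (mk k A Γ X L x l) = g (mk k A Γ X L x l)) : f = g := by
  ext z
  induction z using Twist.induction with
  | zero => simp only [map_zero]
  | add z w hz hw => simp only [map_add, hz, hw]
  | mk x l => exact h x l

/-- The family of `A`-linear maps `X → N` given by an `A # Γ`-linear map `X ⊗ L → N`. -/
noncomputable def curry (F : Twist k A Γ X L →ₗ[SmashProduct k A Γ] N) :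
    L →ₗ[k] (X →ₗ[A] N) where
  toFun l :=
    { toFun := fun x => F (mk k A Γ X L x l)
      map_add' := fun x y => by simp only [map_add, LinearMap.add_apply]
      map_smul' := fun a x => by
        rw [← inl_smul_mk, map_smul]
        rfl }
  map_add' l l' := by ext x; simp
  map_smul' c l := by
    ext x
    exact (congrArg F (map_smul (mk k A Γ X L x) c l)).trans ((F.restrictScalars k).map_smul c _)

lemma curry_apply (F : Twist k A Γ X L →ₗ[SmashProduct k A Γ] N) (l : L) (x : X) :
    curry F l x = F (mk k A Γ X L x l) := rfl

/-- Expanding γ₂x ⊗ l by `mk_op_smul_eq` gives ∑ S(γ₁)γ₂ F(x ⊗ lγ₃), which collapses to F(x ⊗ lγ).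
-/
lemma curry_op_smul (F : Twist k A Γ X L →ₗ[SmashProduct k A Γ] N) (γ : Γ) (l : L) :
    curry F (MulOpposite.op γ • l) = twistAct k γ (curry F l) := by
  ext x
  have key := sweedler_coassoc (k := k) (X := N)
    (LinearMap.mk₂ k (fun g₁ g₂ =>
        Algebra.lsmul k k N (HopfAlgebra.antipode k g₁ * g₂) ∘ₗ F.restrictScalars k ∘ₗ
          mk k A Γ X L x ∘ₗ (Algebra.lsmul k k L).toLinearMap.flip l ∘ₗ
            (MulOpposite.opLinearEquiv k (M := Γ)).toLinearMap)
      (by intros; simp only [map_add, add_mul, LinearMap.add_comp])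
      (by intros; simp only [map_smul, smul_mul_assoc, LinearMap.smul_comp])
      (by intros; simp only [map_add, mul_add, LinearMap.add_comp])
      (by intros; simp only [map_smul, mul_smul_comm, LinearMap.smul_comp])) γ
  simp only [LinearMap.mk₂_apply, LinearMap.comp_apply, LinearMap.flip_apply,
    AlgHom.toLinearMap_apply, Algebra.lsmul_coe, LinearMap.coe_restrictScalars,
    LinearEquiv.coe_coe, MulOpposite.coe_opLinearEquiv] at key
  rw [twistAct_apply]
  simp only [curry_apply, ← mk_op_smul_eq _ x l, map_sum, Finset.smul_sum, map_smul]
  have e (g h : Γ) (n : N) : g • SmashProduct.inr k A Γ h • n = (g * h) • n := (mul_smul g h n).symm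
  simp only [e]
  rw [← key]
  simp only [← Finset.sum_smul, HopfAlgebra.sum_antipode_mul_eq_smul, smul_assoc, one_smul]
  exact (sweedler_counit_left (F.restrictScalars k ∘ₗ
    mk k A Γ X L x ∘ₗ (Algebra.lsmul k k L).toLinearMap.flip l ∘ₗ
      (MulOpposite.opLinearEquiv k (M := Γ)).toLinearMap) γ).symm

/-- Under the adjunction, a lifting problem for X ⊗ L becomes one for L along Hom_A(X, E) → Hom_A(X,
N). That map is surjective because X is projective over A, and L is projective over Γᵐᵒᵖ. -/
instance projective [Module.Projective A X] [Module.Projective Γᵐᵒᵖ L] :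
    Projective (ModuleCat.of (SmashProduct k A Γ) (Twist k A Γ X L)) where
  factors {E N} f e he := by
    let eA : E →ₗ[A] N :=
      { toFun := e.hom, map_add' := map_add e.hom, map_smul' := fun a x => e.hom.map_smul _ x }
    have hsurj : Function.Surjective eA := (ModuleCat.epi_iff_surjective e).mp he
    have heΓ (γ : Γ) (x : E) : eA (γ • x) = γ • eA x := e.hom.map_smul _ x
    let φ : L →ₗ[Γᵐᵒᵖ] TwistedHom k A Γ X N :=
      { toFun := fun l => curry f.hom l
        map_add' := fun l l' => map_add (curry f.hom) l l'
        map_smul' := fun γ l => curry_op_smul f.hom γ.unop l }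
    have hpost : Function.Surjective (TwistedHom.postcomp (k := k) (Γ := Γ) (X := X) eA heΓ) :=
      fun u => Module.projective_lifting_property eA u hsurj
    obtain ⟨ψ, hψ⟩ := Module.projective_lifting_property _ φ hpost
    let g : L →ₗ[k] (X →ₗ[A] E) :=
      { toFun := fun l => ψ l
        map_add' := fun l l' => map_add ψ l l'
        map_smul' := fun c l => by
          -- The lift ψ is only known to be linear over Γᵐᵒᵖ; a scalar c acts as c·1 ∈ Γ, which
          -- gives linearity over k.
          have h : c • l = (MulOpposite.op (c • (1 : Γ))) • l := by
            rw [MulOpposite.op_smul, smul_assoc, MulOpposite.op_one, one_smul]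
          rw [h, map_smul]
          exact (smul_twistAct c 1 (_ : X →ₗ[A] E)).trans
            (congrArg (c • ·) (twistAct_one (_ : X →ₗ[A] E))) }
    have hg : ∀ (γ : Γ) l, g (MulOpposite.op γ • l) = twistAct k γ (g l) :=
      fun γ l => map_smul ψ _ l
    refine ⟨ModuleCat.ofHom (lift g hg), ?_⟩
    ext : 1
    refine linearMap_ext fun x l => ?_
    exact congrArg (fun u : X →ₗ[A] N => u x) (LinearMap.congr_fun hψ l)

end Twist

end TwistHomCorrespondence

/-! ### Contractibility of exact complexes of projectives. -/

section Contraction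

variable {S : Type*} [Ring S]

lemma Function.Exact.exists_lift_of_projective {P Y Y' Y'' : Type*} [AddCommGroup P] [Module S P]
    [Module.Projective S P] [AddCommGroup Y] [Module S Y] [AddCommGroup Y'] [Module S Y']
    [AddCommGroup Y''] [Module S Y''] {d : Y →ₗ[S] Y'} {e : Y' →ₗ[S] Y''}
    (h : Function.Exact d e) (f : P →ₗ[S] Y') (hf : e ∘ₗ f = 0) : ∃ g : P →ₗ[S] Y, d ∘ₗ g = f := by
  obtain ⟨g, hg⟩ := Module.projective_lifting_property d.rangeRestrict
    (f.codRestrict (LinearMap.range d) fun x => (h _).mp (LinearMap.congr_fun hf x))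
    d.surjective_rangeRestrict
  refine ⟨g, LinearMap.ext fun x => ?_⟩
  exact congrArg Subtype.val (LinearMap.congr_fun hg x)

/-- An exact complex of projective modules which ends in a projective module is contractible. -/
lemma exists_contraction {X : ℕ → Type*} [∀ n, AddCommGroup (X n)] [∀ n, Module S (X n)]
    [∀ n, Module.Projective S (X n)] {C : Type*} [AddCommGroup C] [Module S C]
    [Module.Projective S C] (d : ∀ n, X (n + 1) →ₗ[S] X n) (ε : X 0 →ₗ[S] C)
    (hε : Function.Surjective ε) (h0 : Function.Exact (d 0) ε)
    (hd : ∀ n, Function.Exact (d (n + 1)) (d n)) :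
    ∃ (s : C →ₗ[S] X 0) (h : ∀ n, X n →ₗ[S] X (n + 1)), (∀ c, ε (s c) = c) ∧
      (∀ x, d 0 (h 0 x) = x - s (ε x)) ∧
      ∀ n x, d (n + 1) (h (n + 1) x) = x - h n (d n x) := by
  obtain ⟨s, hs⟩ := Module.projective_lifting_property ε LinearMap.id hε
  have hs' (c) : ε (s c) = c := LinearMap.congr_fun hs c
  obtain ⟨h₀, hh₀⟩ := h0.exists_lift_of_projective (LinearMap.id - s ∘ₗ ε)
    (LinearMap.ext fun x => by simp [hs'])
  -- The relation d g d = d says that id - g d takes values in the kernel of d, so it lifts. The new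
  -- map satisfies the same relation since d d = 0, so the recursion below carries the relation
  -- along with the map.
  have step (n : ℕ) (g : X n →ₗ[S] X (n + 1)) (hg : d n ∘ₗ g ∘ₗ d n = d n) :
      ∃ g' : X (n + 1) →ₗ[S] X (n + 2), d (n + 1) ∘ₗ g' = LinearMap.id - g ∘ₗ d n :=
    (hd n).exists_lift_of_projective _ (by rw [LinearMap.comp_sub, hg, LinearMap.comp_id, sub_self])
  choose g' hg' using step
  have hdd (n : ℕ) : d n ∘ₗ d (n + 1) = 0 := LinearMap.ext (hd n).apply_apply_eq_zero
  let h : ∀ n, {g : X n →ₗ[S] X (n + 1) // d n ∘ₗ g ∘ₗ d n = d n} := fun n =>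
    Nat.rec ⟨h₀, by
        rw [← LinearMap.comp_assoc, hh₀, LinearMap.sub_comp, LinearMap.comp_assoc,
          (LinearMap.ext h0.apply_apply_eq_zero : ε ∘ₗ d 0 = 0)]
        simp⟩
      (fun n g => ⟨g' n g.1 g.2, by
        rw [← LinearMap.comp_assoc, hg', LinearMap.sub_comp, LinearMap.comp_assoc, hdd]
        simp⟩) n
  exact ⟨s, fun n => (h n).1, hs', fun x => LinearMap.congr_fun hh₀ x,
    fun n x => LinearMap.congr_fun (hg' n (h n).1 (h n).2) x⟩

end Contraction

/-! ### Consequences of the freeness of the bimodules K_n. -/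

namespace EquivariantResolution

variable {k A Γ : Type u} [Field k] [Ring Γ] [HopfAlgebra k Γ] [Ring A]
  [Algebra k A] [Module Γ A] [IsModuleAlgebra k Γ A] (K : EquivariantResolution k A Γ)

/-- The bimodule `K_n` as a free bimodule. -/
noncomputable def freeEquiv (n : ℕ) : A ⊗[k] (K.base n ⊗[k] A) ≃ₗ[k] K.X n :=
  LinearEquiv.ofBijective _ (K.base_free n)

lemma freeEquiv_tmul (n : ℕ) (a b : A) (v : K.base n) :
    K.freeEquiv n (a ⊗ₜ (v ⊗ₜ b)) = a • MulOpposite.op b • (v : K.X n) := rfl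

lemma freeEquiv_symm_smul_op_smul (n : ℕ) (a b : A) (v : K.base n) :
    (K.freeEquiv n).symm (a • MulOpposite.op b • (v : K.X n)) = a ⊗ₜ (v ⊗ₜ b) := by
  rw [← freeEquiv_tmul, LinearEquiv.symm_apply_apply]

lemma induction_free (n : ℕ) {P : K.X n → Prop} (x : K.X n) (zero : P 0)
    (smul : ∀ (a b : A) (v : K.base n), P (a • MulOpposite.op b • (v : K.X n)))
    (add : ∀ x y, P x → P y → P (x + y)) : P x := by
  obtain ⟨t, rfl⟩ := (K.freeEquiv n).surjective x
  induction t using TensorProduct.induction_on with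
  | zero => rw [map_zero]; exact zero
  | add t s ht hs => rw [map_add]; exact add _ _ ht hs
  | tmul a t =>
    induction t using TensorProduct.induction_on with
    | zero => rw [TensorProduct.tmul_zero, map_zero]; exact zero
    | add t s ht hs => rw [TensorProduct.tmul_add, map_add]; exact add _ _ ht hs
    | tmul v b => exact smul a b v

/-- With V the base space, A ⊗ V ⊗ A is Aᵐᵒᵖ tensored with the vector space A ⊗ V, hence free on the
right. -/
instance projective_right (n : ℕ) : Module.Projective Aᵐᵒᵖ (K.X n) := by
  let e : Aᵐᵒᵖ ⊗[k] (A ⊗[k] K.base n) ≃ₗ[k] K.X n :=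
    (TensorProduct.comm k _ _).trans ((TensorProduct.assoc k _ _ _).trans
      ((TensorProduct.congr (LinearEquiv.refl k A) (TensorProduct.congr (LinearEquiv.refl k _)
        (MulOpposite.opLinearEquiv k).symm)).trans (K.freeEquiv n)))
  have he (a b : A) (v : K.base n) : e (MulOpposite.op b ⊗ₜ (a ⊗ₜ v)) =
      a • MulOpposite.op b • (v : K.X n) := rfl
  have he' (c : Aᵐᵒᵖ) (t : Aᵐᵒᵖ ⊗[k] (A ⊗[k] K.base n)) : e (c • t) = c • e t := ?_
  · exact Module.Projective.of_equiv
      ({ e with map_smul' := he' } : Aᵐᵒᵖ ⊗[k] (A ⊗[k] K.base n) ≃ₗ[Aᵐᵒᵖ] K.X n)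
  induction t using TensorProduct.induction_on with
  | zero => simp only [smul_zero, map_zero]
  | add t s ht hs => simp only [smul_add, map_add, ht, hs]
  | tmul b t =>
    induction t using TensorProduct.induction_on with
    | zero => simp only [TensorProduct.tmul_zero, smul_zero, map_zero]
    | add t s ht hs => simp only [TensorProduct.tmul_add, smul_add, map_add, ht, hs]
    | tmul a v =>
      change e ((c * b) ⊗ₜ (a ⊗ₜ v)) = c • (a • b • (v : K.X n))
      rw [← smul_comm a c, ← mul_smul]
      rfl

variable (M : Type u) [AddCommGroup M] [Module k M] [Module A M] [IsScalarTower k A M]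

/-- With V the base space, avb ⊗ m ↦ a ⊗ (v ⊗ bm) identifies K_n ⊗_A M with A ⊗ (V ⊗ M), which is
free over A because k is a field. No condition on M is needed. -/
instance projective_balTensor (n : ℕ) : Module.Projective A (BalTensor k A (K.X n) M) := by
  let B := BalTensor k A (K.X n) M
  let f : A ⊗[k] (K.base n ⊗[k] M) →ₗ[k] B := TensorProduct.lift
    ((LinearMap.llcomp k (K.base n ⊗[k] M) B B ∘ₗ (Algebra.lsmul k k B).toLinearMap).flip
      (TensorProduct.lift ((BalTensor.mk k A (K.X n) M) ∘ₗ (K.base n).subtype)))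
  have hf (a : A) (v : K.base n) (m : M) :
      f (a ⊗ₜ (v ⊗ₜ m)) = a • BalTensor.mk k A (K.X n) M v m := rfl
  let g' : K.X n →ₗ[k] M →ₗ[k] A ⊗[k] (K.base n ⊗[k] M) :=
    (LinearMap.lTensorHom A ∘ₗ LinearMap.lTensorHom (K.base n) ∘ₗ
      (Algebra.lsmul k k M (A := A)).toLinearMap.flip).flip ∘ₗ (K.freeEquiv n).symm.toLinearMap
  have hg' (a b : A) (v : K.base n) (m : M) :
      g' (a • MulOpposite.op b • (v : K.X n)) m = a ⊗ₜ (v ⊗ₜ (b • m)) := by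
    simp only [g', LinearMap.comp_apply, LinearEquiv.coe_coe, freeEquiv_symm_smul_op_smul]
    rfl
  let g : B →ₗ[k] A ⊗[k] (K.base n ⊗[k] M) := BalTensor.lift g' fun x c m => by
    induction x using K.induction_free with
    | zero => simp only [smul_zero, map_zero, LinearMap.zero_apply]
    | add x y hx hy => simp only [smul_add, map_add, LinearMap.add_apply, hx, hy]
    | smul a b v =>
      rw [← smul_comm a (MulOpposite.op c), ← mul_smul, ← MulOpposite.op_mul, hg', hg', mul_smul]
  have hg (x : K.X n) (m : M) : g (BalTensor.mk k A (K.X n) M x m) = g' x m := rfl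
  have hfg (z : B) : f (g z) = z := by
    induction z using BalTensor.induction with
    | zero => simp only [map_zero]
    | add z w hz hw => simp only [map_add, hz, hw]
    | mk x m =>
      rw [hg]
      induction x using K.induction_free with
      | zero => simp only [map_zero, LinearMap.zero_apply]
      | add x y hx hy => simp only [map_add, LinearMap.add_apply, hx, hy]
      | smul a b v => rw [hg', hf, ← BalTensor.mk_op_smul, BalTensor.smul_mk]
  have hgf (t : A ⊗[k] (K.base n ⊗[k] M)) : g (f t) = t := by
    induction t using TensorProduct.induction_on with
    | zero => simp only [map_zero]
    | add t s ht hs => simp only [map_add, ht, hs]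
    | tmul a t =>
      induction t using TensorProduct.induction_on with
      | zero => simp only [TensorProduct.tmul_zero, map_zero]
      | add t s ht hs => simp only [TensorProduct.tmul_add, map_add, ht, hs]
      | tmul v m =>
        have h := hg' a 1 v m
        rw [MulOpposite.op_one, one_smul, one_smul] at h
        rw [hf, BalTensor.smul_mk, hg, h]
  have hsmul (a : A) (t : A ⊗[k] (K.base n ⊗[k] M)) : f (a • t) = a • f t := ?_
  · exact Module.Projective.of_equiv
      ({ toFun := f, invFun := g, left_inv := hgf, right_inv := hfg, map_add' := map_add f,
         map_smul' := hsmul } : A ⊗[k] (K.base n ⊗[k] M) ≃ₗ[A] B)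
  induction t using TensorProduct.induction_on with
  | zero => simp only [smul_zero, map_zero]
  | add t s ht hs => simp only [smul_add, map_add, ht, hs]
  | tmul b t =>
    induction t using TensorProduct.induction_on with
    | zero => simp only [TensorProduct.tmul_zero, smul_zero, map_zero]
    | add t s ht hs => simp only [TensorProduct.tmul_add, smul_add, map_add, ht, hs]
    | tmul v m => rw [TensorProduct.smul_tmul', hf, hf, smul_eq_mul, mul_smul]

/-- The complex `K ⊗_A M → M → 0` is contractible over `k`. -/
lemma exists_contraction_balTensor (η : BalTensor k A (K.X 0) M →ₗ[k] M)
    (hη : ∀ x m, η (BalTensor.mk k A (K.X 0) M x m) = K.aug x • m) :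
    ∃ (s : M →ₗ[k] BalTensor k A (K.X 0) M)
      (h : ∀ n, BalTensor k A (K.X n) M →ₗ[k] BalTensor k A (K.X (n + 1)) M),
      (∀ m, η (s m) = m) ∧ (∀ z, K.dLeft 0 M (h 0 z) = z - s (η z)) ∧
      ∀ n z, K.dLeft (n + 1) M (h (n + 1) z) = z - h n (K.dLeft n M z) := by
  -- The contraction has to be linear on the right, so that tensoring with M over A preserves it. It
  -- exists since all K_n and A itself are projective over Aᵐᵒᵖ.
  have : Module.Projective Aᵐᵒᵖ A := Module.Projective.of_equiv
    ({ toFun := MulOpposite.unop, invFun := MulOpposite.op, left_inv := fun _ => rfl,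
       right_inv := fun _ => rfl, map_add' := fun _ _ => rfl, map_smul' := fun _ _ => rfl } :
      Aᵐᵒᵖ ≃ₗ[Aᵐᵒᵖ] A)
  obtain ⟨s, h, hs, h0, hd⟩ := exists_contraction (S := Aᵐᵒᵖ) (X := K.X) (C := A)
    (fun n => { K.d n with map_smul' := fun a x => K.d_op_smul n a.unop x })
    { K.aug with map_smul' := fun a x => K.aug_op_smul a.unop x }
    K.aug_surjective K.exact_aug K.exact_d
  have e (c : k) {n : ℕ} (x : K.X n) : c • x = (algebraMap k Aᵐᵒᵖ c) • x :=
    (algebraMap_smul Aᵐᵒᵖ c x).symm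
  let h' (n : ℕ) : K.X n →ₗ[k] K.X (n + 1) :=
    { toFun := h n
      map_add' := map_add (h n)
      map_smul' := fun c x => by
        change h n (c • x) = c • h n x
        rw [e, map_smul, e] }
  -- Under A ⊗_A M = M the right A-linear section s of τ becomes m ↦ s(1) ⊗ m.
  refine ⟨BalTensor.mk k A (K.X 0) M (s 1), fun n => BalTensor.map (h' n) LinearMap.id
    (fun a x => (h n).map_smul _ x) (fun _ _ => rfl), fun m => ?_, fun z => ?_, fun n z => ?_⟩
  · rw [hη]
    refine Eq.trans ?_ (one_smul A m)
    exact congrArg (· • m) (hs 1)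
  · induction z using BalTensor.induction with
    | zero => simp only [map_zero, sub_zero]
    | add z w hz hw => simp only [map_add, hz, hw]; abel
    | mk x m =>
      rw [hη, ← BalTensor.mk_op_smul, ← map_smul s, ← LinearMap.sub_apply, ← map_sub]
      refine congrArg (fun y => BalTensor.mk k A (K.X 0) M y m) ((h0 x).trans ?_)
      refine congrArg (fun y => x - s y) ?_
      exact (one_mul _).symm
  · induction z using BalTensor.induction with
    | zero => simp only [map_zero, sub_zero]
    | add z w hz hw => simp only [map_add, hz, hw]; abel
    | mk x m =>
      change _ = BalTensor.mk k A (K.X (n + 1)) M x m -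
        BalTensor.mk k A (K.X (n + 1)) M (h n (K.d n x)) m
      rw [← LinearMap.sub_apply, ← map_sub]
      exact congrArg (fun y => BalTensor.mk k A (K.X (n + 1)) M y m) (hd n x)

end EquivariantResolution

/-- The complex `L → k → 0` is contractible over `k`. -/
lemma TrivialResolution.exists_contraction {k Γ : Type u} [Field k] [Ring Γ] [HopfAlgebra k Γ]
    (L : TrivialResolution k Γ) :
    ∃ (s : k →ₗ[k] L.X 0) (h : ∀ n, L.X n →ₗ[k] L.X (n + 1)), (∀ c, L.aug (s c) = c) ∧
      (∀ x, L.d 0 (h 0 x) = x - s (L.aug x)) ∧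
      ∀ n x, L.d (n + 1) (h (n + 1) x) = x - h n (L.d n x) :=
  -- Over the field k every term is projective.
  _root_.exists_contraction L.d L.aug L.aug_surjective L.exact_aug L.exact_d

/-! ### The total complex and its exactness. -/

section TotalComplex

variable {k A Γ : Type u} [Field k] [Ring Γ] [HopfAlgebra k Γ] [Ring A]
  [Algebra k A] [Module Γ A] [IsModuleAlgebra k Γ A]
  (K : EquivariantResolution k A Γ) (L : TrivialResolution k Γ)
  (M : ModuleCat.{u} (SmashProduct k A Γ))
  [hS : Fact (Function.Bijective (HopfAlgebra.antipode k (A := Γ)))]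

lemma EquivariantResolution.dLeft_act (n : ℕ) (γ : Γ) (z : BalTensor k A (K.X (n + 1)) M) :
    K.dLeft n M (γ • z) = γ • K.dLeft n M z := by
  simp only [BalTensor.hopf_smul_def]
  induction z using BalTensor.induction with
  | zero => simp only [map_zero]
  | add z w hz hw => simp only [map_add, hz, hw]
  | mk x m =>
    simp only [EquivariantResolution.dLeft, BalTensor.map_mk, BalTensor.diag_mk, map_sum, K.d_act,
      LinearMap.id_apply]

lemma EquivariantResolution.dLeft_dLeft (n : ℕ) (z : BalTensor k A (K.X (n + 2)) M) :
    K.dLeft n M (K.dLeft (n + 1) M z) = 0 := by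
  induction z using BalTensor.induction with
  | zero => simp only [map_zero]
  | add z w hz hw => simp only [map_add, hz, hw, add_zero]
  | mk x m =>
    simp only [EquivariantResolution.dLeft, BalTensor.map_mk]
    rw [(K.exact_d n).apply_apply_eq_zero, map_zero, LinearMap.zero_apply]

/-- The module `(K_q ⊗_A M) ⊗ L_p`. -/
abbrev Piece (p q : ℕ) : Type u := Twist k A Γ (BalTensor k A (K.X q) M) (L.X p)

/-- The map `d ⊗ id`, where `d` is the differential of `K ⊗_A M`. -/
noncomputable def pieceDK (p q : ℕ) :
    Piece K L M p (q + 1) →ₗ[SmashProduct k A Γ] Piece K L M p q :=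
  Twist.map (K.dLeft q M) (K.dLeft_smul q M) (K.dLeft_act M q) LinearMap.id (fun _ _ => rfl)

/-- The map `id ⊗ d`, where `d` is the differential of `L`. -/
noncomputable def pieceDL (p q : ℕ) :
    Piece K L M (p + 1) q →ₗ[SmashProduct k A Γ] Piece K L M p q :=
  Twist.map LinearMap.id (fun _ _ => rfl) (fun _ _ => rfl) (L.d p) (L.d_op_smul p)

variable {K L M} in
lemma pieceDK_mk (p q : ℕ) (z : BalTensor k A (K.X (q + 1)) M) (l : L.X p) :
    pieceDK K L M p q (Twist.mk k A Γ _ _ z l) = Twist.mk k A Γ _ _ (K.dLeft q M z) l := rfl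

variable {K L M} in
lemma pieceDL_mk (p q : ℕ) (z : BalTensor k A (K.X q) M) (l : L.X (p + 1)) :
    pieceDL K L M p q (Twist.mk k A Γ _ _ z l) = Twist.mk k A Γ _ _ z (L.d p l) := rfl

lemma pieceDK_pieceDK (p q : ℕ) (t) : pieceDK K L M p q (pieceDK K L M p (q + 1) t) = 0 := by
  induction t using Twist.induction with
  | zero => simp only [map_zero]
  | add z w hz hw => simp only [map_add, hz, hw, add_zero]
  | mk z l => rw [pieceDK_mk, pieceDK_mk, K.dLeft_dLeft, map_zero, LinearMap.zero_apply]

lemma pieceDL_pieceDL (p q : ℕ) (t) : pieceDL K L M p q (pieceDL K L M (p + 1) q t) = 0 := by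
  induction t using Twist.induction with
  | zero => simp only [map_zero]
  | add z w hz hw => simp only [map_add, hz, hw, add_zero]
  | mk z l => rw [pieceDL_mk, pieceDL_mk, (L.exact_d p).apply_apply_eq_zero, map_zero]

lemma pieceDK_pieceDL (p q : ℕ) (t) : pieceDK K L M p q (pieceDL K L M p (q + 1) t) =
    pieceDL K L M p q (pieceDK K L M (p + 1) q t) := by
  induction t using Twist.induction with
  | zero => simp only [map_zero]
  | add z w hz hw => simp only [map_add, hz, hw]
  | mk z l => rfl

/-- The families of elements of `(K_q ⊗_A M) ⊗ L_p`, for all `p` and `q`. -/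
abbrev PieceFamily : Type u := ∀ p q : ℕ, Piece K L M p q

/-- The differential of the total complex, on all families. -/
noncomputable def familyD : PieceFamily K L M →ₗ[SmashProduct k A Γ] PieceFamily K L M :=
  -- The differential is defined on families over all (p, q), and the degree is imposed afterwards
  -- by `Tot`; this keeps equalities of indices out of the types. The sign (-1)^p makes the two
  -- commuting differentials anticommute.
  LinearMap.pi fun p => LinearMap.pi fun q =>
    pieceDL K L M p q ∘ₗ LinearMap.proj q ∘ₗ LinearMap.proj (p + 1) +
      (-1 : k) ^ p • pieceDK K L M p q ∘ₗ LinearMap.proj (q + 1) ∘ₗ LinearMap.proj p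

lemma familyD_apply (w : PieceFamily K L M) (p q : ℕ) : familyD K L M w p q =
    pieceDL K L M p q (w (p + 1) q) + (-1 : k) ^ p • pieceDK K L M p q (w p (q + 1)) := rfl

lemma familyD_familyD (w : PieceFamily K L M) : familyD K L M (familyD K L M w) = 0 := by
  funext p q
  have h (c : k) (t) : pieceDK K L M p q (c • t) = c • pieceDK K L M p q t :=
    ((pieceDK K L M p q).restrictScalars k).map_smul c t
  have h' (c : k) (t) : pieceDL K L M p q (c • t) = c • pieceDL K L M p q t :=
    ((pieceDL K L M p q).restrictScalars k).map_smul c t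
  simp only [familyD_apply, map_add, h, h', pieceDK_pieceDK, pieceDL_pieceDL, pieceDK_pieceDL,
    smul_zero, zero_add, add_zero, pow_succ, Pi.zero_apply]
  simp

/-- The total complex of `(K ⊗_A M) ⊗ L`. -/
def Tot (n : ℕ) : Submodule (SmashProduct k A Γ) (PieceFamily K L M) where
  carrier := {w | ∀ p q, p + q ≠ n → w p q = 0}
  zero_mem' _ _ _ := rfl
  add_mem' hv hw p q h := by rw [Pi.add_apply, Pi.add_apply, hv p q h, hw p q h, add_zero]
  smul_mem' r w hw p q h := by rw [Pi.smul_apply, Pi.smul_apply, hw p q h, smul_zero]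

lemma familyD_mem (n : ℕ) (w : PieceFamily K L M) (hw : w ∈ Tot K L M (n + 1)) :
    familyD K L M w ∈ Tot K L M n := fun p q h => by
  rw [familyD_apply, hw (p + 1) q (by omega), hw p (q + 1) (by omega), map_zero, map_zero,
    smul_zero, add_zero]

/-- The differential of the total complex. -/
noncomputable def totD (n : ℕ) : Tot K L M (n + 1) →ₗ[SmashProduct k A Γ] Tot K L M n :=
  (familyD K L M).restrict (familyD_mem K L M n)

lemma totD_coe (n : ℕ) (w : Tot K L M (n + 1)) : (totD K L M n w).1 = familyD K L M w.1 := rfl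

lemma totD_totD (n : ℕ) (w : Tot K L M (n + 2)) : totD K L M n (totD K L M (n + 1) w) = 0 :=
  Subtype.ext (familyD_familyD K L M w.1)

/-- The homotopy on all families given by contractions of `K ⊗_A M` and of `L`. -/
noncomputable def familyH
    (h : ∀ n, BalTensor k A (K.X n) M →ₗ[k] BalTensor k A (K.X (n + 1)) M)
    (s' : k →ₗ[k] L.X 0) (h' : ∀ n, L.X n →ₗ[k] L.X (n + 1)) (w : PieceFamily K L M) :
    PieceFamily K L M
  | 0, 0 => 0
  | 0, q + 1 => TensorProduct.map (h q) (s' ∘ₗ L.aug) (w 0 q)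
  | p + 1, q => TensorProduct.map LinearMap.id (h' p) (w p q)

/-- The homotopy contracts L in every row; what it leaves is the part of column p = 0 in the image
of s', which is contracted by that of K ⊗_A M. The only remaining defect is at (0, 0), and it is
killed by the hypothesis on the augmentation. The contractions are just k-linear, which is enough
for exactness. -/
lemma exists_familyD_eq (η : BalTensor k A (K.X 0) M →ₗ[k] M)
    (hη : ∀ x m, η (BalTensor.mk k A (K.X 0) M x m) = K.aug x • m) (w : PieceFamily K L M)
    (hw : familyD K L M w = 0)
    (h0 : TensorProduct.lift ((LinearMap.lsmul k M).flip.compl₁₂ η L.aug) (w 0 0) = 0) :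
    ∃ v : PieceFamily K L M, familyD K L M v = w ∧ ∀ n, w ∈ Tot K L M n → v ∈ Tot K L M (n + 1) := by
  obtain ⟨s, h, hs, hh0, hh⟩ := K.exists_contraction_balTensor M η hη
  obtain ⟨s', h', hs', hh0', hh'⟩ := L.exists_contraction
  have hD (p q : ℕ) := congrFun (congrFun hw p) q
  simp only [familyD_apply, Pi.zero_apply] at hD
  let U (q : ℕ) : Piece K L M 0 q →ₗ[k] Piece K L M 0 (q + 1) :=
    TensorProduct.map (h q) (s' ∘ₗ L.aug)
  let V (p q : ℕ) : Piece K L M p q →ₗ[k] Piece K L M (p + 1) q :=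
    TensorProduct.map LinearMap.id (h' p)
  let W (q : ℕ) : Piece K L M 0 q →ₗ[k] Piece K L M 0 q :=
    TensorProduct.map LinearMap.id (s' ∘ₗ L.aug)
  let T : Piece K L M 0 0 →ₗ[k] M := TensorProduct.lift
    ((LinearMap.lsmul k M).flip.compl₁₂ η L.aug)
  have hU (q z l) : U q (Twist.mk k A Γ _ _ z l) = Twist.mk k A Γ _ _ (h q z) (s' (L.aug l)) := rfl
  have hV (p q z l) : V p q (Twist.mk k A Γ _ _ z l) = Twist.mk k A Γ _ _ z (h' p l) := rfl
  have hW (q z l) : W q (Twist.mk k A Γ _ _ z l) = Twist.mk k A Γ _ _ z (s' (L.aug l)) := rfl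
  have hT (z l) : T (Twist.mk k A Γ _ _ z l) = L.aug l • η z := rfl
  have hDLV (p q) (t : Piece K L M (p + 1) q) :
      pieceDL K L M (p + 1) q (V (p + 1) q t) = t - V p q (pieceDL K L M p q t) := by
    induction t using Twist.induction with
    | zero => simp only [map_zero, sub_zero]
    | add z w hz hw => simp only [map_add, hz, hw]; abel
    | mk z l => rw [hV, pieceDL_mk, pieceDL_mk, hV, hh', map_sub]
  have hDKV (p q) (t : Piece K L M p (q + 1)) :
      pieceDK K L M (p + 1) q (V p (q + 1) t) = V p q (pieceDK K L M p q t) := by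
    induction t using Twist.induction with
    | zero => simp only [map_zero]
    | add z w hz hw => simp only [map_add, hz, hw]
    | mk z l => rfl
  -- In column 0 contracting L leaves the error W = id ⊗ s'ξ, which the contraction U of K ⊗_A M has
  -- to produce again.
  have hDLV0 (q) (t : Piece K L M 0 q) : pieceDL K L M 0 q (V 0 q t) = t - W q t := by
    induction t using Twist.induction with
    | zero => simp only [map_zero, sub_zero]
    | add z w hz hw => simp only [map_add, hz, hw]; abel
    | mk z l => rw [hV, pieceDL_mk, hW, hh0', map_sub]
  have hDKU (q) (t : Piece K L M 0 (q + 1)) :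
      pieceDK K L M 0 (q + 1) (U (q + 1) t) = W (q + 1) t - U q (pieceDK K L M 0 q t) := by
    induction t using Twist.induction with
    | zero => simp only [map_zero, sub_zero]
    | add z w hz hw => simp only [map_add, hz, hw]; abel
    | mk z l => rw [hU, pieceDK_mk, pieceDK_mk, hU, hW, hh, map_sub, LinearMap.sub_apply]
  have hUDL (q) (t : Piece K L M 1 q) : U q (pieceDL K L M 0 q t) = 0 := by
    induction t using Twist.induction with
    | zero => simp only [map_zero]
    | add z w hz hw => simp only [map_add, hz, hw, add_zero]
    | mk z l => rw [pieceDL_mk, hU, L.exact_aug.apply_apply_eq_zero, map_zero, map_zero]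
  -- At the corner the defect is s(T t) ⊗ s'(1), where T is the augmentation η ⊗ ξ.
  have hDKU0 (t : Piece K L M 0 0) : pieceDK K L M 0 0 (U 0 t) =
      W 0 t - Twist.mk k A Γ _ _ (s (T t)) (s' 1) := by
    induction t using Twist.induction with
    | zero => simp only [map_zero, LinearMap.zero_apply, sub_zero]
    | add z w hz hw => simp only [map_add, LinearMap.add_apply, hz, hw]; abel
    | mk z l =>
      rw [hU, pieceDK_mk, hW, hT, hh0, map_sub, LinearMap.sub_apply, map_smul, map_smul,
        LinearMap.smul_apply, ← map_smul _ (L.aug l) (s' 1), ← map_smul s', smul_eq_mul, mul_one]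
  refine ⟨familyH K L M h s' h' w, ?_, ?_⟩
  · funext p q
    rw [familyD_apply]
    rcases p with _ | p
    · change pieceDL K L M 0 q (V 0 q (w 0 q)) + _ = _
      rcases q with _ | q
      · change _ + (-1 : k) ^ 0 • pieceDK K L M 0 0 (U 0 (w 0 0)) = _
        have h0' : T (w 0 0) = 0 := h0
        rw [hDLV0, hDKU0, h0', map_zero, map_zero, LinearMap.zero_apply, pow_zero, one_smul]
        abel
      · change _ + (-1 : k) ^ 0 • pieceDK K L M 0 (q + 1) (U (q + 1) (w 0 (q + 1))) = _
        -- Since ξ d = 0, U annihilates the image of the differential of L, so U applied to Dw = 0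
        -- removes the correction term of `hDKU`.
        have e := congrArg (U q) (hD 0 q)
        rw [map_add, hUDL, pow_zero, one_smul, zero_add, map_zero] at e
        rw [hDLV0, hDKU, e, pow_zero, one_smul]
        abel
    · change pieceDL K L M (p + 1) q (V (p + 1) q (w (p + 1) q)) +
        (-1 : k) ^ (p + 1) • pieceDK K L M (p + 1) q (V p (q + 1) (w p (q + 1))) = _
      -- Away from column 0 the two correction terms add up to V applied to Dw, which is zero.
      have e := congrArg (V p q) (hD p q)
      rw [map_add, map_smul, map_zero] at e
      rw [hDLV, hDKV, pow_succ, mul_smul, neg_one_smul, smul_neg, sub_add, sub_neg_eq_add, e,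
        sub_zero]
  · rintro n hn p q hpq
    rcases p with _ | p
    · rcases q with _ | q
      · rfl
      · exact (congrArg _ (hn 0 q (by omega))).trans (map_zero _)
    · exact (congrArg _ (hn p q (by omega))).trans (map_zero _)

end TotalComplex

/-! ### Cochains as A # Γ-linear maps on the total complex. -/

section TotalHom

variable {k A Γ : Type u} [Field k] [Ring Γ] [HopfAlgebra k Γ] [Ring A]
  [Algebra k A] [Module Γ A] [IsModuleAlgebra k Γ A]
  {K : EquivariantResolution k A Γ} {L : TrivialResolution k Γ}
  {M N : ModuleCat.{u} (SmashProduct k A Γ)}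

lemma twistAct_eq_homAct {q : ℕ} (u : HomA K M N q) (γ : Γ) (z : BalTensor k A (K.X q) M) :
    twistAct k γ u z = homAct u γ z := twistAct_apply γ u z

/-- The component of a family of maps, as a map on `(K_q ⊗_A M) ⊗ L_p`. -/
noncomputable def pieceEval (f : PreCochain K L M N) (p q : ℕ) : Piece K L M p q →ₗ[k] N :=
  TensorProduct.lift (LinearMap.restrictScalarsₗ k A (BalTensor k A (K.X q) M) N k ∘ₗ f p q).flip

lemma pieceEval_mk (f : PreCochain K L M N) (p q : ℕ) (z : BalTensor k A (K.X q) M) (l : L.X p) :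
    pieceEval f p q (Twist.mk k A Γ _ _ z l) = f p q l z := rfl

variable [hS : Fact (Function.Bijective (HopfAlgebra.antipode k (A := Γ)))]

lemma pieceEval_diffK (f : PreCochain K L M N) (p q : ℕ) (t : Piece K L M p (q + 1)) :
    pieceEval (diffK f) p (q + 1) t = -(-1 : k) ^ q • pieceEval f p q (pieceDK K L M p q t) := by
  induction t using Twist.induction with
  | zero => simp only [map_zero, smul_zero]
  | add z w hz hw => simp only [map_add, hz, hw, smul_add]
  | mk z l => rfl

lemma pieceEval_diffL (f : PreCochain K L M N) (p q : ℕ) (t : Piece K L M (p + 1) q) :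
    pieceEval (diffL f) (p + 1) q t = pieceEval f p q (pieceDL K L M p q t) := by
  induction t using Twist.induction with
  | zero => simp only [map_zero]
  | add z w hz hw => simp only [map_add, hz, hw]
  | mk z l => rfl

lemma pieceEval_add (f g : PreCochain K L M N) (p q : ℕ) (t : Piece K L M p q) :
    pieceEval (f + g) p q t = pieceEval f p q t + pieceEval g p q t := by
  induction t using Twist.induction with
  | zero => simp only [map_zero, add_zero]
  | add z w hz hw => simp only [map_add, hz, hw]; abel
  | mk z l => rfl

lemma pieceEval_smul (c : k) (f : PreCochain K L M N) (p q : ℕ) (t : Piece K L M p q) :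
    pieceEval (c • f) p q t = c • pieceEval f p q t := by
  induction t using Twist.induction with
  | zero => simp only [map_zero, smul_zero]
  | add z w hz hw => simp only [map_add, hz, hw, smul_add]
  | mk z l => rfl

lemma pieceEval_sub (f g : PreCochain K L M N) (p q : ℕ) (t : Piece K L M p q) :
    pieceEval (f - g) p q t = pieceEval f p q t - pieceEval g p q t := by
  induction t using Twist.induction with
  | zero => simp only [map_zero, sub_zero]
  | add z w hz hw => simp only [map_add, hz, hw]; abel
  | mk z l => rfl

lemma pieceEval_diffK_zero (f : PreCochain K L M N) (p : ℕ) (t : Piece K L M p 0) :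
    pieceEval (diffK f) p 0 t = 0 := by
  induction t using Twist.induction with
  | zero => simp only [map_zero]
  | add z w hz hw => simp only [map_add, hz, hw, add_zero]
  | mk z l => rfl

lemma pieceEval_diffL_zero (f : PreCochain K L M N) (q : ℕ) (t : Piece K L M 0 q) :
    pieceEval (diffL f) 0 q t = 0 := by
  induction t using Twist.induction with
  | zero => simp only [map_zero]
  | add z w hz hw => simp only [map_add, hz, hw, add_zero]
  | mk z l => rfl

/-- The value of a family of maps on an element of the total complex. -/
noncomputable def totEval (n : ℕ) (f : PreCochain K L M N) (w : PieceFamily K L M) : N :=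
  ∑ s ∈ Finset.HasAntidiagonal.antidiagonal n, pieceEval f s.1 s.2 (w s.1 s.2)

/-- The sign conventions match because (-1)^n (-1)^p = (-1)^q for p + q = n. -/
lemma totEval_diff (n : ℕ) (f : PreCochain K L M N) (w : PieceFamily K L M) :
    totEval (n + 1) (diff K L M N n f) w = -(-1 : k) ^ n • totEval n f (familyD K L M w) := by
  simp only [totEval, diff_apply, pieceEval_sub, pieceEval_smul, Finset.sum_sub_distrib]
  rw [Finset.Nat.sum_antidiagonal_succ', Finset.Nat.sum_antidiagonal_succ]
  simp only [pieceEval_diffK, pieceEval_diffL, pieceEval_diffK_zero, pieceEval_diffL_zero,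
    zero_add, smul_zero, familyD_apply, map_add, map_smul, Finset.smul_sum, smul_add,
    Finset.sum_add_distrib]
  rw [sub_eq_add_neg, add_comm, ← Finset.sum_neg_distrib]
  congr 1
  · exact Finset.sum_congr rfl fun s _ => (neg_smul _ _).symm
  · refine Finset.sum_congr rfl fun s hs => ?_
    obtain rfl := Finset.HasAntidiagonal.mem_antidiagonal.mp hs
    rw [smul_smul, pow_add, neg_mul, mul_right_comm, ← mul_pow, neg_one_mul, neg_neg, one_pow,
      one_mul]

variable (K L M) in
/-- The truncation of a family to its part of degree `n`. -/
noncomputable def truncTot (n : ℕ) : PieceFamily K L M →ₗ[SmashProduct k A Γ] Tot K L M n where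
  toFun w := ⟨fun p q => if p + q = n then w p q else 0, fun p q h => if_neg h⟩
  map_add' v w := Subtype.ext <| funext fun p => funext fun q => by
    by_cases h : p + q = n <;> simp [h]
  map_smul' r w := Subtype.ext <| funext fun p => funext fun q => by
    by_cases h : p + q = n <;> simp [h]

variable (K L M) in
/-- The map from `(K_q ⊗_A M) ⊗ L_p` to the total complex, which is zero unless `p + q = n`. -/
noncomputable def inclTot (n p q : ℕ) : Piece K L M p q →ₗ[SmashProduct k A Γ] Tot K L M n :=
  truncTot K L M n ∘ₗ LinearMap.single _ (fun p => ∀ q, Piece K L M p q) p ∘ₗ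
    LinearMap.single _ (Piece K L M p) q

lemma inclTot_eq_zero (n p q : ℕ) (h : p + q ≠ n) (t : Piece K L M p q) :
    inclTot K L M n p q t = 0 := Subtype.ext <| funext fun p' => funext fun q' => by
  by_cases h' : p' + q' = n
  · refine (if_pos h').trans ?_
    by_cases hp : p' = p
    · subst hp
      have hq : q' ≠ q := by omega
      simp [hq]
    · simp [hp]
  · exact if_neg h'

lemma sum_inclTot (n : ℕ) (w : Tot K L M n) :
    ∑ s ∈ Finset.HasAntidiagonal.antidiagonal n, inclTot K L M n s.1 s.2 (w.1 s.1 s.2) = w := by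
  refine Subtype.ext <| funext fun p => funext fun q => ?_
  simp only [AddSubmonoidClass.coe_finsetSum, Finset.sum_apply]
  by_cases h : p + q = n
  · rw [Finset.sum_eq_single (p, q)]
    · refine (if_pos h).trans ?_
      simp
    · rintro ⟨p', q'⟩ hs hne
      have hs' := Finset.HasAntidiagonal.mem_antidiagonal.mp hs
      have hp : p ≠ p' := by
        rintro rfl
        exact hne (Prod.ext rfl (by dsimp only at hs'; omega))
      refine (if_pos h).trans ?_
      simp [hp]
    · exact fun hn => absurd (Finset.HasAntidiagonal.mem_antidiagonal.mpr h) hn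
  · rw [w.2 p q h]
    exact Finset.sum_eq_zero fun s _ => if_neg h

lemma totEval_inclTot (n p q : ℕ) (h : p + q = n) (f : PreCochain K L M N) (t : Piece K L M p q) :
    totEval n f (inclTot K L M n p q t).1 = pieceEval f p q t := by
  rw [totEval, Finset.sum_eq_single (p, q)]
  · refine congrArg _ ((if_pos h).trans ?_)
    simp
  · rintro ⟨p', q'⟩ hs hne
    have hs' := Finset.HasAntidiagonal.mem_antidiagonal.mp hs
    have hp : p' ≠ p := by
      rintro rfl
      exact hne (Prod.ext rfl (by dsimp only at hs'; omega))
    refine (congrArg _ ((if_pos hs').trans ?_)).trans (map_zero _)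
    simp [hp]
  · exact fun hn => absurd (Finset.HasAntidiagonal.mem_antidiagonal.mpr h) hn

lemma PreCochain.ext_totEval (n : ℕ) {f g : PreCochain K L M N} (hf : ∀ p q, p + q ≠ n → f p q = 0)
    (hg : ∀ p q, p + q ≠ n → g p q = 0)
    (h : ∀ w : Tot K L M n, totEval n f w.1 = totEval n g w.1) : f = g := by
  refine PreCochain.ext fun p q l z => ?_
  by_cases hpq : p + q = n
  · rw [← pieceEval_mk, ← pieceEval_mk, ← totEval_inclTot n p q hpq, ← totEval_inclTot n p q hpq, h]
  · rw [hf p q hpq, hg p q hpq]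

variable (K L M N) in
/-- A cochain of degree `n` as a map on the total complex. -/
noncomputable def cochainHom (n : ℕ) :
    cochains K L M N n →ₗ[k] (Tot K L M n →ₗ[SmashProduct k A Γ] N) where
  toFun f :=
    { toFun := fun w => totEval n f.1 w.1
      map_add' := fun v w => by
        simp only [totEval, Submodule.coe_add, Pi.add_apply, map_add, Finset.sum_add_distrib]
      map_smul' := fun r w => by
        simp only [totEval, Submodule.coe_smul, Pi.smul_apply, RingHom.id_apply, Finset.smul_sum]
        refine Finset.sum_congr rfl fun s _ => ?_
        -- On each piece this evaluation is the map underlying `Twist.lift`; Γ-linearity of the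
        -- cochain is what makes it linear over A # Γ.
        exact (Twist.lift (f.1 s.1 s.2) fun γ l => LinearMap.ext fun z =>
          (f.2.2 s.1 s.2 γ l z).trans (twistAct_eq_homAct _ _ _).symm).map_smul r _ }
  map_add' f g := LinearMap.ext fun w => by
    simp only [totEval, LinearMap.coe_mk, AddHom.coe_mk, Submodule.coe_add, pieceEval_add,
      Finset.sum_add_distrib, LinearMap.add_apply]
  map_smul' c f := LinearMap.ext fun w => by
    simp only [totEval, LinearMap.coe_mk, AddHom.coe_mk, Submodule.coe_smul, pieceEval_smul,
      Finset.smul_sum, LinearMap.smul_apply, RingHom.id_apply]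

lemma cochainHom_apply (n : ℕ) (f : cochains K L M N n) (w : Tot K L M n) :
    cochainHom K L M N n f w = totEval n f.1 w.1 := rfl

lemma cochainHom_injective (n : ℕ) : Function.Injective (cochainHom K L M N n) := fun f g h =>
  Subtype.ext (PreCochain.ext_totEval n f.2.1 g.2.1 fun w => LinearMap.congr_fun h w)

/-- The cochain given by a map on the total complex. -/
noncomputable def homCochain (n : ℕ) (F : Tot K L M n →ₗ[SmashProduct k A Γ] N) :
    cochains K L M N n :=
  ⟨fun p q => Twist.curry (F ∘ₗ inclTot K L M n p q),
    fun p q h => LinearMap.ext fun l => LinearMap.ext fun z => by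
      change F (inclTot K L M n p q _) = 0
      rw [inclTot_eq_zero n p q h, map_zero],
    fun p q γ l z => by rw [Twist.curry_op_smul, twistAct_eq_homAct]⟩

lemma pieceEval_homCochain (n : ℕ) (F : Tot K L M n →ₗ[SmashProduct k A Γ] N) (p q : ℕ)
    (t : Piece K L M p q) : pieceEval (homCochain n F).1 p q t = F (inclTot K L M n p q t) := by
  induction t using Twist.induction with
  | zero => simp only [map_zero]
  | add z w hz hw => simp only [map_add, hz, hw]
  | mk z l => rfl

/-- Together with injectivity this identifies the cochains of degree n with Hom_{A#Γ}(Tot_n, N). -/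
lemma cochainHom_homCochain (n : ℕ) (F : Tot K L M n →ₗ[SmashProduct k A Γ] N) :
    cochainHom K L M N n (homCochain n F) = F := by
  ext w
  rw [cochainHom_apply, totEval]
  simp only [pieceEval_homCochain]
  rw [← map_sum, sum_inclTot]

lemma diff_support (n : ℕ) {f : PreCochain K L M N} (hf : ∀ p q, p + q ≠ n → f p q = 0)
    (p q : ℕ) (h : p + q ≠ n + 1) : diff K L M N n f p q = 0 := by
  have h1 : diffK f p q = 0 := by
    rcases q with _ | q
    · rfl
    · change homD K M N q ∘ₗ f p q = 0
      rw [hf p q (by omega), LinearMap.comp_zero]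
  have h2 : diffL f p q = 0 := by
    rcases p with _ | p
    · rfl
    · change f p q ∘ₗ L.d p = 0
      rw [hf p q (by omega), LinearMap.zero_comp]
  rw [diff_apply, PreCochain.sub_apply, PreCochain.smul_apply, h1, h2, smul_zero, sub_zero]

/-- The right side is a cochain by construction, so the differential preserves Γ-linearity without
any computation with the action. -/
lemma diff_eq_homCochain (n : ℕ) (f : cochains K L M N n) : diff K L M N n f.1 =
    (homCochain (n + 1) (-(-1 : k) ^ n • cochainHom K L M N n f ∘ₗ totD K L M n)).1 := by
  refine PreCochain.ext_totEval (n + 1) (diff_support n f.2.1) (homCochain _ _).2.1 fun w => ?_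
  rw [totEval_diff, ← cochainHom_apply, cochainHom_homCochain]
  rfl

lemma diff_mem_cochains (n : ℕ) (f : cochains K L M N n) :
    diff K L M N n f.1 ∈ cochains K L M N (n + 1) := by
  rw [diff_eq_homCochain]
  exact Subtype.property _

lemma cochainHom_diff (n : ℕ) (f : cochains K L M N n) :
    cochainHom K L M N (n + 1) ⟨diff K L M N n f.1, diff_mem_cochains n f⟩ =
      -(-1 : k) ^ n • cochainHom K L M N n f ∘ₗ totD K L M n := by
  simp only [diff_eq_homCochain, Subtype.coe_eta]
  exact cochainHom_homCochain _ _

lemma cochainHom_comp_totD (n : ℕ) (f : cochains K L M N n) (hf : diff K L M N n f.1 = 0) :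
    cochainHom K L M N n f ∘ₗ totD K L M n = 0 := by
  have h := cochainHom_diff n f
  have h0 : (⟨diff K L M N n f.1, diff_mem_cochains n f⟩ : cochains K L M N (n + 1)) = 0 :=
    Subtype.ext hf
  rw [h0, map_zero, eq_comm, neg_smul, neg_eq_zero] at h
  exact (smul_eq_zero_iff_right (pow_ne_zero n (neg_ne_zero.mpr one_ne_zero))).mp h

end TotalHom

/-! ### The projective resolution of M and the comparison with Ext. -/

section TotalResolution

variable {k A Γ : Type u} [Field k] [Ring Γ] [HopfAlgebra k Γ] [Ring A]
  [Algebra k A] [Module Γ A] [IsModuleAlgebra k Γ A]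
  (K : EquivariantResolution k A Γ) (L : TrivialResolution k Γ)
  (M : ModuleCat.{u} (SmashProduct k A Γ))
  [hS : Fact (Function.Bijective (HopfAlgebra.antipode k (A := Γ)))]

/-- The term of degree `n` of the total complex. -/
noncomputable abbrev totObj (n : ℕ) : ModuleCat.{u} (SmashProduct k A Γ) :=
  ModuleCat.of _ (Tot K L M n)

/-- `Tot` is in each degree a finite direct sum of projective pieces; lifts are found piecewise and
summed over the antidiagonal. -/
instance totObj_projective (n : ℕ) : Projective (totObj K L M n) where
  factors {E X} f e he := by
    have key (p q : ℕ) : ∃ g : Piece K L M p q →ₗ[SmashProduct k A Γ] E,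
        e.hom ∘ₗ g = f.hom ∘ₗ inclTot K L M n p q := by
      have : Projective (ModuleCat.of (SmashProduct k A Γ) (Piece K L M p q)) :=
        Twist.projective
      refine ⟨(Projective.factorThru (ModuleCat.ofHom (f.hom ∘ₗ inclTot K L M n p q)) e).hom, ?_⟩
      exact congrArg ModuleCat.Hom.hom (Projective.factorThru_comp
        (ModuleCat.ofHom (f.hom ∘ₗ inclTot K L M n p q)) e)
    choose g hg using key
    refine ⟨ModuleCat.ofHom (∑ s ∈ Finset.HasAntidiagonal.antidiagonal n,
      g s.1 s.2 ∘ₗ LinearMap.proj s.2 ∘ₗ LinearMap.proj s.1 ∘ₗ (Tot K L M n).subtype), ?_⟩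
    refine ModuleCat.hom_ext (LinearMap.ext fun w => ?_)
    rw [ModuleCat.hom_comp, ModuleCat.hom_ofHom, LinearMap.comp_apply, LinearMap.sum_apply, map_sum]
    refine (Finset.sum_congr rfl fun s _ => LinearMap.congr_fun (hg s.1 s.2) (w.1 s.1 s.2)).trans ?_
    simp only [LinearMap.comp_apply]
    rw [← map_sum, sum_inclTot]

/-- The augmentation of the total complex, `(x ⊗ m) ⊗ l ↦ ξ(l) τ(x) m`. -/
noncomputable def totAug : Tot K L M 0 →ₗ[SmashProduct k A Γ] M :=
  cochainHom K L M M 0 ⟨oneCochain K L M, oneCochain_mem.1⟩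

variable {K L M}

lemma totAug_apply (w : Tot K L M 0) : totAug K L M w = TensorProduct.lift
    ((LinearMap.lsmul k M).flip.compl₁₂ ((augModule K M).restrictScalars k) L.aug) (w.1 0 0) := by
  refine (Finset.sum_singleton _ _).trans (LinearMap.congr_fun ?_ _)
  exact TensorProduct.ext' fun _ _ => rfl

lemma totAug_surjective : Function.Surjective (totAug K L M) := fun m => by
  obtain ⟨x, hx⟩ := K.aug_surjective 1
  obtain ⟨l, hl⟩ := L.aug_surjective 1
  refine ⟨inclTot K L M 0 0 0 (Twist.mk k A Γ _ _ (BalTensor.mk k A _ _ x m) l), ?_⟩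
  refine (totEval_inclTot 0 0 0 rfl _ _).trans ?_
  change L.aug l • (K.aug x • m) = m
  rw [hx, hl, one_smul, one_smul]

/-- The augmentation is the unit cochain, so this is its cocycle condition. -/
lemma totAug_totD : totAug K L M ∘ₗ totD K L M 0 = 0 :=
  cochainHom_comp_totD 0 _ oneCochain_mem.2

/-- In degree 0 the condition that the differential vanishes is automatic, and the augmentation
condition is the one that counts. -/
lemma exists_totD_zero_eq (w : Tot K L M 0) (hw : totAug K L M w = 0) :
    ∃ v, totD K L M 0 v = w := by
  have hD : familyD K L M w.1 = 0 := by
    funext p q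
    rw [familyD_apply, w.2 (p + 1) q (by omega), w.2 p (q + 1) (by omega), map_zero, map_zero,
      smul_zero, add_zero]
    rfl
  obtain ⟨v, hv, hv'⟩ := exists_familyD_eq K L M ((augModule K M).restrictScalars k)
    (fun _ _ => rfl) w.1 hD ((totAug_apply w).symm.trans hw)
  exact ⟨⟨v, hv' 0 w.2⟩, Subtype.ext hv⟩

lemma exists_totD_succ_eq (n : ℕ) (w : Tot K L M (n + 1)) (hw : totD K L M n w = 0) :
    ∃ v, totD K L M (n + 1) v = w := by
  obtain ⟨v, hv, hv'⟩ := exists_familyD_eq K L M ((augModule K M).restrictScalars k)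
    (fun _ _ => rfl) w.1 (congrArg Subtype.val hw) 
    -- In positive degree the component at (0, 0) is zero, so the augmentation condition is
    -- automatic.
    ((congrArg _ (w.2 0 0 (by omega))).trans (map_zero _))
  exact ⟨⟨v, hv' (n + 1) w.2⟩, Subtype.ext hv⟩

variable (K L M)

/-- The cokernel of the differential into the term of degree `n` of the total complex. -/
noncomputable abbrev Syzygy (n : ℕ) : Type u := Tot K L M n ⧸ LinearMap.range (totD K L M n)

/-- The inclusion of a syzygy of the total complex. -/
noncomputable def syzygyIncl (n : ℕ) :
    Syzygy K L M (n + 1) →ₗ[SmashProduct k A Γ] Tot K L M n :=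
  Submodule.liftQ _ (totD K L M n) (by
    rintro _ ⟨w, rfl⟩
    exact totD_totD K L M n w)

/-- This is exactness of the total complex. With syzygies taken as cokernels, a cocycle, being a map
that kills the image of the differential, factors through the syzygy at once. -/
lemma syzygyIncl_injective (n : ℕ) : Function.Injective (syzygyIncl K L M n) := by
  rw [injective_iff_map_eq_zero]
  intro z hz
  obtain ⟨w, rfl⟩ := Submodule.Quotient.mk_surjective _ z
  exact (Submodule.Quotient.mk_eq_zero _).mpr (exists_totD_succ_eq n w hz)

lemma range_syzygyIncl (n : ℕ) :
    LinearMap.range (syzygyIncl K L M n) = LinearMap.range (totD K L M n) :=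
  Submodule.range_liftQ _ _ _

lemma exact_syzygyIncl (n : ℕ) : Function.Exact (syzygyIncl K L M n)
    (Submodule.mkQ (LinearMap.range (totD K L M n))) := by
  rw [LinearMap.exact_iff, Submodule.ker_mkQ, range_syzygyIncl]

/-- The syzygies of the total complex. -/
noncomputable def totSyzygies : SyzygySequence (ModuleCat.{u} (SmashProduct k A Γ)) where
  Z n := ModuleCat.of _ (Syzygy K L M n)
  P n := totObj K L M n
  ι n := ModuleCat.ofHom (syzygyIncl K L M n)
  π _ := ModuleCat.ofHom (Submodule.mkQ _)
  zero n := ModuleCat.hom_ext (exact_syzygyIncl K L M n).linearMap_comp_eq_zero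
  shortExact n :=
    { exact := (ShortComplex.ShortExact.moduleCat_exact_iff_function_exact _).mpr
        (exact_syzygyIncl K L M n)
      mono_f := (ModuleCat.mono_iff_injective _).mpr (syzygyIncl_injective K L M n)
      epi_g := (ModuleCat.epi_iff_surjective _).mpr (Submodule.mkQ_surjective _) }

/-- The augmentation identifies the first syzygy of the total complex with `M`. -/
noncomputable def augEquiv : Syzygy K L M 0 ≃ₗ[SmashProduct k A Γ] M :=
  LinearEquiv.ofBijective
    (Submodule.liftQ _ (totAug K L M) (by
      rintro _ ⟨w, rfl⟩
      exact LinearMap.congr_fun totAug_totD w)) (by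
    refine ⟨(injective_iff_map_eq_zero _).mpr fun z hz => ?_, fun m => ?_⟩
    · obtain ⟨w, rfl⟩ := Submodule.Quotient.mk_surjective _ z
      exact (Submodule.Quotient.mk_eq_zero _).mpr (exists_totD_zero_eq w hz)
    · obtain ⟨w, rfl⟩ := totAug_surjective (K := K) (L := L) m
      exact ⟨Submodule.Quotient.mk w, rfl⟩)

/-- The augmentation identifies the first syzygy of the total complex with `M`. -/
noncomputable def augIso : (totSyzygies K L M).Z 0 ≅ M := (augEquiv K L M).toModuleIso

variable {K L M}
variable {N : ModuleCat.{u} (SmashProduct k A Γ)}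

/-- The map on the syzygy induced by a map on the total complex. -/
noncomputable def syzygyLift {n : ℕ} (F : Tot K L M n →ₗ[SmashProduct k A Γ] N)
    (hF : F ∘ₗ totD K L M n = 0) : Syzygy K L M n →ₗ[SmashProduct k A Γ] N :=
  Submodule.liftQ _ F (by
    rintro _ ⟨w, rfl⟩
    exact LinearMap.congr_fun hF w)

lemma syzygy_hom_ext {n : ℕ} {F G : Syzygy K L M n →ₗ[SmashProduct k A Γ] N}
    (h : ∀ w : Tot K L M n, F (Submodule.Quotient.mk w) = G (Submodule.Quotient.mk w)) : F = G :=
  Submodule.linearMap_qext _ (LinearMap.ext h)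

variable (K L M N) in
/-- The map on the syzygy given by a cocycle, as a linear map. -/
noncomputable def syzygyMap (n : ℕ) :
    cocycles K L M N n →ₗ[k] (Syzygy K L M n →ₗ[SmashProduct k A Γ] N) where
  toFun f := syzygyLift (cochainHom K L M N n ⟨f.1, f.2.1⟩)
    (cochainHom_comp_totD n ⟨f.1, f.2.1⟩ f.2.2)
  map_add' f g := syzygy_hom_ext fun w =>
    LinearMap.congr_fun ((cochainHom K L M N n).map_add ⟨f.1, f.2.1⟩ ⟨g.1, g.2.1⟩) w
  map_smul' c f := syzygy_hom_ext fun w =>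
    LinearMap.congr_fun ((cochainHom K L M N n).map_smul c ⟨f.1, f.2.1⟩) w

variable (K L M N) in
/-- The map on the syzygy given by a cocycle. -/
noncomputable def syzygyHom (n : ℕ) :
    cocycles K L M N n →ₗ[k] ((totSyzygies K L M).Z n ⟶ N) where
  toFun f := ModuleCat.ofHom (syzygyMap K L M N n f)
  map_add' f g := ModuleCat.hom_ext ((syzygyMap K L M N n).map_add f g)
  map_smul' c f := ModuleCat.hom_ext ((syzygyMap K L M N n).map_smul c f)

lemma syzygyHom_mk (n : ℕ) (f : cocycles K L M N n) (w : Tot K L M n) :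
    (syzygyHom K L M N n f).hom (Submodule.Quotient.mk w) = totEval n f.1 w.1 := rfl

lemma totSyzygies_hom_ext {n : ℕ} {F G : (totSyzygies K L M).Z n ⟶ N}
    (h : ∀ w : Tot K L M n, F.hom (Submodule.Quotient.mk w) = G.hom (Submodule.Quotient.mk w)) :
    F = G :=
  ModuleCat.hom_ext (Submodule.linearMap_qext _ (LinearMap.ext h))

/-- The pullback of F to `Tot` kills boundaries and comes from a cochain; injectivity of
`cochainHom` in degree n + 1 shows that this cochain is closed. -/
lemma syzygyHom_surjective (n : ℕ) : Function.Surjective (syzygyHom K L M N n) := fun F => by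
  let G : Tot K L M n →ₗ[SmashProduct k A Γ] N := F.hom ∘ₗ Submodule.mkQ _
  have hG : diff K L M N n (homCochain n G).1 = 0 := by
    have h : G ∘ₗ totD K L M n = 0 := LinearMap.ext fun w =>
      (congrArg F.hom ((Submodule.Quotient.mk_eq_zero _).mpr ⟨w, rfl⟩)).trans (map_zero _)
    have h2 := cochainHom_diff n (homCochain (N := N) n G)
    rw [cochainHom_homCochain, h, smul_zero, ← map_zero (cochainHom K L M N (n + 1))] at h2
    exact congrArg Subtype.val (cochainHom_injective _ h2)
  refine ⟨⟨(homCochain n G).1, (homCochain n G).2, hG⟩, totSyzygies_hom_ext fun w => ?_⟩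
  exact LinearMap.congr_fun (cochainHom_homCochain n G) w

/-- The differential of a cochain is, up to the sign -(-1)^n, composition with `totD`, which factors
through the inclusion of the syzygy. The sign squares to 1 and is absorbed into the extension g. -/
lemma mem_coboundaries_succ_iff (n : ℕ) (f : cocycles K L M N (n + 1)) :
    f.1 ∈ coboundaries K L M N (n + 1) ↔
      ∃ g : totObj K L M n ⟶ N, (totSyzygies K L M).ι n ≫ g = syzygyHom K L M N (n + 1) f := by
  have hc : (-(-1 : k) ^ n) * -(-1 : k) ^ n = 1 := by
    rw [neg_mul_neg, ← mul_pow]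
    simp
  constructor
  · rintro ⟨h, hh, hf⟩
    refine ⟨-(-1 : k) ^ n • ModuleCat.ofHom (cochainHom K L M N n ⟨h, hh⟩),
      totSyzygies_hom_ext fun w => ?_⟩
    rw [syzygyHom_mk, ← hf]
    exact (totEval_diff n h w.1).symm
  · rintro ⟨g, hg⟩
    refine ⟨(homCochain n (-(-1 : k) ^ n • g.hom)).1, Subtype.property _, ?_⟩
    refine PreCochain.ext_totEval (n + 1) (diff_support n (Subtype.property (homCochain n _)).1)
      f.2.1.1 fun w => ?_
    rw [totEval_diff, ← totD_coe, ← cochainHom_apply, cochainHom_homCochain, LinearMap.smul_apply,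
      smul_smul, hc, one_smul, ← syzygyHom_mk, ← hg]
    rfl

variable (K L M N) in
/-- The class of a cocycle in `Ext`. -/
noncomputable def extClass (n : ℕ) : cocycles K L M N n →ₗ[k] Abelian.Ext M N n where
  toFun f := (Abelian.Ext.mk₀ (augIso K L M).inv).comp
    ((totSyzygies K L M).extOfHom k n N (syzygyHom K L M N n f)) (zero_add n)
  map_add' f g := by rw [map_add, map_add, Abelian.Ext.comp_add]
  map_smul' c f := by rw [map_smul, map_smul, Abelian.Ext.comp_smul, RingHom.id_apply]

lemma extClass_apply (n : ℕ) (f : cocycles K L M N n) : extClass K L M N n f =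
    (Abelian.Ext.mk₀ (augIso K L M).inv).comp
      ((totSyzygies K L M).extOfHom k n N (syzygyHom K L M N n f)) (zero_add n) := rfl

lemma extClass_surjective (n : ℕ) : Function.Surjective (extClass K L M N n) := fun x => by
  obtain ⟨F, hF⟩ := (totSyzygies K L M).extOfHom_surjective k n N
    ((Abelian.Ext.mk₀ (augIso K L M).hom).comp x (zero_add n))
  obtain ⟨f, rfl⟩ := syzygyHom_surjective n F
  refine ⟨f, ?_⟩
  rw [extClass_apply, hF, Abelian.Ext.mk₀_comp_mk₀_assoc, Iso.inv_hom_id, Abelian.Ext.mk₀_id_comp]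

lemma extClass_eq_zero_iff_extOfHom (n : ℕ) (f : cocycles K L M N n) : extClass K L M N n f = 0 ↔
    (totSyzygies K L M).extOfHom k n N (syzygyHom K L M N n f) = 0 := by
  refine ⟨fun h => ?_, fun h => by rw [extClass_apply, h, Abelian.Ext.comp_zero]⟩
  have h2 := congrArg (fun x => (Abelian.Ext.mk₀ (augIso K L M).hom).comp x (zero_add n)) h
  rwa [extClass_apply, Abelian.Ext.mk₀_comp_mk₀_assoc, Iso.hom_inv_id, Abelian.Ext.mk₀_id_comp,
    Abelian.Ext.comp_zero] at h2

lemma pieceEval_zero (p q : ℕ) (t : Piece K L M p q) :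
    pieceEval (0 : PreCochain K L M N) p q t = 0 := by
  induction t using Twist.induction with
  | zero => simp only [map_zero]
  | add z w hz hw => simp only [map_add, hz, hw, add_zero]
  | mk z l => rfl

/-- In positive degree both sides say that the map extends to the preceding projective. In degree 0
there are no coboundaries and a map out of Z_0 is determined by its class. -/
lemma extClass_eq_zero_iff (n : ℕ) (f : cocycles K L M N n) :
    extClass K L M N n f = 0 ↔ f.1 ∈ coboundaries K L M N n := by
  rw [extClass_eq_zero_iff_extOfHom]
  rcases n with _ | n
  · constructor
    · intro h
      have h2 := (totSyzygies K L M).extOfHom_zero_eq_zero k _ h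
      refine PreCochain.ext_totEval 0 f.2.1.1 (fun _ _ _ => rfl) fun w => ?_
      refine (congrArg (fun F => ModuleCat.Hom.hom F (Submodule.Quotient.mk w)) h2).trans ?_
      exact (Finset.sum_eq_zero fun s _ => pieceEval_zero _ _ _).symm
    · intro h
      obtain rfl : f = 0 := Subtype.ext h
      rw [map_zero, map_zero]
  · exact ((totSyzygies K L M).extOfHom_succ_eq_zero_iff k n _).trans
      (mem_coboundaries_succ_iff n f).symm

variable (K L M N) in
/-- The cohomology of the complex of cochains is `Ext`. -/
noncomputable def cohomologyEquivExt (n : ℕ) : Cohomology K L M N n ≃ₗ[k] Abelian.Ext M N n :=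
  LinearEquiv.ofBijective
    (Submodule.liftQ _ (extClass K L M N n) fun f hf => (extClass_eq_zero_iff n f).mpr hf) (by
    refine ⟨(injective_iff_map_eq_zero _).mpr fun z hz => ?_, fun x => ?_⟩
    · obtain ⟨f, rfl⟩ := Submodule.Quotient.mk_surjective _ z
      exact (Submodule.Quotient.mk_eq_zero _).mpr ((extClass_eq_zero_iff n f).mp hz)
    · obtain ⟨f, rfl⟩ := extClass_surjective (K := K) (L := L) n x
      exact ⟨Submodule.Quotient.mk f, rfl⟩)

end TotalResolution

/-! ### Naturality of the product, and products of cochains from M to N. -/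

section Functoriality

variable {k A Γ : Type u} [Field k] [Ring Γ] [HopfAlgebra k Γ] [Ring A]
  [Algebra k A] [Module Γ A] [IsModuleAlgebra k Γ A]
  {K : EquivariantResolution k A Γ} {L : TrivialResolution k Γ}
  {M M₁ M₂ N N₁ N₂ : ModuleCat.{u} (SmashProduct k A Γ)}

/-- The restriction of a map of `A # Γ`-modules to a map of `A`-modules. -/
def restrictLeft (β : N₁ →ₗ[SmashProduct k A Γ] N₂) : N₁ →ₗ[A] N₂ :=
  { β with map_smul' := fun a x => β.map_smul (SmashProduct.inl k A Γ a) x }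

/-- The map `id ⊗ α` on `X ⊗_A M₁`. -/
noncomputable def balMapRight (q : ℕ) (α : M₁ →ₗ[SmashProduct k A Γ] M₂) :
    BalTensor k A (K.X q) M₁ →ₗ[A] BalTensor k A (K.X q) M₂ where
  __ := BalTensor.map LinearMap.id (α.restrictScalars k) (fun _ _ => rfl)
    (restrictLeft α).map_smul
  map_smul' a z := by
    induction z using BalTensor.induction with
    | zero => simp
    | mk x m => rfl
    | add z w hz hw =>
      simp only [AddHom.toFun_eq_coe, LinearMap.coe_toAddHom, RingHom.id_apply] at hz hw ⊢
      simp only [smul_add, map_add, hz, hw]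

lemma balMapRight_mk (q : ℕ) (α : M₁ →ₗ[SmashProduct k A Γ] M₂) (x : K.X q) (m : M₁) :
    balMapRight q α (BalTensor.mk k A _ _ x m) = BalTensor.mk k A _ _ x (α m) := rfl

lemma balMapRight_diag (q : ℕ) (α : M₁ →ₗ[SmashProduct k A Γ] M₂) (γ : Γ)
    (z : BalTensor k A (K.X q) M₁) :
    balMapRight q α (BalTensor.diag γ z) = BalTensor.diag γ (balMapRight q α z) := by
  induction z using BalTensor.induction with
  | zero => simp only [map_zero]
  | add z w hz hw => simp only [map_add, hz, hw]
  | mk x m =>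
    simp only [balMapRight_mk, BalTensor.diag_mk, map_sum]
    exact Finset.sum_congr rfl fun i _ =>
      congrArg _ (α.map_smul (SmashProduct.inr k A Γ ((ℛ k γ).right i)) m)

/-- The composite of a family of maps with maps of modules `M₂ → M₁` and `N₁ → N₂`. -/
noncomputable def PreCochain.map (α : M₂ →ₗ[SmashProduct k A Γ] M₁)
    (β : N₁ →ₗ[SmashProduct k A Γ] N₂) : PreCochain K L M₁ N₁ →ₗ[k] PreCochain K L M₂ N₂ where
  toFun f p q :=
    { toFun := fun l => restrictLeft β ∘ₗ f p q l ∘ₗ balMapRight q α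
      map_add' := fun l l' => by
        rw [map_add, LinearMap.add_comp, LinearMap.comp_add]
      map_smul' := fun c l => LinearMap.ext fun z => by
        rw [map_smul]
        exact (β.restrictScalars k).map_smul c _ }
  map_add' f g := PreCochain.ext fun p q l z => β.map_add _ _
  map_smul' c f := PreCochain.ext fun p q l z => (β.restrictScalars k).map_smul c _

lemma PreCochain.map_apply (α : M₂ →ₗ[SmashProduct k A Γ] M₁) (β : N₁ →ₗ[SmashProduct k A Γ] N₂)
    (f : PreCochain K L M₁ N₁) (p q : ℕ) (l : L.X p) (z : BalTensor k A (K.X q) M₂) :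
    PreCochain.map α β f p q l z = β (f p q l (balMapRight q α z)) := rfl

lemma PreCochain.map_apply_mk (α : M₂ →ₗ[SmashProduct k A Γ] M₁)
    (β : N₁ →ₗ[SmashProduct k A Γ] N₂) (f : PreCochain K L M₁ N₁) (p q : ℕ) (l : L.X p)
    (x : K.X q) (m : M₂) : PreCochain.map α β f p q l (BalTensor.mk k A _ _ x m) =
      β (f p q l (BalTensor.mk k A _ _ x (α m))) := rfl

lemma PreCochain.hom_ext {f g : PreCochain K L M N}
    (h : ∀ p q l x m, f p q l (BalTensor.mk k A _ _ x m) = g p q l (BalTensor.mk k A _ _ x m)) :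
    f = g := by
  refine PreCochain.ext fun p q l z => ?_
  induction z using BalTensor.induction with
  | zero => simp only [map_zero]
  | add z w hz hw => rw [map_add, map_add, hz, hw]
  | mk x m => exact h p q l x m

lemma diff_map (n : ℕ) (α : M₂ →ₗ[SmashProduct k A Γ] M₁) (β : N₁ →ₗ[SmashProduct k A Γ] N₂)
    (f : PreCochain K L M₁ N₁) : diff K L M₂ N₂ n (PreCochain.map α β f) =
      PreCochain.map α β (diff K L M₁ N₁ n f) := by
  have hK : diffK (PreCochain.map α β f) = PreCochain.map α β (diffK f) := by
    refine PreCochain.hom_ext fun p q l x m => ?_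
    rcases q with _ | q
    · exact (map_zero β).symm
    · exact ((β.restrictScalars k).map_smul (-(-1 : k) ^ q) _).symm
  have hL : diffL (PreCochain.map α β f) = PreCochain.map α β (diffL f) := by
    refine PreCochain.hom_ext fun p q l x m => ?_
    rcases p with _ | p
    · exact (map_zero β).symm
    · rfl
  rw [diff_apply, diff_apply, hK, hL, map_sub, map_smul]

lemma map_support {n : ℕ} (α : M₂ →ₗ[SmashProduct k A Γ] M₁) (β : N₁ →ₗ[SmashProduct k A Γ] N₂)
    {f : PreCochain K L M₁ N₁} (hf : ∀ p q, p + q ≠ n → f p q = 0) (p q : ℕ) (h : p + q ≠ n) :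
    PreCochain.map α β f p q = 0 := LinearMap.ext fun l => LinearMap.ext fun z => by
  rw [PreCochain.map_apply, hf p q h]
  exact map_zero β

lemma homAct_map {q : ℕ} (α : M₂ →ₗ[SmashProduct k A Γ] M₁) (β : N₁ →ₗ[SmashProduct k A Γ] N₂)
    (u : HomA K M₁ N₁ q) (γ : Γ) (z : BalTensor k A (K.X q) M₂) :
    homAct (restrictLeft β ∘ₗ u ∘ₗ balMapRight q α) γ z = β (homAct u γ (balMapRight q α z)) := by
  simp only [homAct, LinearMap.comp_apply, balMapRight_diag, map_sum]
  exact Finset.sum_congr rfl fun i _ => (β.map_smul (SmashProduct.inr k A Γ _) _).symm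

lemma map_mem_cochains {n : ℕ} (α : M₂ →ₗ[SmashProduct k A Γ] M₁)
    (β : N₁ →ₗ[SmashProduct k A Γ] N₂) {f : PreCochain K L M₁ N₁} (hf : f ∈ cochains K L M₁ N₁ n) :
    PreCochain.map α β f ∈ cochains K L M₂ N₂ n := by
  refine ⟨map_support α β hf.1, fun p q γ l z => ?_⟩
  rw [PreCochain.map_apply, hf.2]
  exact (homAct_map α β (f p q l) γ z).symm

variable (ω : K.Diagonal) (σ : L.Diagonal)

/-- In u(x ⊗ v(y ⊗ m)) the map h'' passes through f and becomes h, which passes through g and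
becomes h'. The three maps may differ since the outer, the middle and the inner copy of the module
play separate roles; this freedom is needed for projections of a product. -/
lemma pairE_intertwine {h h' h'' : M₁ →ₗ[SmashProduct k A Γ] M₂}
    {f g : PreCochain K L M₁ M₁} {f' g' : PreCochain K L M₂ M₂}
    (hf : PreCochain.map LinearMap.id h'' f = PreCochain.map h LinearMap.id f')
    (hg : PreCochain.map LinearMap.id h g = PreCochain.map h' LinearMap.id g')
    (p₁ q₁ p₂ q₂ : ℕ) (r w) (m : M₁) :
    h'' (pairE f g p₁ q₁ p₂ q₂ r w m) = pairE f' g' p₁ q₁ p₂ q₂ r w (h' m) := by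
  induction r using TensorProduct.induction_on with
  | zero => simp only [map_zero, LinearMap.zero_apply]
  | add r s hr hs => simp only [map_add, LinearMap.add_apply, hr, hs]
  | tmul l l' =>
  induction w using BalTensor.induction with
  | zero => simp only [map_zero, LinearMap.zero_apply]
  | add z w hz hw => simp only [map_add, LinearMap.add_apply, hz, hw]
  | mk x y =>
  have hf' (y : M₁) := LinearMap.congr_fun (LinearMap.congr_fun (congrFun (congrFun hf p₁) q₁) l)
    (BalTensor.mk k A _ _ x y)
  have hg' := LinearMap.congr_fun (LinearMap.congr_fun (congrFun (congrFun hg p₂) q₂) l')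
    (BalTensor.mk k A _ _ y m)
  simp only [PreCochain.map_apply_mk, LinearMap.id_apply] at hf' hg'
  rw [pairE_tmul, pairE_tmul, evalPair_mk, evalPair_mk, hf', hg']

lemma cup_intertwine (b : ℕ) {h h' h'' : M₁ →ₗ[SmashProduct k A Γ] M₂}
    {f g : PreCochain K L M₁ M₁} {f' g' : PreCochain K L M₂ M₂}
    (hf : PreCochain.map LinearMap.id h'' f = PreCochain.map h LinearMap.id f')
    (hg : PreCochain.map LinearMap.id h g = PreCochain.map h' LinearMap.id g') :
    PreCochain.map LinearMap.id h'' (cup ω σ b f g) =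
      PreCochain.map h' LinearMap.id (cup ω σ b f' g') := by
  refine PreCochain.hom_ext fun p q l x m => ?_
  have hs (c : k) (n : M₁) : h'' (c • n) = c • h'' n := (h''.restrictScalars k).map_smul c n
  simp only [PreCochain.map_apply_mk, cup_mk, map_sum, hs, LinearMap.id_apply,
    pairE_intertwine hf hg]

/-- The product of a map with values in `N` and a map of degree `b` with values in `M`. -/
noncomputable def cupRight (b : ℕ) (F : PreCochain K L M N) (g : PreCochain K L M M) :
    PreCochain K L M N :=
  -- Over M × N the cochain g sits in the corner M → M and F in the entry M → N; the entry M → N of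
  -- their product is read off.
  PreCochain.map (N₁ := ModuleCat.of _ (M × N)) (LinearMap.inl _ M N) (LinearMap.snd _ M N)
    (cup ω σ b
      (PreCochain.map (N₂ := ModuleCat.of _ (M × N)) (LinearMap.fst _ M N) (LinearMap.inr _ M N) F)
      (PreCochain.map (LinearMap.fst _ M N) (LinearMap.inl _ M N) g))

/-- The product of the unit with a map of degree `b`. -/
noncomputable def cupOne (b : ℕ) (F : PreCochain K L M N) : PreCochain K L M N :=
  PreCochain.map (N₁ := ModuleCat.of _ (M × N)) (LinearMap.inl _ M N) (LinearMap.snd _ M N)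
    (cup ω σ b (oneCochain K L (ModuleCat.of _ (M × N)))
      (PreCochain.map (LinearMap.fst _ M N) (LinearMap.inr _ M N) F))

lemma cupRight_mem {a b : ℕ} {F : PreCochain K L M N} {g : PreCochain K L M M}
    (hF : F ∈ cochains K L M N a) (hg : g ∈ cochains K L M M b) :
    cupRight ω σ b F g ∈ cochains K L M N (a + b) :=
  map_mem_cochains _ _ (cup_mem ω σ a b _ _ (map_mem_cochains _ _ hF) (map_mem_cochains _ _ hg))

lemma cupOne_mem {b : ℕ} {F : PreCochain K L M N} (hF : F ∈ cochains K L M N b) :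
    cupOne ω σ b F ∈ cochains K L M N b := by
  have h := cup_mem ω σ 0 b _ _ oneCochain_mem.1
    (map_mem_cochains (N₂ := ModuleCat.of _ (M × N)) (LinearMap.fst _ M N) (LinearMap.inr _ M N) hF)
  rw [zero_add] at h
  exact map_mem_cochains _ _ h

/-- The Leibniz rule; the second term vanishes because g is closed. -/
lemma diff_cupRight {a b : ℕ} {F : PreCochain K L M N} {g : PreCochain K L M M}
    (hF : F ∈ cochains K L M N a) (hg : diff K L M M b g = 0) :
    diff K L M N (a + b) (cupRight ω σ b F g) = cupRight ω σ b (diff K L M N a F) g := by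
  rw [cupRight, diff_map, diff_cup ω σ a b _ _ (map_support _ _ hF.1), diff_map, diff_map, hg,
    map_zero, ← cupBilin_apply ω σ (b + 1), map_zero, smul_zero, add_zero]
  rfl

/-- The Leibniz rule for the closed unit of degree 0, which produces no sign. -/
lemma diff_cupOne {b : ℕ} (F : PreCochain K L M N) :
    diff K L M N b (cupOne ω σ b F) = cupOne ω σ (b + 1) (diff K L M N b F) := by
  have h := diff_cup ω σ 0 b (oneCochain K L (ModuleCat.of _ (M × N)))
    (PreCochain.map (LinearMap.fst _ M N) (LinearMap.inr _ M N) F) oneCochain_mem.1.1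
  rw [zero_add] at h
  have h1 : diff K L _ _ 0 (oneCochain K L (ModuleCat.of _ (M × N))) = 0 := oneCochain_mem.2
  rw [cupOne, diff_map, h, h1, ← cupBilin_apply ω σ b, map_zero, LinearMap.zero_apply, zero_add,
    pow_zero, one_smul, diff_map]
  rfl

lemma cupRight_smul (b : ℕ) (c : k) (F : PreCochain K L M N) (g : PreCochain K L M M) :
    cupRight ω σ b (c • F) g = c • cupRight ω σ b F g := by
  simp only [cupRight, map_smul, cup_smul_left]

lemma cupOne_smul (b : ℕ) (c : k) (F : PreCochain K L M N) :
    cupOne ω σ b (c • F) = c • cupOne ω σ b F := by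
  simp only [cupOne, map_smul, cup_smul_right]

lemma oneCochain_map (h : M₁ →ₗ[SmashProduct k A Γ] M₂) :
    PreCochain.map LinearMap.id h (oneCochain K L M₁) =
      PreCochain.map h LinearMap.id (oneCochain K L M₂) := by
  refine PreCochain.hom_ext fun p q l x m => ?_
  rcases p with _ | p
  · rcases q with _ | q
    · change h (L.aug l • (K.aug x • m)) = L.aug l • (K.aug x • h m)
      refine ((h.restrictScalars k).map_smul (L.aug l) _).trans (congrArg (L.aug l • ·) ?_)
      exact (restrictLeft h).map_smul (K.aug x) m
    · exact map_zero h
  · exact map_zero h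

lemma PreCochain.map_map {M₃ N₃ : ModuleCat.{u} (SmashProduct k A Γ)}
    (α : M₂ →ₗ[SmashProduct k A Γ] M₁) (β : N₁ →ₗ[SmashProduct k A Γ] N₂)
    (α' : M₃ →ₗ[SmashProduct k A Γ] M₂) (β' : N₂ →ₗ[SmashProduct k A Γ] N₃)
    (f : PreCochain K L M₁ N₁) : PreCochain.map α' β' (PreCochain.map α β f) =
      PreCochain.map (α ∘ₗ α') (β' ∘ₗ β) f := PreCochain.hom_ext fun _ _ _ _ _ => rfl

lemma PreCochain.map_id (f : PreCochain K L M N) :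
    PreCochain.map LinearMap.id LinearMap.id f = f := PreCochain.hom_ext fun _ _ _ _ _ => rfl

lemma map_cup_eq_map_cup (b : ℕ) (α : M →ₗ[SmashProduct k A Γ] M₁)
    (β : M₂ →ₗ[SmashProduct k A Γ] N) {h h' h'' : M₁ →ₗ[SmashProduct k A Γ] M₂}
    {f g : PreCochain K L M₁ M₁} {f' g' : PreCochain K L M₂ M₂}
    (hf : PreCochain.map LinearMap.id h'' f = PreCochain.map h LinearMap.id f')
    (hg : PreCochain.map LinearMap.id h g = PreCochain.map h' LinearMap.id g') :
    PreCochain.map α (β ∘ₗ h'') (cup ω σ b f g) =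
      PreCochain.map (h' ∘ₗ α) β (cup ω σ b f' g') := by
  have key := congrArg (PreCochain.map α β) (cup_intertwine ω σ b hf hg)
  rwa [PreCochain.map_map, PreCochain.map_map, LinearMap.id_comp, LinearMap.comp_id] at key

/-- The map id × h from M × N₁ to M × N₂ intertwines both factors of the product, and composing with
inclusion and projection leaves h. -/
lemma cupRight_map (b : ℕ) (h : N₁ →ₗ[SmashProduct k A Γ] N₂) (F : PreCochain K L M N₁)
    (g : PreCochain K L M M) : cupRight ω σ b (PreCochain.map LinearMap.id h F) g =
      PreCochain.map LinearMap.id h (cupRight ω σ b F g) := by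
  let H : ModuleCat.of (SmashProduct k A Γ) (M × N₁) →ₗ[SmashProduct k A Γ]
    ModuleCat.of (SmashProduct k A Γ) (M × N₂) := LinearMap.prodMap LinearMap.id h
  rw [cupRight, cupRight, PreCochain.map_map _ _ LinearMap.id h]
  refine .trans ?_ (map_cup_eq_map_cup ω σ b (LinearMap.inl _ M N₁) (LinearMap.snd _ M N₂)
    (h := H) (h' := H) (h'' := H)
    (f' := PreCochain.map (LinearMap.fst _ M N₂) (LinearMap.inr _ M N₂)
      (PreCochain.map LinearMap.id h F))
    (g' := PreCochain.map (LinearMap.fst _ M N₂) (LinearMap.inl _ M N₂) g) ?_ ?_).symm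
  · refine congrArg (fun α => PreCochain.map (N₁ := ModuleCat.of _ (M × N₂)) α
      (LinearMap.snd _ M N₂) _) (LinearMap.ext fun m => ?_)
    exact Prod.ext rfl (map_zero h).symm
  · exact PreCochain.hom_ext fun _ _ _ _ _ => rfl
  · rw [PreCochain.map_map, PreCochain.map_map]
    refine congrArg (fun β => PreCochain.map (M₂ := ModuleCat.of _ (M × N₁))
      (N₂ := ModuleCat.of _ (M × N₂)) (LinearMap.fst _ M N₁) β g) (LinearMap.ext fun m => ?_)
    exact Prod.ext rfl (map_zero h)

lemma cupOne_map (b : ℕ) (h : N₁ →ₗ[SmashProduct k A Γ] N₂) (F : PreCochain K L M N₁) :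
    cupOne ω σ b (PreCochain.map LinearMap.id h F) =
      PreCochain.map LinearMap.id h (cupOne ω σ b F) := by
  let H : ModuleCat.of (SmashProduct k A Γ) (M × N₁) →ₗ[SmashProduct k A Γ]
    ModuleCat.of (SmashProduct k A Γ) (M × N₂) := LinearMap.prodMap LinearMap.id h
  rw [cupOne, cupOne, PreCochain.map_map _ _ LinearMap.id h]
  refine .trans ?_ (map_cup_eq_map_cup ω σ b (LinearMap.inl _ M N₁) (LinearMap.snd _ M N₂)
    (h := H) (h' := H) (h'' := H)
    (g' := PreCochain.map (LinearMap.fst _ M N₂) (LinearMap.inr _ M N₂)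
      (PreCochain.map LinearMap.id h F)) (oneCochain_map H) ?_).symm
  · refine congrArg (fun α => PreCochain.map (N₁ := ModuleCat.of _ (M × N₂)) α
      (LinearMap.snd _ M N₂) _) (LinearMap.ext fun m => ?_)
    exact Prod.ext rfl (map_zero h).symm
  · exact PreCochain.hom_ext fun _ _ _ _ _ => rfl

/-- For N = M the first projection of M × M on the inner and the middle copy, and the second on the
outer one, intertwine the extended cochains with f and g. -/
lemma cupRight_eq_cup (b : ℕ) (f g : PreCochain K L M M) :
    cupRight ω σ b f g = cup ω σ b f g := by
  have key := map_cup_eq_map_cup ω σ b (M₁ := ModuleCat.of (SmashProduct k A Γ) (M × M)) (M₂ := M)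
    (LinearMap.inl _ M M) (LinearMap.id) (h := LinearMap.fst _ M M) (h' := LinearMap.fst _ M M)
    (h'' := LinearMap.snd _ M M) (f' := f) (g' := g)
    (f := PreCochain.map (LinearMap.fst _ M M) (LinearMap.inr _ M M) f)
    (g := PreCochain.map (LinearMap.fst _ M M) (LinearMap.inl _ M M) g)
    (PreCochain.hom_ext fun _ _ _ _ _ => rfl) (PreCochain.hom_ext fun _ _ _ _ _ => rfl)
  exact key.trans (PreCochain.map_id _)

/-- As before, except that the middle copy is now projected to the second factor, where the values
of F lie and on which the unit acts. -/
lemma cupOne_eq_cup (b : ℕ) (f : PreCochain K L M M) :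
    cupOne ω σ b f = cup ω σ b (oneCochain K L M) f := by
  have key := map_cup_eq_map_cup ω σ b (M₁ := ModuleCat.of (SmashProduct k A Γ) (M × M)) (M₂ := M)
    (LinearMap.inl _ M M) (LinearMap.id) (h := LinearMap.snd _ M M) (h' := LinearMap.fst _ M M)
    (h'' := LinearMap.snd _ M M) (g' := f)
    (g := PreCochain.map (LinearMap.fst _ M M) (LinearMap.inr _ M M) f) (oneCochain_map _)
    (PreCochain.hom_ext fun _ _ _ _ _ => rfl)
  exact key.trans (PreCochain.map_id _)

/-- This strict equality is exactly (ξ ⊗ ξ)σ = ξ and (τ ⊗ τ)ω = τ. For a general cocycle g only the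
classes of 1·g and g agree. -/
lemma cup_oneCochain : cup ω σ 0 (oneCochain K L M) (oneCochain K L M) = oneCochain K L M := by
  refine PreCochain.hom_ext fun p q l x m => ?_
  by_cases h : p + q = 0
  · obtain ⟨rfl, rfl⟩ : p = 0 ∧ q = 0 := by omega
    have key (r w) : pairE (oneCochain K L M) (oneCochain K L M) 0 0 0 0 r w m =
        TensorProduct.lid k k (TensorProduct.map L.aug L.aug r) • (K.augTensor w • m) := by
      induction r using TensorProduct.induction_on with
      | zero => simp only [map_zero, LinearMap.zero_apply, zero_smul]
      | add r s hr hs => simp only [map_add, LinearMap.add_apply, hr, hs, add_smul]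
      | tmul l l' =>
      induction w using BalTensor.induction with
      | zero => simp only [map_zero, LinearMap.zero_apply, zero_smul, smul_zero]
      | add z w hz hw => simp only [map_add, LinearMap.add_apply, hz, hw, add_smul, smul_add]
      | mk x y =>
        change L.aug l • (K.aug x • (L.aug l' • (K.aug y • m))) =
          (L.aug l * L.aug l') • ((K.aug x * K.aug y) • m)
        refine (congrArg (fun n : M => L.aug l • n) ?_).trans (mul_smul _ _ _).symm
        rw [mul_smul (K.aug x)]
        exact smul_algebra_smul_comm (L.aug l') (K.aug x) (K.aug y • m)
    rw [cup_mk]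
    refine (Finset.sum_singleton _ _).trans ((Finset.sum_singleton _ _).trans ?_)
    change (-1 : k) ^ (0 * 0 + 0 * 0) • pairE _ _ 0 0 0 0 (σ.comp 0 0 0 l) (ω.comp 0 0 0 x) m = _
    rw [key, σ.comp_aug, ω.comp_aug]
    simp only [mul_zero, add_zero, pow_zero, one_smul]
    rfl
  · rw [cup_support ω σ 0 0 _ _ oneCochain_mem.1.1 oneCochain_mem.1.1 p q h,
      oneCochain_mem.1.1 p q h]

end Functoriality

/-! ### Lifting cocycles to the total complex; compatibility with Yoneda products. -/

section Multiplicativity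

open Abelian

variable {k A Γ : Type u} [Field k] [Ring Γ] [HopfAlgebra k Γ] [Ring A]
  [Algebra k A] [Module Γ A] [IsModuleAlgebra k Γ A]
  {K : EquivariantResolution k A Γ} {L : TrivialResolution k Γ}
  {M N N₁ N₂ : ModuleCat.{u} (SmashProduct k A Γ)}

variable [hS : Fact (Function.Bijective (HopfAlgebra.antipode k (A := Γ)))]

lemma totEval_smul (n : ℕ) (c : k) (f : PreCochain K L M N) (w : PieceFamily K L M) :
    totEval n (c • f) w = c • totEval n f w := by
  simp only [totEval, pieceEval_smul, Finset.smul_sum]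

lemma totEval_smul_of_eq (n : ℕ) (c : k) {f : PreCochain K L M N} {w : PieceFamily K L M} {v : N}
    (h : totEval n f w = v) : totEval n (c • f) w = c • v := by
  rw [totEval_smul, h]

lemma totEval_map (n : ℕ) (h : N₁ →ₗ[SmashProduct k A Γ] N₂) (f : PreCochain K L M N₁)
    (w : PieceFamily K L M) :
    totEval n (PreCochain.map LinearMap.id h f) w = h (totEval n f w) := by
  have key (p q : ℕ) (t : Piece K L M p q) :
      pieceEval (PreCochain.map LinearMap.id h f) p q t = h (pieceEval f p q t) := by
    induction t using Twist.induction with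
    | zero => simp only [map_zero]
    | add z w hz hw => simp only [map_add, hz, hw]
    | mk z l =>
      rw [pieceEval_mk, pieceEval_mk, PreCochain.map_apply]
      congr 2
      induction z using BalTensor.induction with
      | zero => simp only [map_zero]
      | add z w hz hw => simp only [map_add, hz, hw]
      | mk x m => rfl
  simp only [totEval, key, map_sum]

variable (K L M) in
/-- The tautological cochain with values in the total complex. -/
noncomputable def idCochain (n : ℕ) : cochains K L M (totObj K L M n) n :=
  homCochain n LinearMap.id

lemma totEval_idCochain (n : ℕ) (w : Tot K L M n) :
    totEval n (idCochain K L M n).1 w.1 = w :=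
  LinearMap.congr_fun (cochainHom_homCochain (N := totObj K L M n) n LinearMap.id) w

/-- The Yoneda principle: every cochain is a pushforward of the tautological one, so an operation on
cochains natural in N is determined by its value there. -/
lemma map_cochainHom_idCochain (n : ℕ) (f : cochains K L M N n) :
    PreCochain.map LinearMap.id (N₁ := totObj K L M n) (cochainHom K L M N n f)
      (idCochain K L M n).1 = f.1 := by
  refine PreCochain.ext_totEval n (map_support _ _ (idCochain K L M n).2.1) f.2.1 fun w => ?_
  rw [totEval_map, totEval_idCochain, cochainHom_apply]

lemma diff_idCochain (n : ℕ) : diff K L M _ n (idCochain K L M n).1 =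
    -(-1 : k) ^ n • PreCochain.map LinearMap.id (N₁ := totObj K L M (n + 1))
      (N₂ := totObj K L M n) (totD K L M n) (idCochain K L M (n + 1)).1 := by
  refine PreCochain.ext_totEval (n + 1) (diff_support n (idCochain K L M n).2.1)
    ((Submodule.smul_mem _ (-(-1 : k) ^ n)
      (map_mem_cochains _ _ (idCochain K L M (n + 1)).2)).1) fun w => ?_
  rw [totEval_diff, ← totD_coe, totEval_idCochain]
  refine (totEval_smul_of_eq (N := totObj K L M n) (n + 1) (-(-1 : k) ^ n) ?_).symm
  refine (totEval_map (n + 1) (N₁ := totObj K L M (n + 1)) (N₂ := totObj K L M n)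
    (totD K L M n) (idCochain K L M (n + 1)).1 w.1).trans ?_
  rw [totEval_idCochain]

/-- The map on syzygies induced by a map on the total complex which commutes with the differential
up to a scalar. -/
noncomputable def syzygyInduced {m n : ℕ}
    (φ : Tot K L M m →ₗ[SmashProduct k A Γ] Tot K L M n)
    (φ' : Tot K L M (m + 1) →ₗ[SmashProduct k A Γ] Tot K L M (n + 1)) (c : k)
    (h : ∀ w, φ (totD K L M m w) =
      algebraMap k (SmashProduct k A Γ) c • totD K L M n (φ' w)) :
    Syzygy K L M m →ₗ[SmashProduct k A Γ] Syzygy K L M n :=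
  syzygyLift (N := ModuleCat.of _ (Syzygy K L M n)) (Submodule.mkQ _ ∘ₗ φ) (LinearMap.ext fun w =>
    (Submodule.Quotient.mk_eq_zero _).mpr ⟨algebraMap k (SmashProduct k A Γ) c • φ' w, by
      rw [map_smul]
      exact (h w).symm⟩)

/-- Cancels the sign c and passes from the action of k to that of its image in A # Γ, the form which
`syzygyInduced` requires. -/
lemma eq_smul_of_smul_eq_smul {c d e : k} {x y : N} (h : d • x = c • y) (hc : c * c = 1)
    (he : c * d = e) : y = algebraMap k (SmashProduct k A Γ) e • x := by
  rw [algebraMap_smul, ← he, mul_smul, h, ← mul_smul, hc, one_smul]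

variable (ω : K.Diagonal) (σ : L.Diagonal)

/-- The endomorphism of the total complex given by the product with the unit. -/
noncomputable def totOne (n : ℕ) : Tot K L M n →ₗ[SmashProduct k A Γ] Tot K L M n :=
  cochainHom K L M (totObj K L M n) n
    ⟨cupOne ω σ n (idCochain K L M n).1, cupOne_mem ω σ (idCochain K L M n).2⟩

/-- By naturality of the product in N, composition of any cochain with the operator on `Tot` is
multiplication by the unit. The same mechanism gives `cochainHom_totCup`. -/
lemma cochainHom_totOne (n : ℕ) (f : cochains K L M N n) (w : Tot K L M n) :
    cochainHom K L M N n f (totOne ω σ n w) = totEval n (cupOne ω σ n f.1) w.1 := by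
  conv_rhs => rw [← map_cochainHom_idCochain n f]
  exact ((congrArg (fun F => totEval n F w.1) (cupOne_map ω σ n
    (N₁ := totObj K L M n) (cochainHom K L M N n f) (idCochain K L M n).1)).trans
    (totEval_map n (N₁ := totObj K L M n) (cochainHom K L M N n f) _ w.1)).symm

/-- The product commutes with `diff`, and `diff` of the tautological cochain is `totD` up to the
sign -(-1)^n. This sign occurs on both sides and cancels. -/
lemma totOne_totD (n : ℕ) (w : Tot K L M (n + 1)) :
    totOne ω σ n (totD K L M n w) = totD K L M n (totOne ω σ (n + 1) w) := by
  have h := totEval_diff n (cupOne ω σ n (idCochain K L M n).1) w.1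
  rw [diff_cupOne, diff_idCochain, cupOne_smul, cupOne_map] at h
  replace h := (totEval_smul (N := totObj K L M n) (n + 1) (-(-1 : k) ^ n) _ w.1).symm.trans h
  have e : -(-1 : k) ^ n * -(-1 : k) ^ n = 1 := by
    rw [neg_mul_neg, ← mul_pow]
    simp
  rw [← totD_coe] at h
  refine (eq_smul_of_smul_eq_smul h e e).trans ?_
  rw [map_one, one_smul]
  exact totEval_map (n + 1) (N₁ := totObj K L M (n + 1)) (N₂ := totObj K L M n)
    (totD K L M n) (cupOne ω σ (n + 1) (idCochain K L M (n + 1)).1) w.1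

/-- The map of degree `-b` on the total complex given by the product with a cocycle. -/
noncomputable def totCup {b : ℕ} (g : cocycles K L M M b) (n : ℕ) :
    Tot K L M (b + n) →ₗ[SmashProduct k A Γ] Tot K L M n :=
  cochainHom K L M (totObj K L M n) (b + n) ⟨cupRight ω σ b (idCochain K L M n).1 g.1, by
    rw [add_comm]
    exact cupRight_mem ω σ (idCochain K L M n).2 g.2.1⟩

lemma cochainHom_totCup {b : ℕ} (g : cocycles K L M M b) (n : ℕ) (f : cochains K L M N n)
    (w : Tot K L M (b + n)) :
    cochainHom K L M N n f (totCup ω σ g n w) = totEval (b + n) (cupRight ω σ b f.1 g.1) w.1 := by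
  conv_rhs => rw [← map_cochainHom_idCochain n f]
  exact ((congrArg (fun F => totEval (b + n) F w.1) (cupRight_map ω σ b
    (N₁ := totObj K L M n) (cochainHom K L M N n f) (idCochain K L M n).1 g.1)).trans
    (totEval_map (b + n) (N₁ := totObj K L M n) (cochainHom K L M N n f) _ w.1)).symm

/-- As for `totOne_totD`, but evaluation takes place in degree b + n and the tautological cochain
has degree n; the two signs leave (-1)^b. -/
lemma totCup_totD {b : ℕ} (g : cocycles K L M M b) (n : ℕ) (w : Tot K L M (b + n + 1)) :
    totCup ω σ g n (totD K L M (b + n) w) =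
      algebraMap k (SmashProduct k A Γ) ((-1) ^ b) • totD K L M n (totCup ω σ g (n + 1) w) := by
  have h := totEval_diff (b + n) (cupRight ω σ b (idCochain K L M n).1 g.1) w.1
  have h1 := diff_cupRight ω σ (idCochain K L M n).2 (show diff K L M M b g.1 = 0 from g.2.2)
  rw [add_comm n b] at h1
  rw [h1, diff_idCochain, cupRight_smul, cupRight_map] at h
  replace h := (totEval_smul (N := totObj K L M n) (b + n + 1) (-(-1 : k) ^ n) _ w.1).symm.trans h
  have e1 : -(-1 : k) ^ (b + n) * -(-1 : k) ^ n = (-1) ^ b := by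
    rw [neg_mul_neg, pow_add, mul_assoc, ← mul_pow]
    simp
  have e2 : -(-1 : k) ^ (b + n) * -(-1 : k) ^ (b + n) = 1 := by
    rw [neg_mul_neg, ← mul_pow]
    simp
  rw [← totD_coe] at h
  refine (eq_smul_of_smul_eq_smul h e2 e1).trans
    (congrArg (fun v => algebraMap k (SmashProduct k A Γ) ((-1) ^ b) • v) ?_)
  exact totEval_map (b + n + 1) (N₁ := totObj K L M (n + 1)) (N₂ := totObj K L M n)
    (totD K L M n) (cupRight ω σ b (idCochain K L M (n + 1)).1 g.1) w.1

/-- The map on syzygies given by `totOne`. -/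
noncomputable def syzygyOne (n : ℕ) : (totSyzygies K L M).Z n ⟶ (totSyzygies K L M).Z n :=
  ModuleCat.ofHom (syzygyInduced (totOne ω σ n) (totOne ω σ (n + 1)) (1 : k)
    fun w => by rw [map_one, one_smul, totOne_totD])

/-- The map on syzygies given by `totCup`. -/
noncomputable def syzygyCup {b : ℕ} (g : cocycles K L M M b) (n : ℕ) :
    (totSyzygies K L M).Z (b + n) ⟶ (totSyzygies K L M).Z n :=
  ModuleCat.ofHom (syzygyInduced (totCup ω σ g n) (totCup ω σ g (n + 1)) ((-1 : k) ^ b)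
    (totCup_totD ω σ g n))

lemma syzygyHom_oneCochain :
    syzygyHom K L M M 0 ⟨oneCochain K L M, oneCochain_mem⟩ = (augIso K L M).hom :=
  totSyzygies_hom_ext fun _ => rfl

/-- Composed with the augmentation, which is the unit cochain, the operator becomes 1·1 = 1, so over
M it is the identity. -/
lemma syzygyOne_zero : syzygyOne (K := K) (L := L) (M := M) ω σ 0 = 𝟙 _ := by
  rw [← cancel_mono (augIso K L M).hom, Category.id_comp]
  refine totSyzygies_hom_ext fun w => ?_
  refine (cochainHom_totOne ω σ 0 ⟨oneCochain K L M, oneCochain_mem.1⟩ w).trans ?_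
  rw [cupOne_eq_cup, cup_oneCochain]
  rfl

variable (M) in
lemma splice_comp_syzygyOne (n : ℕ) :
    ((totSyzygies K L M).splice k n).comp (Ext.mk₀ (syzygyOne ω σ n)) (add_zero n) =
      (totSyzygies K L M).splice k n := by
  rw [(totSyzygies K L M).splice_naturality k (fun n => ModuleCat.ofHom (totOne ω σ n))
    (syzygyOne ω σ) (fun n => rfl) (fun n => totSyzygies_hom_ext fun w => totOne_totD ω σ n w),
    syzygyOne_zero, Ext.mk₀_id_comp]

lemma oneCup_mem {b : ℕ} (g : cocycles K L M M b) :
    cup ω σ b (oneCochain K L M) g.1 ∈ cocycles K L M M b := by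
  have h := cup_mem_cocycles ω σ 0 b oneCochain_mem g.2
  rwa [zero_add] at h

/-- The map on Z_b given by 1·g is that of g preceded by a chain endomorphism over the identity of
M, which `splice` does not see. -/
lemma extClass_oneCup {b : ℕ} (g : cocycles K L M M b) :
    extClass K L M M b ⟨cup ω σ b (oneCochain K L M) g.1, oneCup_mem ω σ g⟩ =
      extClass K L M M b g := by
  have h : syzygyHom K L M M b ⟨cup ω σ b (oneCochain K L M) g.1, oneCup_mem ω σ g⟩ =
      syzygyOne ω σ b ≫ syzygyHom K L M M b g := by
    refine totSyzygies_hom_ext fun w => .symm ?_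
    refine (cochainHom_totOne ω σ b ⟨g.1, g.2.1⟩ w).trans ?_
    rw [cupOne_eq_cup]
    rfl
  rw [extClass_apply, extClass_apply, SyzygySequence.extOfHom_apply,
    SyzygySequence.extOfHom_apply, h, ← Ext.mk₀_comp_mk₀,
    ← Ext.comp_assoc_of_third_deg_zero ((totSyzygies K L M).splice k b), splice_comp_syzygyOne]

/-- Followed by the augmentation, that is the unit cochain, the lift gives 1·g. So it is 1·g, and
not g, that is lifted on the nose. -/
lemma syzygyHom_oneCup {b : ℕ} (g : cocycles K L M M b) :
    syzygyHom K L M M b ⟨cup ω σ b (oneCochain K L M) g.1, oneCup_mem ω σ g⟩ =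
      syzygyCup ω σ g 0 ≫ (augIso K L M).hom := by
  refine totSyzygies_hom_ext fun w => .symm ?_
  refine (cochainHom_totCup ω σ g 0 ⟨oneCochain K L M, oneCochain_mem.1⟩ w).trans ?_
  rw [cupRight_eq_cup]
  rfl

/-- The isomorphism Z_0 ≅ M in the middle of the composite cancels, `splice_comp_splice` moves the
lift of g past the splice of length a, and the lift followed by f is the cocycle fg. The separate
index n mediates between the degrees b + a of the composite and a + b of the product. -/
lemma extClass_comp {a b n : ℕ} (h : b + a = n) (f : cocycles K L M M a) (g : cocycles K L M M b)
    (hfg : cup ω σ b f.1 g.1 ∈ cocycles K L M M n) :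
    (extClass K L M M b g).comp (extClass K L M M a f) h =
      extClass K L M M n ⟨cup ω σ b f.1 g.1, hfg⟩ := by
  subst h
  have hF : syzygyHom K L M M (b + a) ⟨cup ω σ b f.1 g.1, hfg⟩ =
      syzygyCup ω σ g a ≫ syzygyHom K L M M a f := by
    refine totSyzygies_hom_ext fun w => .symm ?_
    refine (cochainHom_totCup ω σ g a ⟨f.1, f.2.1⟩ w).trans ?_
    rw [cupRight_eq_cup]
    rfl
  have hs := (totSyzygies K L M).splice_comp_splice k b
    (fun n => ModuleCat.ofHom (totCup ω σ g n)) (syzygyCup ω σ g) (fun n => rfl)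
    (fun n => totSyzygies_hom_ext fun w => totCup_totD ω σ g n w) a
  -- Replaces g by the cocycle that `syzygyCup` lifts strictly.
  rw [← extClass_oneCup ω σ g]
  simp only [extClass_apply, SyzygySequence.extOfHom_apply, hF, syzygyHom_oneCup]
  rw [← Ext.mk₀_comp_mk₀ (syzygyCup ω σ g 0), ← Ext.mk₀_comp_mk₀ (syzygyCup ω σ g a),
    ← Ext.comp_assoc_of_third_deg_zero ((totSyzygies K L M).splice k b),
    ← Ext.comp_assoc_of_third_deg_zero ((totSyzygies K L M).splice k (b + a)), ← hs,
    Ext.comp_assoc _ _ _ (zero_add b) rfl (by omega), Ext.comp_assoc_of_second_deg_zero,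
    Ext.mk₀_comp_mk₀_assoc, Iso.hom_inv_id, Ext.mk₀_id_comp, Ext.comp_assoc_of_third_deg_zero]

lemma extClass_oneCochain :
    extClass K L M M 0 ⟨oneCochain K L M, oneCochain_mem⟩ = Ext.mk₀ (𝟙 M) := by
  rw [extClass_apply, syzygyHom_oneCochain, SyzygySequence.extOfHom_apply]
  change (Ext.mk₀ _).comp ((Ext.mk₀ (𝟙 _)).comp (Ext.mk₀ _) _) _ = _
  rw [Ext.mk₀_id_comp, Ext.mk₀_comp_mk₀, Iso.inv_hom_id]

end Multiplicativity

theorem mainTheorem9 {k A Γ : Type u} [Field k] [Ring Γ] [HopfAlgebra k Γ] [Ring A] [Algebra k A]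
    [Module Γ A] [IsModuleAlgebra k Γ A]
    (hS : Function.Bijective (HopfAlgebra.antipode k (A := Γ)))
    (K : EquivariantResolution k A Γ) (ω : K.Diagonal)
    (L : TrivialResolution k Γ) (σ : L.Diagonal)
    (M N : ModuleCat.{u} (SmashProduct k A Γ)) :
    Nonempty (∀ n : ℕ, Abelian.Ext M N n ≃ₗ[k] Cohomology K L M N n) ∧
    ∃ e : ∀ n : ℕ, Abelian.Ext M M n ≃ₗ[k] Cohomology K L M M n,
      e 0 (Abelian.Ext.mk₀ (𝟙 M)) = cohomologyOne K L M ∧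
      ∀ (a b : ℕ) (x : Abelian.Ext M M a) (y : Abelian.Ext M M b),
        e (a + b) (y.comp x (Nat.add_comm b a)) = cohomologyMul ω σ a b (e a x) (e b y) := by
  have := Fact.mk hS
  refine ⟨⟨fun n => (cohomologyEquivExt K L M N n).symm⟩,
    fun n => (cohomologyEquivExt K L M M n).symm, ?_, fun a b x y => ?_⟩
  · rw [LinearEquiv.symm_apply_eq]
    exact extClass_oneCochain.symm
  · obtain ⟨f, rfl⟩ := extClass_surjective (K := K) (L := L) a x
    obtain ⟨g, rfl⟩ := extClass_surjective (K := K) (L := L) b y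
    have h (n : ℕ) (f : cocycles K L M M n) : (cohomologyEquivExt K L M M n).symm
        (extClass K L M M n f) = cohomologyClass K L M n f :=
      (LinearEquiv.symm_apply_eq _).mpr rfl
    -- `Ext.comp` composes from left to right, so y stands first, in accordance with the product in
    -- which g is applied before f.
    rw [extClass_comp ω σ _ f g (cup_mem_cocycles ω σ a b f.2 g.2), h, h, h, cohomologyMul_class]
    rfl
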